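/- **Setting.** Let $T>0$, let $\mathcal V$ be a real Hilbert space and $\mathcal W,\mathcal X$ Banach spaces with $\mathcal V\hookrightarrow^c\mathcal W\hookrightarrow\mathcal V\hookrightarrow\mathcal X$ (the case $\mathcal Z=\mathcal V$ of a chain $\mathcal Z\hookrightarrow^c\mathcal W\hookrightarrow\mathcal V\hookrightarrow\mathcal X$, where $\hookrightarrow^c$ is a compact embedding; e.g. $\mathcal V=\mathbb R^n$). Let $\mathbb V\in L(\mathcal V,\mathcal V^*)$ be self-adjoint and coercive, $\|v\|_{\mathbb V}=\langle\mathbb Vv,v\rangle^{1/2}$, $\|\eta\|_{\mathbb V^{-1}}=\langle\eta,\mathbb V^{-1}\eta\rangle^{1/2}$. Let $\mathcal R:\mathcal X\to[0,\infty)$ be convex, lower semicontinuous and positively $1$-homogeneous with $\rho\|v\|_{\mathcal X}\le\mathcal R(v)\le R\|v\|_{\mathcal V}$ for $v\in\mathcal V$ and constants $\rho,R>0$; $\mathcal R$ is regarded as a function on $\mathcal V$. Let $z_0\in\mathcal V$ and $$\mathcal I(t,z)=\tfrac12\langle Az,z\rangle+\mathcal F(z)-f(t,z),$$ where * $A\in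 L(\mathcal V,\mathcal V^*)$ is self-adjoint and coercive; * $\mathcal F\in C^2(\mathcal V)$, $\mathcal F\ge0$, $\|D^2\mathcal F(z)v\|_{\mathcal V^*}\le C(1+\|z\|^q)\|v\|$ for some $C>0$, $q\ge1$, and $z_k\rightharpoonup z$ implies $D\mathcal F(z_k)\rightharpoonup D\mathcal F(z)$; * $f\in C^1([0,T]\times\mathcal V)$, $f(t,z)\le c(\|z\|+1)$, $|\partial_tf(t,z)|\le\mu(\|z\|+1)$, $f(t,\cdot)$ is weakly sequentially continuous, $t_k\to t$ in $[0,T]$ and $z_k\rightharpoonup z$ imply $\partial_tf(t_k,z_k)\to\partial_tf(t,z)$, and $|\langle D_zf(t_1,z_1)-D_zf(t_2,z_2),v\rangle|\le\nu(|t_1-t_2|+\|z_1-z_2\|_{\mathcal W})\|v\|_{\mathcal V}$, with constants $c,\mu,\nu>0$. Since the last step of the scheme below may pass beyond $T$, $f$ is taken to be continued to times $t>T$ such that $f(t,\cdot)$ is differentiable and the last bound holds for all $t_1,t_2\ge0$ (for instance $f(t,\cdot)=f(T,\cdot)$ for $t>T$). Put $\operatorname{dist}\{\eta,\partial\mathcal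 R(0)\}=\inf\{\|w\|_{\mathbb V^{-1}}:w\in\partial\mathcal R(0)-\eta\}$ and $d(t,z)=\operatorname{dist}\{-D_z\mathcal I(t,z),\partial\mathcal R(0)\}$. **Solutions.** $(\hat t,\hat z)$ is a *$\mathbb V$-parametrized BV solution* on $[0,S]$, $S\ge T$, if $\hat t\in W^{1,\infty}(0,S)$, $\hat z\in W^{1,\infty}(0,S;\mathcal V)$ (continuous representatives), $\hat z(0)=z_0$, $\hat t(0)=0$, $\hat t(S)=T$; for a.a. $s\in(0,S)$: $\hat t'\ge0$, $\hat t'+\|\hat z'\|_{\mathbb V}\le1$ and $\hat t'\,d(\hat t,\hat z)=0$; and for all $s\in[0,S]$ $$\mathcal I(\hat t(s),\hat z(s))+\int_0^s\mathcal R(\hat z')+\|\hat z'\|_{\mathbb V}\,d(\hat t,\hat z)\,d\sigma=\mathcal I(0,z_0)+\int_0^s\partial_t\mathcal I(\hat t,\hat z)\,\hat t'\,d\sigma.$$ **Scheme** with tolerance $\mathrm{tol}>0$ and initial step size $\tau_1>0$. Start with $t_0=s_0=0$, the initial state $z_0$, $\tau=\tau_1$ and $k=1$. While $t_{k-1}<T$: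 compute any $z_k$ with $$0\in\partial(\mathcal R+I_\tau)(z_k-z_{k-1})+D_z\mathcal I(t_{k-1},z_k),\qquad \mathcal I(t_{k-1},z_k)+\mathcal R(z_k-z_{k-1})\le\mathcal I(t_{k-1},z_{k-1}),$$ where $I_\tau$ is the indicator function of $\{\|v\|_{\mathbb V}\le\tau\}$; set $t_k=t_{k-1}+\tau-\|z_k-z_{k-1}\|_{\mathbb V}$ and $s_k=s_{k-1}+\tau$; on $[s_{k-1},s_k)$ let $\hat t,\hat z$ be the affine interpolants of $t_{k-1},t_k$ and of $z_{k-1},z_k$; compute $$I_1^k=\int_{s_{k-1}}^{s_k}\hat t'\,d(\hat t,\hat z)\,ds,\qquad I_2^k=\int_{s_{k-1}}^{s_k}\langle D_z\mathcal I(\hat t,\hat z)-D_z\mathcal I(t_{k-1},z_k),\hat z'\rangle+\|\hat z'\|_{\mathbb V}\big(d(\hat t,\hat z)-d(t_{k-1},z_k)\big)ds.$$ If $I_1^k,I_2^k<\mathrm{tol}$, accept the step and go on to $k+1$, with $\tau$ doubled if even $I_1^k,I_2^k<\mathrm{tol}/2$ and with $\tau$ unchanged otherwise; if not, reject it, halve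 $\tau$ and repeat it. After the last accepted step the interpolants are continued by constants. **Theorem.** The scheme can be run for all $\mathrm{tol},\tau_1>0$. Let $\mathrm{tol}_n>0$ tend to zero, let the initial step sizes $\tau_1^n>0$ be arbitrary, and for each $n$ consider any execution of the scheme. Then each of these executions reaches the final time after finitely many passes, and $S_n=\min\{s\ge0:\hat t_n(s)=T\}$ exists. There are a subsequence (not relabelled), $S$, $\hat t$ and $\hat z$ such that $$S_n\to S,\qquad \hat t_n\rightharpoonup^*\hat t\ \text{ in }W^{1,\infty}(0,S),\qquad \hat z_n\rightharpoonup^*\hat z\ \text{ in }W^{1,\infty}(0,S;\mathcal V),$$ that is, the functions and their weak derivatives converge weakly* in $L^\infty(0,S)$ and in $L^\infty(0,S;\mathcal V)=L^1(0,S;\mathcal V^*)^*$, respectively. Moreover, whenever a subsequence converges in this sense, its limit $(\hat t,\hat z)$ is a $\mathbb V$-parametrized BV solution on $[0,S]$. -/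

import Mathlib

open Set Filter Topology MeasureTheory

noncomputable section

/-! ### `W^{1,∞}(0,S;E)` and its weak* convergence -/

section Sobolev

variable {E : Type*} [NormedAddCommGroup E] [NormedSpace ℝ E]

/-- `u ∈ W^{1,∞}(0,S;E)`, given by its continuous representative on `[0,S]`, with weak
derivative `u'`. -/
structure MemW1Inf (S : ℝ) (u u' : ℝ → E) : Prop where
  continuousOn : ContinuousOn u (Icc 0 S)
  memLp : MemLp u ⊤ (volume.restrict (Ioo 0 S))
  memLp_deriv : MemLp u' ⊤ (volume.restrict (Ioo 0 S))
  weak_deriv : ∀ φ : ℝ → ℝ, ContDiff ℝ ((⊤ : ℕ∞) : WithTop ℕ∞) φ → HasCompactSupport φ →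
    tsupport φ ⊆ Ioo 0 S →
    ∫ s in Ioo 0 S, deriv φ s • u s = -∫ s in Ioo 0 S, φ s • u' s

/-- Weak* convergence in `L^∞(0,S;E)`, tested with `L¹(0,S;E*)`. -/
def TendstoWeakStarLInf (S : ℝ) (u : ℕ → ℝ → E) (v : ℝ → E) : Prop :=
  ∀ φ : ℝ → (E →L[ℝ] ℝ), IntegrableOn φ (Ioo 0 S) →
    Tendsto (fun n => ∫ s in Ioo 0 S, φ s (u n s)) atTop (𝓝 (∫ s in Ioo 0 S, φ s (v s)))

/-- Weak* convergence in `W^{1,∞}(0,S;E)`: the functions and their weak derivatives (which are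
unique a.e.) converge weakly* in `L^∞(0,S;E)`. -/
def TendstoWeakStarW1Inf (S : ℝ) (u : ℕ → ℝ → E) (v : ℝ → E) : Prop :=
  ∃ (u' : ℕ → ℝ → E) (v' : ℝ → E),
    (∀ n, MemW1Inf S (u n) (u' n)) ∧ MemW1Inf S v v' ∧
    TendstoWeakStarLInf S u v ∧ TendstoWeakStarLInf S u' v'

/-- Weak convergence of a sequence in `E`. -/
def WeakConv (x : ℕ → E) (y : E) : Prop :=
  ∀ l : E →L[ℝ] ℝ, Tendsto (fun n => l (x n)) atTop (𝓝 (l y))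

/-- Convex subdifferential of an extended-real-valued function. (It is empty at points where
`G = ⊤` as soon as `G` is finite somewhere.) -/
def convexSubdiff (G : E → EReal) (v : E) : Set (E →L[ℝ] ℝ) :=
  {ξ | ∀ w, G v + ((ξ (w - v) : ℝ) : EReal) ≤ G w}

/-- Piecewise affine interpolant of the nodes `(σ j, x j)`, continued by the constant `x N`
outside the intervals `[σ j, σ (j+1))`. -/
def affineInterp (σ : ℕ → ℝ) (x : ℕ → E) (N : ℕ) (s : ℝ) : E :=
  open Classical in
  if h : ∃ j, s ∈ Ico (σ j) (σ (j + 1)) then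
    x h.choose + ((s - σ h.choose) / (σ (h.choose + 1) - σ h.choose)) •
      (x (h.choose + 1) - x h.choose)
  else x N

end Sobolev

/-! ### The rate-independent system, in the case where the state space `Z` equals `V` -/

/-- The data of the rate-independent system for `Z = V`. -/
structure RISData (V W X : Type*) [NormedAddCommGroup V] [InnerProductSpace ℝ V]
    [NormedAddCommGroup W] [NormedSpace ℝ W] [NormedAddCommGroup X] [NormedSpace ℝ X] where
  /-- final time -/
  T : ℝ
  /-- embedding `Z = V → W` -/
  iZW : V →L[ℝ] W
  /-- embedding `W → V` -/
  iWV : W →L[ℝ] V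
  /-- embedding `V → X` -/
  iVX : V →L[ℝ] X
  /-- viscosity operator `𝕍 : V → V*` -/
  Vop : V →L[ℝ] (V →L[ℝ] ℝ)
  /-- dissipation -/
  R : X → ℝ
  /-- initial state -/
  z₀ : V
  /-- quadratic part of the energy -/
  A : V →L[ℝ] (V →L[ℝ] ℝ)
  /-- nonlinear part of the energy -/
  F : V → ℝ
  /-- time-dependent part of the energy; only its values for times `t ≥ 0` matter -/
  f : ℝ → V → ℝ

namespace RISData

variable {V W X : Type*} [NormedAddCommGroup V] [InnerProductSpace ℝ V]
  [NormedAddCommGroup W] [NormedSpace ℝ W] [NormedAddCommGroup X] [NormedSpace ℝ X]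
  (D : RISData V W X)

/-- Partial time derivative of `f` on `[0,T]` (one-sided at the end points). -/
def dtf (t : ℝ) (z : V) : ℝ := derivWithin (fun r => D.f r z) (Icc 0 D.T) t

/-- The standing assumptions, for `Z = V`. -/
structure StandingAssumptions : Prop where
  T_pos : 0 < D.T
  -- spaces: `Z` embeds compactly into `W`, and `W ⊆ V ⊆ X` continuously
  iZW_compact : IsCompactOperator D.iZW
  iWV_injective : Function.Injective D.iWV
  iWV_iZW : ∀ v, D.iWV (D.iZW v) = v
  iVX_injective : Function.Injective D.iVX
  -- viscosity operator
  Vop_symm : ∀ v w, D.Vop v w = D.Vop w v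
  Vop_coercive : ∃ γ : ℝ, 0 < γ ∧ ∀ v, γ * ‖v‖ ^ 2 ≤ D.Vop v v
  -- dissipation
  R_nonneg : ∀ x, 0 ≤ D.R x
  R_convex : ConvexOn ℝ univ D.R
  R_lsc : LowerSemicontinuous D.R
  R_homogeneous : ∀ (c : ℝ) (x : X), 0 < c → D.R (c • x) = c * D.R x
  R_bounds : ∃ ρ R₀ : ℝ, 0 < ρ ∧ 0 < R₀ ∧
    ∀ v : V, ρ * ‖D.iVX v‖ ≤ D.R (D.iVX v) ∧ D.R (D.iVX v) ≤ R₀ * ‖v‖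
  -- energy, quadratic part
  A_symm : ∀ v w, D.A v w = D.A w v
  A_coercive : ∃ α : ℝ, 0 < α ∧ ∀ v, α * ‖v‖ ^ 2 ≤ D.A v v
  -- energy, nonlinear part
  F_contDiff : ContDiff ℝ 2 D.F
  F_nonneg : ∀ z, 0 ≤ D.F z
  F_growth : ∃ C q : ℝ, 0 < C ∧ 1 ≤ q ∧
    ∀ z v : V, ‖fderiv ℝ (fderiv ℝ D.F) z v‖ ≤ C * (1 + ‖z‖ ^ q) * ‖v‖
  F_weak : ∀ (x : ℕ → V) (z : V), WeakConv x z →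
    ∀ v, Tendsto (fun k => fderiv ℝ D.F (x k) v) atTop (𝓝 (fderiv ℝ D.F z v))
  -- energy, time-dependent part
  f_contDiffOn : ContDiffOn ℝ 1 (fun p : ℝ × V => D.f p.1 p.2) (Icc 0 D.T ×ˢ univ)
  f_growth : ∃ c : ℝ, 0 < c ∧ ∀ t ∈ Icc 0 D.T, ∀ z, D.f t z ≤ c * (‖z‖ + 1)
  dtf_growth : ∃ μ : ℝ, 0 < μ ∧ ∀ t ∈ Icc 0 D.T, ∀ z, |D.dtf t z| ≤ μ * (‖z‖ + 1)
  /- The last step of the scheme may overshoot `T`, and its residuals evaluate `D_z f` at times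
  beyond `T`. So `f` is continued past `T` such that `D_z f` exists there and keeps its Lipschitz
  bound, for instance by `f t = f T` for `t > T`. Nothing else is asked for beyond `T`. -/
  f_differentiable : ∀ t, 0 ≤ t → Differentiable ℝ (D.f t)
  f_lipschitz : ∃ ν : ℝ, 0 < ν ∧ ∀ t₁ t₂ : ℝ, 0 ≤ t₁ → 0 ≤ t₂ → ∀ z₁ z₂ v : V,
    |(fderiv ℝ (D.f t₁) z₁ - fderiv ℝ (D.f t₂) z₂) v| ≤
      ν * (|t₁ - t₂| + ‖D.iZW (z₁ - z₂)‖) * ‖v‖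
  f_weak : ∀ t ∈ Icc 0 D.T, ∀ (x : ℕ → V) (z : V), WeakConv x z →
    Tendsto (fun k => D.f t (x k)) atTop (𝓝 (D.f t z))
  dtf_weak : ∀ (r : ℕ → ℝ) (t : ℝ) (x : ℕ → V) (z : V), (∀ k, r k ∈ Icc 0 D.T) →
    t ∈ Icc 0 D.T → Tendsto r atTop (𝓝 t) → WeakConv x z →
    Tendsto (fun k => D.dtf (r k) (x k)) atTop (𝓝 (D.dtf t z))

/-- The dissipation as a function on `V`. -/
def Rv (v : V) : ℝ := D.R (D.iVX v)

/-- The norm `‖v‖_𝕍 = ⟨𝕍 v, v⟩^{1/2}`. -/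
def normV (v : V) : ℝ := Real.sqrt (D.Vop v v)

/-- The dual norm `‖η‖_{𝕍⁻¹} = ⟨η, 𝕍⁻¹ η⟩^{1/2}`. -/
def normVinv (η : V →L[ℝ] ℝ) : ℝ := Real.sqrt (η (D.Vop.inverse η))

/-- The energy `𝓘(t,z)`. -/
def energy (t : ℝ) (z : V) : ℝ := 1 / 2 * D.A z z + D.F z - D.f t z

/-- `D_z 𝓘(t,z)`. -/
def dzEnergy (t : ℝ) (z : V) : V →L[ℝ] ℝ := fderiv ℝ (D.energy t) z

/-- `∂_t 𝓘(t,z)` on `[0,T]`. -/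
def dtEnergy (t : ℝ) (z : V) : ℝ := derivWithin (fun r => D.energy r z) (Icc 0 D.T) t

/-- `∂R(0)`. -/
def subdiffZero : Set (V →L[ℝ] ℝ) := convexSubdiff (fun v => ((D.Rv v : ℝ) : EReal)) 0

/-- `dist_{V*}{η, ∂R(0)} = inf {‖w‖_{𝕍⁻¹} : w ∈ ∂R(0) - η}`. For `Z = V` and under the standing
assumptions the set is nonempty, since `0 ∈ ∂R(0)`, so that the infimum is a real number. -/
def distSubdiff (η : V →L[ℝ] ℝ) : ℝ := sInf (D.normVinv '' {w | w + η ∈ D.subdiffZero})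

/-- `(t,z) ↦ dist_{V*}{-D_z 𝓘(t,z), ∂R(0)}`. -/
def stabDist (t : ℝ) (z : V) : ℝ := D.distSubdiff (-D.dzEnergy t z)

/-- `𝕍`-parametrized BV solution on `[0,S]`. -/
def IsParamBVSolution (S : ℝ) (that : ℝ → ℝ) (zhat : ℝ → V) : Prop :=
  D.T ≤ S ∧ ∃ (t' : ℝ → ℝ) (z' : ℝ → V),
    MemW1Inf S that t' ∧ MemW1Inf S zhat z' ∧
    zhat 0 = D.z₀ ∧ that 0 = 0 ∧ that S = D.T ∧
    (∀ᵐ s ∂(volume.restrict (Ioo 0 S)), 0 ≤ t' s ∧ t' s + D.normV (z' s) ≤ 1) ∧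
    (∀ᵐ s ∂(volume.restrict (Ioo 0 S)), t' s * D.stabDist (that s) (zhat s) = 0) ∧
    ∀ s ∈ Icc 0 S,
      D.energy (that s) (zhat s) +
          ∫ σ in (0 : ℝ)..s, (D.Rv (z' σ) + D.normV (z' σ) * D.stabDist (that σ) (zhat σ)) =
        D.energy 0 D.z₀ + ∫ σ in (0 : ℝ)..s, D.dtEnergy (that σ) (zhat σ) * t' σ

/-! ### The adaptive incremental stationary scheme -/

/-- The indicator functional of the closed `𝕍`-ball of radius `τ`. -/
def ballIndicator (τ : ℝ) (v : V) : EReal :=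
  open Classical in if D.normV v ≤ τ then 0 else ⊤

/-- `z` is an admissible new iterate for the old iterate `(t₀, z₀)` and the step size `τ`:
`0 ∈ ∂(R + I_τ)(z - z₀) + D_z 𝓘(t₀,z)` and `𝓘(t₀,z) + R(z - z₀) ≤ 𝓘(t₀,z₀)`. -/
def IsIterate (t₀ : ℝ) (z₀ : V) (τ : ℝ) (z : V) : Prop :=
  -D.dzEnergy t₀ z ∈
      convexSubdiff (fun v => ((D.Rv v : ℝ) : EReal) + D.ballIndicator τ v) (z - z₀) ∧
    D.energy t₀ z + D.Rv (z - z₀) ≤ D.energy t₀ z₀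

/-- Time update. -/
def newTime (t₀ : ℝ) (z₀ : V) (τ : ℝ) (z : V) : ℝ := t₀ + τ - D.normV (z - z₀)

/-- First residual of a step with old iterate `(t₀, z₀)`, old curve parameter `s₀`, step size
`τ` and new iterate `z`. -/
def resid₁ (s₀ t₀ : ℝ) (z₀ : V) (τ : ℝ) (z : V) : ℝ :=
  let t' := (D.newTime t₀ z₀ τ z - t₀) / τ
  let z' := τ⁻¹ • (z - z₀)
  ∫ s in s₀..(s₀ + τ), t' * D.stabDist (t₀ + (s - s₀) * t') (z₀ + (s - s₀) • z')

/-- Second residual of a step. -/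
def resid₂ (s₀ t₀ : ℝ) (z₀ : V) (τ : ℝ) (z : V) : ℝ :=
  let t' := (D.newTime t₀ z₀ τ z - t₀) / τ
  let z' := τ⁻¹ • (z - z₀)
  ∫ s in s₀..(s₀ + τ),
    ((D.dzEnergy (t₀ + (s - s₀) * t') (z₀ + (s - s₀) • z') - D.dzEnergy t₀ z) z' +
      D.normV z' *
        (D.stabDist (t₀ + (s - s₀) * t') (z₀ + (s - s₀) • z') - D.stabDist t₀ z))

end RISData

/-- State of the scheme: the last accepted curve parameter `s`, time `t` and state `z`, and the
step size `τ` that is tried next. -/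
structure AlgState (V : Type*) where
  s : ℝ
  t : ℝ
  z : V
  τ : ℝ

namespace RISData

variable {V W X : Type*} [NormedAddCommGroup V] [InnerProductSpace ℝ V]
  [NormedAddCommGroup W] [NormedSpace ℝ W] [NormedAddCommGroup X] [NormedSpace ℝ X]
  (D : RISData V W X)

/-- One pass through the body of the loop with tolerance `tol`: compute an admissible new iterate
`z` and the residuals. If both residuals are below `tol`, the step is accepted, and the step size
is doubled if both are even below `tol / 2`. Otherwise the step is rejected and the step size is
halved. -/
def LoopPass (tol : ℝ) (a b : AlgState V) : Prop :=
  ∃ z : V, D.IsIterate a.t a.z a.τ z ∧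
    (((D.resid₁ a.s a.t a.z a.τ z < tol ∧ D.resid₂ a.s a.t a.z a.τ z < tol) ∧
        b.s = a.s + a.τ ∧ b.t = D.newTime a.t a.z a.τ z ∧ b.z = z ∧
        ((D.resid₁ a.s a.t a.z a.τ z < tol / 2 ∧ D.resid₂ a.s a.t a.z a.τ z < tol / 2 ∧
            b.τ = 2 * a.τ) ∨
          (¬(D.resid₁ a.s a.t a.z a.τ z < tol / 2 ∧ D.resid₂ a.s a.t a.z a.τ z < tol / 2) ∧
            b.τ = a.τ))) ∨
      (¬(D.resid₁ a.s a.t a.z a.τ z < tol ∧ D.resid₂ a.s a.t a.z a.τ z < tol) ∧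
        b.s = a.s ∧ b.t = a.t ∧ b.z = a.z ∧ b.τ = a.τ / 2))

/-- `a` is an execution of the scheme with tolerance `tol` and initial step size `τ₁`; `a j` is
the state after `j` passes through the loop. The loop is left as soon as the final time is
reached; from then on the state is kept. -/
structure IsExecution (tol τ₁ : ℝ) (a : ℕ → AlgState V) : Prop where
  init : a 0 = ⟨0, 0, D.z₀, τ₁⟩
  pass : ∀ j, (a j).t < D.T → D.LoopPass tol (a j) (a (j + 1))
  final : ∀ j, D.T ≤ (a j).t → a (j + 1) = a j

/-- Number of passes after which the final time is reached. -/
def stopIndex (a : ℕ → AlgState V) : ℕ := sInf {j | D.T ≤ (a j).t}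

/-- The affine interpolant `t̂` of an execution. (A rejected pass leaves `s`, `t`, `z` unchanged
and contributes an empty interval.) -/
def tHat (a : ℕ → AlgState V) : ℝ → ℝ :=
  affineInterp (fun j => (a j).s) (fun j => (a j).t) (D.stopIndex a)

/-- The affine interpolant `ẑ` of an execution. -/
def zHat (a : ℕ → AlgState V) : ℝ → V :=
  affineInterp (fun j => (a j).s) (fun j => (a j).z) (D.stopIndex a)

/-- The end point `min {s ≥ 0 : t̂(s) = T}` of the curve parameter. -/
def endParam (a : ℕ → AlgState V) : ℝ := sInf {s | 0 ≤ s ∧ D.tHat a s = D.T}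

end RISData

end

/-! ### Lipschitz curves: weak derivatives, weak* convergence and pointwise convergence. -/

section LipschitzCurves

open scoped NNReal

variable {E : Type*} [NormedAddCommGroup E] [NormedSpace ℝ E]

/-! The identity of `V` factors through a compact embedding, so `V` has finite dimension. Weak
convergence is strong there, and for curves with a common Lipschitz constant weak* convergence in
`W^{1,∞}` amounts to pointwise convergence. Compactness is then an Arzelà–Ascoli argument, and the
real work lies in the bounds and in the limit equation.

The algebraic core is duality: the distance of `ξ` to `∂R(0)` is the maximum of `ξ v - R v` over the
unit ball of `𝕍`. Hence `ξ v ≤ R v + ‖v‖_𝕍 dist ξ` always (`apply_le_Rv_add`), and the inclusion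
solved by the scheme says that equality holds for the increment and that either the increment has
full length `τ` or the distance vanishes (`convexSubdiff_ball_eq`). Inserting this, the integrand of
the second residual becomes the defect `⟨D_z I, z'⟩ + R z' + ‖z'‖_𝕍 d`, which is nonnegative at
every point; so is the integrand of the first residual. Both integrands vanish when evaluated at the
new state and old time, so Lipschitz continuity of the forces makes the residuals at most `C τ²` on
bounded sets (`exists_resid_le`).

A discrete Gronwall argument on the energy estimate bounds the states before `T`, and the
dissipation bounds the arc length, uniformly over all executions (`exists_apriori_bound`). A
rejection needs `tol ≤ C τ²`, so step sizes stay away from zero; bounded arc length then excludes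
infinitely many passes (`exists_final`). An accepted residual is below both `tol` and `C τ²`, hence
below their geometric mean, which is linear in `τ`; summed over the execution, the residuals are at
most a multiple of `√tol` plus `tol` for the last step (`exists_resid_sum_bound`).

For the limit, the force and the distance are frozen on a short interval `[r,s]`. The dissipation
potential is sublinear, so its value at the increment of the interpolant is bounded by the weighted
sum over the steps; nonnegativity of the integrands lets the residuals control parts of steps
(`exists_local_balance`). As `tol → 0` only an error of order `(s - r)²` remains
(`exists_limit_local_balance`). Division by `s - r` at a point of differentiability yields
complementarity and one inequality of the force balance; the other is the duality inequality. The
chain rule integrates the balance to the energy identity (`energy_balance`). -/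

theorem LipschitzOnWith.ae_differentiableAt_Ioo [FiniteDimensional ℝ E] {u : ℝ → E} {K : ℝ≥0} {S : ℝ}
    (hu : LipschitzOnWith K u (Icc 0 S)) :
    ∀ᵐ s ∂(volume.restrict (Ioo 0 S)), DifferentiableAt ℝ u s := by
  have h := (hu.mono Ioo_subset_Icc_self).ae_differentiableWithinAt_real measurableSet_Ioo
  filter_upwards [h, ae_restrict_mem measurableSet_Ioo] with s hs hmem
  exact hs.differentiableAt (Ioo_mem_nhds hmem.1 hmem.2)

theorem LipschitzOnWith.norm_deriv_le_Ioo {u : ℝ → E} {K : ℝ≥0} {S : ℝ}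
    (hu : LipschitzOnWith K u (Icc 0 S)) {s : ℝ} (hs : s ∈ Ioo 0 S) : ‖deriv u s‖ ≤ K :=
  norm_deriv_le_of_lipschitzOn (Icc_mem_nhds hs.1 hs.2) hu

theorem LipschitzOnWith.memLp_deriv_Ioo [FiniteDimensional ℝ E] {u : ℝ → E} {K : ℝ≥0} {S : ℝ}
    (hu : LipschitzOnWith K u (Icc 0 S)) : MemLp (deriv u) ⊤ (volume.restrict (Ioo 0 S)) := by
  refine memLp_top_of_bound (stronglyMeasurable_deriv u).aestronglyMeasurable K ?_
  filter_upwards [ae_restrict_mem measurableSet_Ioo] with s hs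
  exact hu.norm_deriv_le_Ioo hs

omit [NormedSpace ℝ E] in
theorem ContinuousOn.memLp_top_Ioo {u : ℝ → E} {S : ℝ} (hu : ContinuousOn u (Icc 0 S)) :
    MemLp u ⊤ (volume.restrict (Ioo 0 S)) := by
  obtain ⟨C, hC⟩ := isCompact_Icc.exists_bound_of_continuousOn hu
  refine memLp_top_of_bound
    ((hu.mono Ioo_subset_Icc_self).aestronglyMeasurable measurableSet_Ioo) C ?_
  filter_upwards [ae_restrict_mem measurableSet_Ioo] with s hs
  exact hC s (Ioo_subset_Icc_self hs)

/-- Fundamental theorem of calculus for real Lipschitz functions. -/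
theorem LipschitzOnWith.setIntegral_deriv {u : ℝ → ℝ} {K : ℝ≥0} {S : ℝ} (hS : 0 ≤ S)
    (hu : LipschitzOnWith K u (Icc 0 S)) : ∫ s in Ioo 0 S, deriv u s = u S - u 0 := by
  have h := (LipschitzOnWith.absolutelyContinuousOnInterval (a := 0) (b := S)
    (by rwa [uIcc_of_le hS])).integral_deriv_eq_sub
  rwa [intervalIntegral.integral_of_le hS, integral_Ioc_eq_integral_Ioo] at h

theorem integrableOn_Ioo_clm_apply {S K : ℝ} {φ : ℝ → (E →L[ℝ] ℝ)} {u : ℝ → E}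
    (hφ : IntegrableOn φ (Ioo 0 S)) (hu : AEStronglyMeasurable u (volume.restrict (Ioo 0 S)))
    (hK : ∀ s ∈ Ioo 0 S, ‖u s‖ ≤ K) : IntegrableOn (fun s => φ s (u s)) (Ioo 0 S) := by
  refine Integrable.mono' (hφ.norm.mul_const K) ?_ ?_
  · exact (ContinuousLinearMap.apply ℝ ℝ : E →L[ℝ] _).flip.aestronglyMeasurable_comp₂
      hφ.aestronglyMeasurable hu
  · filter_upwards [ae_restrict_mem measurableSet_Ioo] with s hs
    exact ((φ s).le_opNorm _).trans (by gcongr; exact hK s hs)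

theorem ContDiff.exists_lipschitzOnWith_Icc {F : Type*} [NormedAddCommGroup F] [NormedSpace ℝ F]
    {φ : ℝ → F} (hφ : ContDiff ℝ 1 φ) (a b : ℝ) : ∃ K : ℝ≥0, LipschitzOnWith K φ (Icc a b) :=
  hφ.contDiffOn.exists_lipschitzOnWith one_ne_zero (convex_Icc a b) isCompact_Icc

/-- The pairing of a Lipschitz curve with a Lipschitz curve of functionals is Lipschitz. -/
theorem LipschitzOnWith.clm_apply_Icc {φ : ℝ → (E →L[ℝ] ℝ)} {u : ℝ → E} {K L : ℝ≥0} {S : ℝ}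
    (hφ : LipschitzOnWith L φ (Icc 0 S)) (hu : LipschitzOnWith K u (Icc 0 S)) :
    ∃ C : ℝ≥0, LipschitzOnWith C (fun s => φ s (u s)) (Icc 0 S) := by
  obtain ⟨A, hA⟩ := isCompact_Icc.exists_bound_of_continuousOn hφ.continuousOn
  obtain ⟨B, hB⟩ := isCompact_Icc.exists_bound_of_continuousOn hu.continuousOn
  refine ⟨Real.toNNReal (A * K + L * B), LipschitzOnWith.of_dist_le_mul fun x hx y hy => ?_⟩
  have hA0 : 0 ≤ A := (norm_nonneg _).trans (hA x hx)
  have hB0 : 0 ≤ B := (norm_nonneg _).trans (hB x hx)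
  rw [Real.coe_toNNReal _ (by positivity), Real.dist_eq]
  have h1 : φ x (u x) - φ y (u y) = φ x (u x - u y) + (φ x - φ y) (u y) := by
    simp [map_sub]
  have h2 := hu.dist_le_mul x hx y hy
  have h3 := hφ.dist_le_mul x hx y hy
  rw [dist_eq_norm] at h2 h3
  calc |φ x (u x) - φ y (u y)| ≤ ‖φ x (u x - u y)‖ + ‖(φ x - φ y) (u y)‖ := by
        rw [h1]; exact abs_add_le _ _
    _ ≤ ‖φ x‖ * ‖u x - u y‖ + ‖φ x - φ y‖ * ‖u y‖ :=
        add_le_add ((φ x).le_opNorm _) ((φ x - φ y).le_opNorm _)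
    _ ≤ A * (K * dist x y) + (L * dist x y) * B := by
        gcongr
        · exact hA x hx
        · exact hB y hy
    _ = _ := by ring

/-- Integration by parts for a Lipschitz curve and a smooth curve of functionals. -/
theorem LipschitzOnWith.integral_clm_deriv [FiniteDimensional ℝ E] {u : ℝ → E} {K : ℝ≥0}
    {S : ℝ} (hS : 0 ≤ S) (hu : LipschitzOnWith K u (Icc 0 S)) {φ : ℝ → (E →L[ℝ] ℝ)} (hφ : ContDiff ℝ 1 φ) :
    ∫ s in Ioo 0 S, φ s (deriv u s) =
      φ S (u S) - φ 0 (u 0) - ∫ s in Ioo 0 S, deriv φ s (u s) := by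
  obtain ⟨L, hL⟩ := hφ.exists_lipschitzOnWith_Icc 0 S
  obtain ⟨C, hC⟩ := hL.clm_apply_Icc hu
  have h1 := hC.setIntegral_deriv hS
  have hint : ∀ ψ : ℝ → (E →L[ℝ] ℝ), Continuous ψ → IntegrableOn ψ (Ioo 0 S) := fun ψ hψ =>
    hψ.integrableOn_Icc.mono_set Ioo_subset_Icc_self
  have hi1 : IntegrableOn (fun s => φ s (deriv u s)) (Ioo 0 S) :=
    integrableOn_Ioo_clm_apply (hint φ hφ.continuous)
      (stronglyMeasurable_deriv u).aestronglyMeasurable fun s hs => hu.norm_deriv_le_Ioo hs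
  obtain ⟨B, hB⟩ := isCompact_Icc.exists_bound_of_continuousOn hu.continuousOn
  have hi2 : IntegrableOn (fun s => deriv φ s (u s)) (Ioo 0 S) :=
    integrableOn_Ioo_clm_apply (hint _ (hφ.continuous_deriv le_rfl))
      ((hu.continuousOn.mono Ioo_subset_Icc_self).aestronglyMeasurable measurableSet_Ioo)
      fun s hs => hB s (Ioo_subset_Icc_self hs)
  have h2 : ∫ s in Ioo 0 S, deriv (fun s => φ s (u s)) s =
      ∫ s in Ioo 0 S, (deriv φ s (u s) + φ s (deriv u s)) := by
    refine integral_congr_ae ?_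
    filter_upwards [hu.ae_differentiableAt_Ioo] with s hs
    exact ((hφ.differentiable one_ne_zero s).hasDerivAt.clm_apply hs.hasDerivAt).deriv
  rw [h2, integral_add hi2 hi1] at h1
  linarith

/-- Lipschitz curves belong to `W^{1,∞}`. -/
theorem LipschitzOnWith.memW1Inf [FiniteDimensional ℝ E] {u : ℝ → E} {K : ℝ≥0}
    {S : ℝ} (hS : 0 ≤ S) (hu : LipschitzOnWith K u (Icc 0 S)) : MemW1Inf S u (deriv u) where
  continuousOn := hu.continuousOn
  memLp := hu.continuousOn.memLp_top_Ioo
  memLp_deriv := hu.memLp_deriv_Ioo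
  weak_deriv := by
    intro φ hφ _ hsupp
    have hφ1 : ContDiff ℝ 1 φ := hφ.of_le (by exact_mod_cast le_top)
    have h0 : φ 0 = 0 := image_eq_zero_of_notMem_tsupport fun h => (hsupp h).1.false
    have h1 : φ S = 0 := image_eq_zero_of_notMem_tsupport fun h => (hsupp h).2.false
    have hi1 : IntegrableOn (fun s => deriv φ s • u s) (Ioo 0 S) :=
      (((hφ1.continuous_deriv le_rfl).continuousOn.smul hu.continuousOn).integrableOn_Icc).mono_set
        Ioo_subset_Icc_self
    have hi2 : IntegrableOn (fun s => φ s • deriv u s) (Ioo 0 S) := by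
      have hφi : IntegrableOn φ (Ioo 0 S) :=
        hφ1.continuous.integrableOn_Icc.mono_set Ioo_subset_Icc_self
      refine Integrable.mono' (hφi.norm.mul_const (K : ℝ))
        (hφi.aestronglyMeasurable.smul (stronglyMeasurable_deriv u).aestronglyMeasurable) ?_
      filter_upwards [ae_restrict_mem measurableSet_Ioo] with s hs
      rw [norm_smul]
      gcongr
      exact hu.norm_deriv_le_Ioo hs
    -- Functionals separate points, so it suffices to integrate by parts against `φ • l`; the
    -- boundary terms vanish because the support of `φ` lies in the open interval.
    refine (SeparatingDual.eq_iff_forall_dual_eq (R := ℝ)).2 fun l => ?_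
    rw [map_neg, ← l.integral_comp_comm hi1, ← l.integral_comp_comm hi2]
    have h := hu.integral_clm_deriv hS (φ := fun s => φ s • l) (hφ1.smul contDiff_const)
    have hd : ∀ s, deriv (fun s => φ s • l) s = deriv φ s • l := fun s =>
      ((hφ1.differentiable one_ne_zero s).hasDerivAt.smul_const l).deriv
    simp only [hd, smul_apply, h0, h1, zero_smul, zero_apply, sub_zero, zero_sub] at h
    simp only [map_smul, h, neg_neg]

omit [NormedSpace ℝ E] in
/-- A pointwise limit of functions with a common Lipschitz constant is Lipschitz. -/
theorem LipschitzOnWith.of_tendsto {u : ℕ → ℝ → E} {v : ℝ → E} {K : ℝ≥0} {s : Set ℝ}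
    (hu : ∀ᶠ n in atTop, LipschitzOnWith K (u n) s)
    (h : ∀ x ∈ s, Tendsto (fun n => u n x) atTop (𝓝 (v x))) : LipschitzOnWith K v s :=
  LipschitzOnWith.of_dist_le_mul fun x hx y hy =>
    le_of_tendsto ((h x hx).dist (h y hy)) (hu.mono fun _ hn => hn.dist_le_mul x hx y hy)

theorem abs_integral_clm_sub_le {S K : ℝ} {φ ψ : ℝ → (E →L[ℝ] ℝ)} {w : ℝ → E}
    (hφ : IntegrableOn φ (Ioo 0 S)) (hψ : IntegrableOn ψ (Ioo 0 S))
    (hw : AEStronglyMeasurable w (volume.restrict (Ioo 0 S)))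
    (hK : ∀ s ∈ Ioo 0 S, ‖w s‖ ≤ K) :
    |(∫ s in Ioo 0 S, φ s (w s)) - ∫ s in Ioo 0 S, ψ s (w s)| ≤
      K * ∫ s in Ioo 0 S, ‖φ s - ψ s‖ := by
  rw [← integral_sub (integrableOn_Ioo_clm_apply hφ hw hK) (integrableOn_Ioo_clm_apply hψ hw hK),
    ← integral_const_mul, ← Real.norm_eq_abs]
  refine norm_integral_le_of_norm_le ((hφ.sub hψ).norm.const_mul K) ?_
  filter_upwards [ae_restrict_mem measurableSet_Ioo] with s hs
  rw [← sub_apply, mul_comm]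
  exact ((φ s - ψ s).le_opNorm _).trans (by gcongr; exact hK s hs)

theorem tendstoWeakStarLInf_of_pointwise {u : ℕ → ℝ → E} {v : ℝ → E} {S B : ℝ}
    (hu : ∀ n, ContinuousOn (u n) (Icc 0 S)) (hB : ∀ n, ∀ s ∈ Icc 0 S, ‖u n s‖ ≤ B)
    (h : ∀ s ∈ Icc 0 S, Tendsto (fun n => u n s) atTop (𝓝 (v s))) :
    TendstoWeakStarLInf S u v := by
  intro φ hφ
  refine tendsto_integral_of_dominated_convergence (fun s => ‖φ s‖ * B) (fun n => ?_)
    (hφ.norm.mul_const B) (fun n => ?_) ?_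
  · exact (integrableOn_Ioo_clm_apply hφ
      (((hu n).mono Ioo_subset_Icc_self).aestronglyMeasurable measurableSet_Ioo)
      fun s hs => hB n s (Ioo_subset_Icc_self hs)).aestronglyMeasurable
  · filter_upwards [ae_restrict_mem measurableSet_Ioo] with s hs
    exact ((φ s).le_opNorm _).trans (by gcongr; exact hB n s (Ioo_subset_Icc_self hs))
  · filter_upwards [ae_restrict_mem measurableSet_Ioo] with s hs
    exact ((φ s).continuous.tendsto _).comp (h s (Ioo_subset_Icc_self hs))

omit [NormedSpace ℝ E] in
theorem exists_norm_le_of_lipschitzOnWith_of_tendsto {u : ℕ → ℝ → E} {x : E} {K : ℝ≥0} {S : ℝ}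
    (hu : ∀ n, LipschitzOnWith K (u n) (Icc 0 S)) (h : Tendsto (fun n => u n 0) atTop (𝓝 x)) :
    ∃ B, ∀ n, ∀ s ∈ Icc 0 S, ‖u n s‖ ≤ B := by
  obtain ⟨B, hB⟩ := h.norm.bddAbove_range
  refine ⟨B + K * S, fun n s hs => ?_⟩
  have h0 : (0 : ℝ) ∈ Icc 0 S := ⟨le_rfl, hs.1.trans hs.2⟩
  have h1 := (hu n).dist_le_mul s hs 0 h0
  rw [dist_eq_norm, Real.dist_eq, sub_zero, abs_of_nonneg hs.1] at h1
  have h2 : ‖u n 0‖ ≤ B := hB ⟨n, rfl⟩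
  have h3 : (K : ℝ) * s ≤ K * S := by gcongr; exact hs.2
  have h4 := norm_le_norm_add_norm_sub' (u n s) (u n 0)
  linarith

/-- Pointwise convergence of curves with a common Lipschitz constant implies weak* convergence
in `W^{1,∞}`. -/
theorem tendstoWeakStarW1Inf_of_pointwise [FiniteDimensional ℝ E] {u : ℕ → ℝ → E} {v : ℝ → E}
    {K : ℝ≥0} {S : ℝ} (hS : 0 ≤ S) (hu : ∀ n, LipschitzOnWith K (u n) (Icc 0 S))
    (h : ∀ s ∈ Icc 0 S, Tendsto (fun n => u n s) atTop (𝓝 (v s))) :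
    TendstoWeakStarW1Inf S u v := by
  have hv : LipschitzOnWith K v (Icc 0 S) := LipschitzOnWith.of_tendsto (.of_forall hu) h
  obtain ⟨B, hB⟩ := exists_norm_le_of_lipschitzOnWith_of_tendsto hu (h 0 ⟨le_rfl, hS⟩)
  have hLInf := tendstoWeakStarLInf_of_pointwise (fun n => (hu n).continuousOn) hB h
  refine ⟨fun n => deriv (u n), deriv v, fun n => (hu n).memW1Inf hS, hv.memW1Inf hS, hLInf, ?_⟩
  intro φ hφ
  rw [Metric.tendsto_atTop]
  intro ε hε
  -- The derivatives are bounded by `K`, so replacing `φ` by a smooth `g` that is `η`-close in `L¹`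
  -- changes each pairing by at most `ε / 4`.
  set η : ℝ := ε / (4 * (K + 1)) with hη
  have hη0 : 0 < η := by positivity
  obtain ⟨g, -, hg, hgφ⟩ := (memLp_one_iff_integrable.2 hφ).exist_eLpNorm_sub_le
    ENNReal.one_ne_top le_rfl hη0
  have hg1 : ContDiff ℝ 1 g := hg.of_le (by exact_mod_cast le_top)
  have hint : ∀ ψ : ℝ → (E →L[ℝ] ℝ), Continuous ψ → IntegrableOn ψ (Ioo 0 S) := fun ψ hψ =>
    hψ.integrableOn_Icc.mono_set Ioo_subset_Icc_self
  have hgi := hint g hg1.continuous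
  have hsmall : ∫ s in Ioo 0 S, ‖φ s - g s‖ ≤ η := by
    rw [eLpNorm_one_eq_lintegral_enorm] at hgφ
    have h1 := integral_norm_eq_lintegral_enorm (hφ.sub hgi).aestronglyMeasurable
    simp only [Pi.sub_apply] at h1 hgφ
    rw [h1]
    exact ENNReal.toReal_le_of_le_ofReal hη0.le hgφ
  have hclose : ∀ w : ℝ → E, LipschitzOnWith K w (Icc 0 S) →
      |(∫ s in Ioo 0 S, φ s (deriv w s)) - ∫ s in Ioo 0 S, g s (deriv w s)| ≤ ε / 4 := by
    intro w hw
    refine (abs_integral_clm_sub_le hφ hgi (stronglyMeasurable_deriv w).aestronglyMeasurable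
      fun s hs => hw.norm_deriv_le_Ioo hs).trans ?_
    calc (K : ℝ) * ∫ s in Ioo 0 S, ‖φ s - g s‖ ≤ (K + 1) * η := by
          gcongr
          linarith
      _ = ε / 4 := by rw [hη]; field_simp
  -- For smooth `g` the derivative is moved onto `g`; what remains are boundary values and a pairing
  -- with the curves themselves.
  have hconv : Tendsto (fun n => ∫ s in Ioo 0 S, g s (deriv (u n) s)) atTop
      (𝓝 (∫ s in Ioo 0 S, g s (deriv v s))) := by
    simp only [fun n => (hu n).integral_clm_deriv hS hg1, hv.integral_clm_deriv hS hg1]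
    refine Tendsto.sub (Tendsto.sub ?_ ?_) (hLInf _ (hint _ (hg1.continuous_deriv le_rfl)))
    · exact ((g S).continuous.tendsto _).comp (h S ⟨hS, le_rfl⟩)
    · exact ((g 0).continuous.tendsto _).comp (h 0 ⟨le_rfl, hS⟩)
  obtain ⟨N, hN⟩ := Metric.tendsto_atTop.1 hconv (ε / 4) (by positivity)
  refine ⟨N, fun n hn => ?_⟩
  have h1 := abs_le.1 (hclose _ (hu n))
  have h2 := abs_le.1 (hclose _ hv)
  have h3 := hN n hn
  rw [Real.dist_eq, abs_lt] at h3 ⊢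
  constructor <;> linarith [h1.1, h1.2, h2.1, h2.2, h3.1, h3.2]

theorem abs_setIntegral_Ioo_sub_le {g : ℝ → ℝ} {p q c ε : ℝ} (hpq : p ≤ q)
    (hg : IntegrableOn g (Ioo p q)) (h : ∀ r ∈ Ioo p q, |g r - c| ≤ ε) :
    |(∫ r in Ioo p q, g r) - (q - p) * c| ≤ (q - p) * ε := by
  have h1 : (q - p) * c = ∫ _ in Ioo p q, c := by
    rw [setIntegral_const, measureReal_def, Real.volume_Ioo,
      ENNReal.toReal_ofReal (by linarith), smul_eq_mul]
  rw [h1, ← integral_sub hg (by simp)]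
  have h2 := norm_setIntegral_le_of_norm_le_const (μ := volume) (s := Ioo p q)
    (f := fun r => g r - c) (C := ε) (by simp) (by simpa using h)
  rwa [measureReal_def, Real.volume_Ioo, ENNReal.toReal_ofReal (by linarith), mul_comm,
    Real.norm_eq_abs] at h2

/-- Coordinates with respect to a finite basis are continuous functionals. -/
theorem tendsto_of_forall_clm_tendsto [FiniteDimensional ℝ E] {x : ℕ → E} {y : E}
    (h : WeakConv x y) : Tendsto x atTop (𝓝 y) := by
  let e := (Module.finBasis ℝ E).equivFunL
  have h1 : Tendsto (fun n => e (x n)) atTop (𝓝 (e y)) :=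
    tendsto_pi_nhds.2 fun i => h ((ContinuousLinearMap.proj i).comp e.toContinuousLinearMap)
  have h2 := (e.symm.continuous.tendsto _).comp h1
  simpa [Function.comp_def] using h2

/-- For curves with a common Lipschitz constant, weak* convergence in `L^∞` to a continuous limit
implies pointwise convergence. -/
theorem TendstoWeakStarLInf.tendsto_apply [FiniteDimensional ℝ E] {u : ℕ → ℝ → E} {v : ℝ → E}
    {K : ℝ≥0} {S : ℝ} (hS : 0 < S) (h : TendstoWeakStarLInf S u v)
    (hu : ∀ n, LipschitzOnWith K (u n) (Icc 0 S)) (hv : ContinuousOn v (Icc 0 S)) {s : ℝ}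
    (hs : s ∈ Icc 0 S) : Tendsto (fun n => u n s) atTop (𝓝 (v s)) := by
  refine tendsto_of_forall_clm_tendsto fun l => ?_
  rw [Metric.tendsto_atTop]
  intro ε hε
  have hlv : ContinuousOn (fun r => l (v r)) (Icc 0 S) := l.continuous.comp_continuousOn hv
  obtain ⟨δ, hδ, hδv⟩ := Metric.continuousOn_iff.1 hlv s hs (ε / 4) (by positivity)
  -- Within distance `η` of `s`, both `l ∘ v` and every `l ∘ u n` deviate by at most `ε / 4` from
  -- their values at `s`. Testing with `l` times the indicator of `(p, q)` therefore compares these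
  -- values up to averages, which converge.
  set η : ℝ := min δ (ε / (4 * (‖l‖ * K + 1))) with hη
  have hη0 : 0 < η := lt_min hδ (by positivity)
  set p := max 0 (s - η) with hp
  set q := min S (s + η) with hq
  have hpq : p < q := max_lt (lt_min hS (by linarith [hs.1])) (lt_min (by linarith [hs.2])
    (by linarith))
  have hmem : ∀ r ∈ Ioo p q, r ∈ Icc 0 S ∧ |r - s| < η := by
    rintro r ⟨hr1, hr2⟩
    rw [hp, max_lt_iff] at hr1
    rw [hq, lt_min_iff] at hr2
    exact ⟨⟨hr1.1.le, hr2.1.le⟩, abs_lt.2 ⟨by linarith, by linarith⟩⟩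
  have hsub : Ioo p q ⊆ Ioo 0 S := Ioo_subset_Ioo (le_max_left _ _) (min_le_left _ _)
  have hint : ∀ w : ℝ → E, ContinuousOn w (Icc 0 S) →
      IntegrableOn (fun r => l (w r)) (Ioo p q) := fun w hw =>
    ((l.continuous.comp_continuousOn hw).integrableOn_Icc).mono_set
      (hsub.trans Ioo_subset_Icc_self)
  have hind : ∀ w : ℝ → E, ∫ r in Ioo 0 S, (Ioo p q).indicator (fun _ => l) r (w r) =
      ∫ r in Ioo p q, l (w r) := by
    intro w
    rw [← integral_indicator measurableSet_Ioo, ← integral_indicator measurableSet_Ioo]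
    congr 1
    ext r
    by_cases hr : r ∈ Ioo p q
    · simp [hr, hsub hr]
    · by_cases hr' : r ∈ Ioo 0 S <;> simp [hr, hr']
  have hc := h ((Ioo p q).indicator fun _ => l)
    ((integrableOn_const (C := l) measure_Ioo_lt_top.ne enorm_ne_top).indicator
      measurableSet_Ioo)
  simp only [hind] at hc
  obtain ⟨N, hN⟩ := Metric.tendsto_atTop.1 hc ((q - p) * (ε / 4))
    (mul_pos (by linarith) (by positivity))
  refine ⟨N, fun n hn => ?_⟩
  have h1 : |(∫ r in Ioo p q, l (u n r)) - (q - p) * l (u n s)| ≤ (q - p) * (ε / 4) := by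
    refine abs_setIntegral_Ioo_sub_le hpq.le (hint _ (hu n).continuousOn) fun r hr => ?_
    obtain ⟨hr1, hr2⟩ := hmem r hr
    have h2 := (hu n).dist_le_mul r hr1 s hs
    rw [dist_eq_norm, Real.dist_eq] at h2
    calc |l (u n r) - l (u n s)| = ‖l (u n r - u n s)‖ := by rw [map_sub, Real.norm_eq_abs]
      _ ≤ ‖l‖ * (K * |r - s|) := (l.le_opNorm _).trans (by gcongr)
      _ ≤ (‖l‖ * K + 1) * (ε / (4 * (‖l‖ * K + 1))) := by
          rw [← mul_assoc]
          gcongr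
          · linarith
          · exact hr2.le.trans (min_le_right _ _)
      _ = ε / 4 := by field_simp
  have h2 : |(∫ r in Ioo p q, l (v r)) - (q - p) * l (v s)| ≤ (q - p) * (ε / 4) := by
    refine abs_setIntegral_Ioo_sub_le hpq.le (hint _ hv) fun r hr => ?_
    obtain ⟨hr1, hr2⟩ := hmem r hr
    exact (hδv r hr1 (by rw [Real.dist_eq]; exact hr2.trans_le (min_le_left _ _))).le
  have h3 := hN n hn
  rw [Real.dist_eq] at h3 ⊢
  have h4 : (q - p) * |l (u n s) - l (v s)| < (q - p) * ε := by
    rw [← abs_of_pos (sub_pos.2 hpq), ← abs_mul, abs_of_pos (sub_pos.2 hpq), abs_lt]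
    rw [abs_le] at h1 h2
    rw [abs_lt] at h3
    have hpos : 0 < (q - p) * ε := mul_pos (sub_pos.2 hpq) hε
    constructor <;> linarith [h1.1, h1.2, h2.1, h2.2, h3.1, h3.2]
  exact lt_of_mul_lt_mul_left h4 (sub_pos.2 hpq).le

/-- A bounded sequence of curves with a common Lipschitz constant has a pointwise convergent
subsequence. -/
theorem exists_subseq_tendsto_of_lipschitzWith [FiniteDimensional ℝ E] {u : ℕ → ℝ → E}
    {K : ℝ≥0} {B : ℝ} (hu : ∀ n, LipschitzWith K (u n)) (hB : ∀ n, ‖u n 0‖ ≤ B) :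
    ∃ (φ : ℕ → ℕ) (v : ℝ → E), StrictMono φ ∧
      ∀ s, Tendsto (fun n => u (φ n) s) atTop (𝓝 (v s)) := by
  have : ProperSpace E := FiniteDimensional.proper ℝ E
  -- Countably many rational parameters suffice for the diagonal extraction: the product of balls is
  -- compact and metrizable, hence sequentially compact.
  have hcpt : IsCompact (univ.pi fun q : ℚ => Metric.closedBall (0 : E) (B + K * |(q : ℝ)|)) :=
    isCompact_univ_pi fun _ => isCompact_closedBall _ _
  obtain ⟨x, -, φ, hφ, hx⟩ := hcpt.tendsto_subseq (x := fun n (q : ℚ) => u n q) (by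
    intro n q _
    have h1 := (hu n).dist_le_mul q 0
    rw [dist_eq_norm, Real.dist_eq, sub_zero] at h1
    have h2 := norm_le_norm_add_norm_sub' (u n q) (u n 0)
    simp only [mem_closedBall_zero_iff]
    linarith [hB n])
  rw [tendsto_pi_nhds] at hx
  have hcauchy : ∀ s, CauchySeq fun n => u (φ n) s := by
    intro s
    rw [Metric.cauchySeq_iff]
    intro ε hε
    obtain ⟨q, hq⟩ := exists_rat_btwn (show s < s + ε / (4 * (K + 1)) by
      have : 0 < ε / (4 * ((K : ℝ) + 1)) := by positivity
      linarith)
    obtain ⟨N, hN⟩ := Metric.cauchySeq_iff.1 (hx q).cauchySeq (ε / 2) (by positivity)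
    refine ⟨N, fun m hm n hn => ?_⟩
    have hclose : ∀ k, dist (u (φ k) s) (u (φ k) q) ≤ ε / 4 := by
      intro k
      refine ((hu _).dist_le_mul _ _).trans ?_
      rw [Real.dist_eq, abs_sub_comm, abs_of_pos (by linarith)]
      calc (K : ℝ) * (q - s) ≤ (K + 1) * (ε / (4 * (K + 1))) := by
            gcongr <;> linarith
        _ = ε / 4 := by field_simp
    have h1 := hN m hm n hn
    have h2 := dist_triangle4 (u (φ m) s) (u (φ m) q) (u (φ n) q) (u (φ n) s)
    have h3 := hclose n
    rw [dist_comm] at h3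
    simp only [Function.comp_apply] at h1
    linarith [hclose m]
  choose v hv using fun s => cauchySeq_tendsto_of_complete (hcauchy s)
  exact ⟨φ, v, hφ, hv⟩

end LipschitzCurves

/-- First order condition for a minimizer of the sum of a differentiable function and a convex
function on a convex set. -/
theorem IsMinOn.fderiv_add_convex_nonneg {E : Type*} [NormedAddCommGroup E] [NormedSpace ℝ E]
    {f R : E → ℝ} {f' : E →L[ℝ] ℝ} {K : Set E} {n w : E} (hmin : IsMinOn (fun v => f v + R v) K n)
    (hK : Convex ℝ K) (hR : ConvexOn ℝ univ R) (hf : HasFDerivAt f f' n) (hn : n ∈ K)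
    (hw : w ∈ K) : 0 ≤ f' (w - n) + R w - R n := by
  have hline : HasDerivAt (fun s : ℝ => n + s • (w - n)) (w - n) 0 := by
    simpa using ((hasDerivAt_id (0 : ℝ)).smul_const (w - n)).const_add n
  -- `R` need not be differentiable. Along the segment it is replaced by its chord, which lies above
  -- it by convexity and touches it at `0`, so that `0` remains a minimizer.
  have hg : HasDerivAt (fun s : ℝ => f (n + s • (w - n)) + s * (R w - R n))
      (f' (w - n) + (R w - R n)) 0 := by
    have h1 : HasFDerivAt f f' (n + (0 : ℝ) • (w - n)) := by simpa using hf
    have h2 := (h1.comp_hasDerivAt 0 hline).add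
      ((hasDerivAt_id (0 : ℝ)).mul_const (R w - R n))
    rw [one_mul] at h2
    exact h2
  have hminOn : IsMinOn (fun s : ℝ => f (n + s • (w - n)) + s * (R w - R n)) (Icc 0 1) 0 := by
    intro s hs
    have hcomb : n + s • (w - n) = (1 - s) • n + s • w := by module
    have h1 := hmin (show n + s • (w - n) ∈ K by
      rw [hcomb]; exact hK hn hw (by linarith [hs.2]) hs.1 (by ring))
    have h2 := hR.2 (mem_univ n) (mem_univ w) (show (0 : ℝ) ≤ 1 - s by linarith [hs.2]) hs.1
      (by ring)
    rw [← hcomb] at h2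
    simp only [smul_eq_mul, mem_ofPred_eq, zero_smul, add_zero, zero_mul] at h1 h2 ⊢
    linarith
  have h3 := hminOn.localize.hasFDerivWithinAt_nonneg hg.hasFDerivAt.hasFDerivWithinAt
    (y := 1) (mem_posTangentConeAt_of_segment_subset (by simp [segment_eq_Icc]))
  rw [ContinuousLinearMap.toSpanSingleton_apply, one_smul] at h3
  linarith

theorem hasFDerivAt_half_quadratic {E : Type*} [NormedAddCommGroup E] [NormedSpace ℝ E]
    {B : E →L[ℝ] E →L[ℝ] ℝ} (hB : ∀ v w, B v w = B w v) (n : E) :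
    HasFDerivAt (fun v => 1 / 2 * B v v) (B n) n := by
  have h := (B.hasFDerivAt.clm_apply (hasFDerivAt_id n)).const_mul (1 / 2 : ℝ)
  refine h.congr_fderiv ?_
  ext v
  simp [hB v n]
  ring

/-! ### Finite dimension, norms, dissipation, and the dual description of the distance. -/

namespace RISData

variable {V W X : Type*} [NormedAddCommGroup V] [InnerProductSpace ℝ V]
  [NormedAddCommGroup W] [NormedSpace ℝ W] [NormedAddCommGroup X] [NormedSpace ℝ X]
  {D : RISData V W X}

namespace StandingAssumptions

/-- Since `V` embeds compactly into `W` and `W` into `V`, the state space has finite dimension. -/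
theorem finiteDimensional (hD : D.StandingAssumptions) : FiniteDimensional ℝ V := by
  refine FiniteDimensional.of_isCompactOperator_id (𝕜 := ℝ) ?_
  have h := hD.iZW_compact.clm_comp D.iWV
  rwa [show ⇑D.iWV ∘ ⇑D.iZW = id from funext hD.iWV_iZW] at h

/-! ### The viscosity norm -/

theorem Vop_self_nonneg (hD : D.StandingAssumptions) (v : V) : 0 ≤ D.Vop v v := by
  obtain ⟨γ, hγ, h⟩ := hD.Vop_coercive
  exact (by positivity : 0 ≤ γ * ‖v‖ ^ 2).trans (h v)

theorem normV_nonneg (v : V) : 0 ≤ D.normV v := Real.sqrt_nonneg _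

theorem normV_sq (hD : D.StandingAssumptions) (v : V) : D.normV v ^ 2 = D.Vop v v :=
  Real.sq_sqrt (hD.Vop_self_nonneg v)

theorem normV_zero : D.normV (0 : V) = 0 := by simp [normV]

theorem normV_smul (c : ℝ) (v : V) : D.normV (c • v) = |c| * D.normV v := by
  simp only [normV, map_smul, smul_apply, smul_eq_mul]
  rw [← mul_assoc, Real.sqrt_mul (mul_self_nonneg c), Real.sqrt_mul_self_eq_abs]

theorem normV_neg (v : V) : D.normV (-v) = D.normV v := by simp [normV]

theorem Vop_le (hD : D.StandingAssumptions) (v w : V) : D.Vop v w ≤ D.normV v * D.normV w := by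
  let B : LinearMap.BilinForm ℝ V := (ContinuousLinearMap.coeLM ℝ).comp D.Vop.toLinearMap
  have h : (D.Vop v w) ^ 2 ≤ D.Vop v v * D.Vop w w :=
    B.apply_sq_le_of_symm hD.Vop_self_nonneg ⟨fun x y => hD.Vop_symm x y⟩ v w
  rw [← hD.normV_sq, ← hD.normV_sq, ← mul_pow] at h
  exact (le_abs_self _).trans
    (abs_le_of_sq_le_sq h (mul_nonneg (normV_nonneg v) (normV_nonneg w)))

theorem normV_add_le (hD : D.StandingAssumptions) (v w : V) :
    D.normV (v + w) ≤ D.normV v + D.normV w := by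
  refine le_of_sq_le_sq ?_ (add_nonneg (normV_nonneg v) (normV_nonneg w))
  have h1 := hD.Vop_le v w
  have h2 := hD.Vop_symm v w
  have h3 := hD.normV_sq v
  have h4 := hD.normV_sq w
  rw [hD.normV_sq]
  simp only [map_add, add_apply]
  nlinarith

theorem exists_normV_le (hD : D.StandingAssumptions) :
    ∃ C : ℝ, 0 < C ∧ ∀ v : V, D.normV v ≤ C * ‖v‖ := by
  refine ⟨‖D.Vop‖ + 1, by positivity, fun v => le_of_sq_le_sq ?_ (by positivity)⟩
  rw [hD.normV_sq]
  calc D.Vop v v ≤ ‖D.Vop v v‖ := le_abs_self _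
    _ ≤ ‖D.Vop‖ * ‖v‖ * ‖v‖ := D.Vop.le_opNorm₂ v v
    _ ≤ ((‖D.Vop‖ + 1) * ‖v‖) ^ 2 := by
        have h := norm_nonneg D.Vop
        have h' := sq_nonneg ‖v‖
        nlinarith [mul_nonneg h h', mul_nonneg (mul_nonneg h h) h']

theorem exists_norm_le_normV (hD : D.StandingAssumptions) :
    ∃ C : ℝ, 0 < C ∧ ∀ v : V, ‖v‖ ≤ C * D.normV v := by
  obtain ⟨γ, hγ, h⟩ := hD.Vop_coercive
  refine ⟨(Real.sqrt γ)⁻¹, by positivity, fun v => ?_⟩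
  rw [le_inv_mul_iff₀ (Real.sqrt_pos.2 hγ)]
  refine le_of_sq_le_sq ?_ (normV_nonneg v)
  rw [hD.normV_sq, mul_pow, Real.sq_sqrt hγ.le]
  exact h v

theorem continuous_normV : Continuous D.normV := by
  unfold normV
  fun_prop

/-! ### The dissipation -/

theorem Rv_nonneg (hD : D.StandingAssumptions) (v : V) : 0 ≤ D.Rv v := hD.R_nonneg _

theorem exists_Rv_le (hD : D.StandingAssumptions) :
    ∃ C : ℝ, 0 < C ∧ ∀ v : V, D.Rv v ≤ C * ‖v‖ := by
  obtain ⟨_, R₀, _, hR₀, h⟩ := hD.R_bounds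
  exact ⟨R₀, hR₀, fun v => (h v).2⟩

theorem Rv_zero (hD : D.StandingAssumptions) : D.Rv (0 : V) = 0 := by
  obtain ⟨C, _, h⟩ := hD.exists_Rv_le
  exact le_antisymm (by simpa using h 0) (hD.Rv_nonneg 0)

theorem Rv_smul (hD : D.StandingAssumptions) {c : ℝ} (hc : 0 ≤ c) (v : V) :
    D.Rv (c • v) = c * D.Rv v := by
  rcases hc.eq_or_lt with rfl | hc
  · simp [hD.Rv_zero]
  · simp only [Rv, map_smul]
    exact hD.R_homogeneous c _ hc

theorem Rv_convexOn (hD : D.StandingAssumptions) : ConvexOn ℝ univ (D.Rv : V → ℝ) :=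
  hD.R_convex.comp_linearMap D.iVX.toLinearMap

theorem Rv_add_le (hD : D.StandingAssumptions) (v w : V) : D.Rv (v + w) ≤ D.Rv v + D.Rv w := by
  have h := hD.Rv_convexOn.2 (mem_univ v) (mem_univ w) (show (0 : ℝ) ≤ 1 / 2 by norm_num)
    (show (0 : ℝ) ≤ 1 / 2 by norm_num) (by norm_num)
  rw [← smul_add, hD.Rv_smul (by norm_num)] at h
  simp only [smul_eq_mul] at h
  linarith

/-- The dissipation only controls the weaker norm of `X`, but an injective linear map on a
finite-dimensional space is bounded below. This lets dissipated energy pay for arc length in `V`. -/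
theorem exists_norm_le_Rv (hD : D.StandingAssumptions) :
    ∃ C : ℝ, 0 < C ∧ ∀ v : V, ‖v‖ ≤ C * D.Rv v := by
  have := hD.finiteDimensional
  obtain ⟨ρ, _, hρ, _, h⟩ := hD.R_bounds
  obtain ⟨K, hK, hKi⟩ := D.iVX.toLinearMap.exists_antilipschitzWith
    (LinearMap.ker_eq_bot.2 hD.iVX_injective)
  refine ⟨K / ρ, by positivity, fun v => ?_⟩
  have h1 := hKi.le_mul_dist v 0
  simp only [dist_zero_right, map_zero] at h1
  calc ‖v‖ ≤ K * ‖D.iVX v‖ := h1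
    _ = K / ρ * (ρ * ‖D.iVX v‖) := by field_simp
    _ ≤ K / ρ * D.Rv v := by gcongr; exact (h v).1

theorem continuous_Rv (hD : D.StandingAssumptions) : Continuous (D.Rv : V → ℝ) := by
  have := hD.finiteDimensional
  exact continuousOn_univ.1 (hD.Rv_convexOn.continuousOn isOpen_univ)

/-! ### The distance to the stable set -/

theorem mem_subdiffZero (hD : D.StandingAssumptions) {ξ : V →L[ℝ] ℝ} :
    ξ ∈ D.subdiffZero ↔ ∀ v, ξ v ≤ D.Rv v := by
  simp only [subdiffZero, convexSubdiff, mem_ofPred_eq, sub_zero, hD.Rv_zero]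
  refine forall_congr' fun v => ?_
  rw [EReal.coe_zero, zero_add, EReal.coe_le_coe_iff]

/-- Coercivity gives injectivity and equality of dimensions gives surjectivity, so `D.Vop.inverse`
is a genuine inverse and not the default value. -/
theorem exists_Vop_equiv (hD : D.StandingAssumptions) :
    ∃ e : V ≃L[ℝ] (V →L[ℝ] ℝ), D.Vop = e := by
  have := hD.finiteDimensional
  obtain ⟨C, hC, h⟩ := hD.exists_norm_le_normV
  have hinj : Function.Injective D.Vop.toLinearMap := by
    rw [← LinearMap.ker_eq_bot, LinearMap.ker_eq_bot']
    intro v hv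
    have h1 : D.Vop v = 0 := hv
    have h2 := h v
    rw [normV, h1, zero_apply, Real.sqrt_zero, mul_zero] at h2
    exact norm_le_zero_iff.1 h2
  have hfin : Module.finrank ℝ V = Module.finrank ℝ (V →L[ℝ] ℝ) := by
    rw [← (LinearMap.toContinuousLinearMap (𝕜 := ℝ) (E := V) (F' := ℝ)).finrank_eq]
    exact (Subspace.dual_finrank_eq).symm
  have hsurj := (LinearMap.injective_iff_surjective_of_finrank_eq_finrank hfin).1 hinj
  exact ⟨(LinearEquiv.ofBijective D.Vop.toLinearMap ⟨hinj, hsurj⟩).toContinuousLinearEquiv, rfl⟩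

/-- With this isometry all dual norms are computed in `V`, where Cauchy–Schwarz for `𝕍` is
available. -/
theorem normVinv_Vop (hD : D.StandingAssumptions) (v : V) : D.normVinv (D.Vop v) = D.normV v := by
  obtain ⟨e, he⟩ := hD.exists_Vop_equiv
  rw [normVinv, normV, he, ContinuousLinearMap.inverse_equiv]
  simp

theorem exists_Vop_eq (hD : D.StandingAssumptions) (η : V →L[ℝ] ℝ) : ∃ v, D.Vop v = η := by
  obtain ⟨e, he⟩ := hD.exists_Vop_equiv
  exact ⟨e.symm η, by rw [he]; simp⟩

theorem exists_isMinOn_viscous (hD : D.StandingAssumptions) (ξ : V →L[ℝ] ℝ) :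
    ∃ n, IsMinOn (fun v => (1 / 2 * D.Vop v v - ξ v) + D.Rv v) univ n := by
  have := hD.finiteDimensional
  have : ProperSpace V := FiniteDimensional.proper ℝ V
  obtain ⟨γ, hγ, h⟩ := hD.Vop_coercive
  -- Beyond this radius the quadratic term dominates `ξ`, so the objective is at least its value `0`
  -- at the origin.
  set r := 2 * ‖ξ‖ / γ with hr
  have hcont : Continuous fun v => (1 / 2 * D.Vop v v - ξ v) + D.Rv v := by
    have := hD.continuous_Rv
    fun_prop
  obtain ⟨n, -, hn⟩ := (isCompact_closedBall (0 : V) r).exists_isMinOn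
    (Metric.nonempty_closedBall.2 (by positivity)) hcont.continuousOn
  refine ⟨n, fun v _ => ?_⟩
  by_cases hv : v ∈ Metric.closedBall (0 : V) r
  · exact hn hv
  have h0 := hn (Metric.mem_closedBall_self (show 0 ≤ r by positivity))
  simp only [mem_ofPred_eq, map_zero, hD.Rv_zero, mul_zero, sub_zero, add_zero] at h0 ⊢
  refine h0.trans ?_
  rw [mem_closedBall_zero_iff, not_le, hr, div_lt_iff₀ hγ] at hv
  have h1 := h v
  have h2 : ξ v ≤ ‖ξ‖ * ‖v‖ := (le_abs_self _).trans (ξ.le_opNorm v)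
  have h3 := hD.Rv_nonneg v
  nlinarith [norm_nonneg v]

/-- The distance is the viscosity norm of the proximal point of the dissipation. -/
theorem exists_distSubdiff (hD : D.StandingAssumptions) (ξ : V →L[ℝ] ℝ) :
    ∃ n, D.distSubdiff ξ = D.normV n ∧ (∀ v, ξ v - D.Rv v ≤ D.Vop n v) ∧
      ξ n - D.Rv n = D.normV n ^ 2 := by
  obtain ⟨n, hn⟩ := hD.exists_isMinOn_viscous ξ
  have hder : HasFDerivAt (fun v => 1 / 2 * D.Vop v v - ξ v) (D.Vop n - ξ) n :=
    (hasFDerivAt_half_quadratic hD.Vop_symm n).sub ξ.hasFDerivAt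
  have hvar : ∀ w, 0 ≤ (D.Vop n - ξ) (w - n) + D.Rv w - D.Rv n := fun w =>
    hn.fderiv_add_convex_nonneg convex_univ hD.Rv_convexOn hder (mem_univ _) (mem_univ w)
  have hsq := hD.normV_sq n
  -- Testing the variational inequality at `0` and at `2 n` gives the two inequalities, by positive
  -- homogeneity.
  have heq : ξ n - D.Rv n = D.normV n ^ 2 := by
    have h0 := hvar 0
    have h2 := hvar ((2 : ℝ) • n)
    rw [hD.Rv_smul (by norm_num)] at h2
    simp only [zero_sub, map_neg, sub_apply, hD.Rv_zero, map_sub, map_smul, smul_eq_mul] at h0 h2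
    linarith
  have hle : ∀ v, ξ v - D.Rv v ≤ D.Vop n v := by
    intro v
    have h1 := hvar v
    simp only [sub_apply, map_sub] at h1
    linarith
  refine ⟨n, ?_, hle, heq⟩
  have hleast : IsLeast (D.normVinv '' {w | w + ξ ∈ D.subdiffZero}) (D.normV n) := by
    constructor
    · refine ⟨D.Vop (-n), ?_, by rw [hD.normVinv_Vop, normV_neg]⟩
      rw [mem_ofPred_eq, hD.mem_subdiffZero]
      intro v
      simp only [map_neg, add_apply, neg_apply]
      linarith [hle v]
    -- With `w = 𝕍 u`, testing `w + ξ ≤ R` at `n` gives `‖n‖² = ξ n - R n ≤ -⟨𝕍 u, n⟩ ≤ ‖u‖ ‖n‖` in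
    -- the norm of `𝕍`.
    · rintro _ ⟨w, hw, rfl⟩
      obtain ⟨u, rfl⟩ := hD.exists_Vop_eq w
      rw [mem_ofPred_eq, hD.mem_subdiffZero] at hw
      rw [hD.normVinv_Vop]
      have h1 := hw n
      have h2 := hD.Vop_le (-u) n
      rw [normV_neg] at h2
      simp only [map_neg, add_apply, neg_apply] at h1 h2
      have h3 := normV_nonneg (D := D) u
      by_contra hlt
      have h4 : D.normV n * D.normV n ≤ D.normV u * D.normV n := by nlinarith
      nlinarith
  exact hleast.csInf_eq

theorem distSubdiff_nonneg (hD : D.StandingAssumptions) (ξ : V →L[ℝ] ℝ) :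
    0 ≤ D.distSubdiff ξ := by
  obtain ⟨n, h, -⟩ := hD.exists_distSubdiff ξ
  exact h ▸ normV_nonneg n

/-- The easy half of the duality: the variational inequality of the proximal point, followed by
Cauchy–Schwarz. -/
theorem apply_le_Rv_add (hD : D.StandingAssumptions) (ξ : V →L[ℝ] ℝ) (v : V) :
    ξ v ≤ D.Rv v + D.normV v * D.distSubdiff ξ := by
  obtain ⟨n, h, hle, -⟩ := hD.exists_distSubdiff ξ
  have h1 := hle v
  have h2 := hD.Vop_le n v
  rw [h]
  linarith

/-- The normalized proximal point is the maximizer (zero if the distance is zero), so the distance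
is the maximum of `ξ - R` over the unit ball. -/
theorem exists_distSubdiff_eq (hD : D.StandingAssumptions) (ξ : V →L[ℝ] ℝ) :
    ∃ v, D.normV v ≤ 1 ∧ ξ v - D.Rv v = D.distSubdiff ξ := by
  obtain ⟨n, h, -, heq⟩ := hD.exists_distSubdiff ξ
  rcases (normV_nonneg (D := D) n).eq_or_lt with h0 | h0
  · exact ⟨0, by simp [normV_zero], by simp [hD.Rv_zero, h, ← h0]⟩
  · refine ⟨(D.normV n)⁻¹ • n, ?_, ?_⟩
    · rw [normV_smul, abs_of_pos (inv_pos.2 h0), inv_mul_cancel₀ h0.ne']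
    · rw [hD.Rv_smul (inv_pos.2 h0).le, map_smul, smul_eq_mul, ← mul_sub, heq, h]
      field_simp

/-- A maximum over the unit ball of functions that are Lipschitz in `ξ` with a common constant is
Lipschitz. -/
theorem exists_distSubdiff_lipschitz (hD : D.StandingAssumptions) :
    ∃ C : ℝ, 0 < C ∧ ∀ ξ η : V →L[ℝ] ℝ, D.distSubdiff ξ ≤ D.distSubdiff η + C * ‖ξ - η‖ := by
  obtain ⟨C, hC, h⟩ := hD.exists_norm_le_normV
  refine ⟨C, hC, fun ξ η => ?_⟩
  obtain ⟨v, hv, heq⟩ := hD.exists_distSubdiff_eq ξ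
  have h1 := hD.apply_le_Rv_add η v
  have h2 : (ξ - η) v ≤ ‖ξ - η‖ * C := by
    refine (le_abs_self _).trans (((ξ - η).le_opNorm v).trans ?_)
    gcongr
    exact (h v).trans (by nlinarith)
  have h3 : D.normV v * D.distSubdiff η ≤ D.distSubdiff η :=
    mul_le_of_le_one_left (hD.distSubdiff_nonneg η) hv
  rw [sub_apply] at h2
  linarith

theorem mem_convexSubdiff_ball_iff (hD : D.StandingAssumptions) {τ : ℝ} (hτ : 0 ≤ τ)
    {ξ : V →L[ℝ] ℝ} {v : V} :
    ξ ∈ convexSubdiff (fun v => ((D.Rv v : ℝ) : EReal) + D.ballIndicator τ v) v ↔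
      D.normV v ≤ τ ∧ ∀ w, D.normV w ≤ τ → D.Rv v + ξ (w - v) ≤ D.Rv w := by
  simp only [convexSubdiff, mem_ofPred_eq, ballIndicator]
  constructor
  · intro h
    have hv : D.normV v ≤ τ := by
      -- Outside the ball the left-hand side would be `⊤`, while the competitor `0` has the finite
      -- value `0`.
      by_contra hv
      have h0 := h 0
      rw [if_neg hv, if_pos (by rwa [normV_zero])] at h0
      simp [hD.Rv_zero] at h0
    refine ⟨hv, fun w hw => ?_⟩
    have h1 := h w
    rw [if_pos hv, if_pos hw, add_zero, add_zero] at h1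
    exact_mod_cast h1
  · rintro ⟨hv, h⟩ w
    rw [if_pos hv, add_zero]
    split_ifs with hw
    · rw [add_zero]
      exact_mod_cast h w hw
    · simp

/-- The competitor `τ • u`, with `u` the dual maximizer, gives `R v + τ dist ξ ≤ ξ v`; duality gives
`ξ v ≤ R v + ‖v‖ dist ξ`. Since `‖v‖ ≤ τ`, equality holds throughout. -/
theorem convexSubdiff_ball_eq (hD : D.StandingAssumptions) {τ : ℝ} (hτ : 0 ≤ τ)
    {ξ : V →L[ℝ] ℝ} {v : V}
    (h : ξ ∈ convexSubdiff (fun v => ((D.Rv v : ℝ) : EReal) + D.ballIndicator τ v) v) :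
    D.normV v ≤ τ ∧ ξ v = D.Rv v + D.normV v * D.distSubdiff ξ ∧
      (τ - D.normV v) * D.distSubdiff ξ = 0 := by
  obtain ⟨hv, hw⟩ := (hD.mem_convexSubdiff_ball_iff hτ).1 h
  obtain ⟨u, hu, heq⟩ := hD.exists_distSubdiff_eq ξ
  have h1 := hw (τ • u) (by
    rw [normV_smul, abs_of_nonneg hτ]
    exact mul_le_of_le_one_right hτ hu)
  rw [hD.Rv_smul hτ, map_sub, map_smul, smul_eq_mul] at h1
  have h2 := hD.apply_le_Rv_add ξ v
  have h3 : D.Rv v + τ * D.distSubdiff ξ ≤ ξ v := by rw [← heq]; linarith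
  have h4 := mul_nonneg (sub_nonneg.2 hv) (hD.distSubdiff_nonneg ξ)
  exact ⟨hv, by linarith, by linarith⟩

end StandingAssumptions

end RISData

/-! ### Regularity of the energy in state and time. -/

namespace RISData

variable {V W X : Type*} [NormedAddCommGroup V] [InnerProductSpace ℝ V]
  [NormedAddCommGroup W] [NormedSpace ℝ W] [NormedAddCommGroup X] [NormedSpace ℝ X]
  {D : RISData V W X}

namespace StandingAssumptions

/-! ### The energy -/

theorem hasFDerivAt_energy_formula (hD : D.StandingAssumptions) {t : ℝ} (ht : 0 ≤ t) (z : V) :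
    HasFDerivAt (D.energy t) (D.A z + fderiv ℝ D.F z - fderiv ℝ (D.f t) z) z :=
  ((hasFDerivAt_half_quadratic hD.A_symm z).add
    (hD.F_contDiff.differentiable two_ne_zero z).hasFDerivAt).sub
    (hD.f_differentiable t ht z).hasFDerivAt

theorem dzEnergy_eq (hD : D.StandingAssumptions) {t : ℝ} (ht : 0 ≤ t) (z : V) :
    D.dzEnergy t z = D.A z + fderiv ℝ D.F z - fderiv ℝ (D.f t) z :=
  (hD.hasFDerivAt_energy_formula ht z).fderiv

theorem hasFDerivAt_energy (hD : D.StandingAssumptions) {t : ℝ} (ht : 0 ≤ t) (z : V) :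
    HasFDerivAt (D.energy t) (D.dzEnergy t z) z :=
  hD.dzEnergy_eq ht z ▸ hD.hasFDerivAt_energy_formula ht z

theorem exists_fderiv_F_lipschitz (hD : D.StandingAssumptions) {M : ℝ} (hM : 0 ≤ M) :
    ∃ L : ℝ, 0 ≤ L ∧ ∀ z₁ z₂ : V, ‖z₁‖ ≤ M → ‖z₂‖ ≤ M →
      ‖fderiv ℝ D.F z₁ - fderiv ℝ D.F z₂‖ ≤ L * ‖z₁ - z₂‖ := by
  obtain ⟨C, q, hC, hq, h⟩ := hD.F_growth
  have hMq : 0 ≤ M ^ q := Real.rpow_nonneg hM q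
  refine ⟨C * (1 + M ^ q), by positivity, fun z₁ z₂ h₁ h₂ => ?_⟩
  have hdiff : Differentiable ℝ (fderiv ℝ D.F) :=
    (hD.F_contDiff.fderiv_right (m := 1) (by norm_num)).differentiable one_ne_zero
  refine (convex_closedBall (0 : V) M).norm_image_sub_le_of_norm_fderiv_le (𝕜 := ℝ)
    (f := fderiv ℝ D.F) (fun z _ => hdiff z) (fun z hz => ?_) (mem_closedBall_zero_iff.2 h₂)
    (mem_closedBall_zero_iff.2 h₁)
  refine ContinuousLinearMap.opNorm_le_bound _ (by positivity) fun v => (h z v).trans ?_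
  have hz' : ‖z‖ ≤ M := mem_closedBall_zero_iff.1 hz
  gcongr

theorem exists_fderiv_f_lipschitz (hD : D.StandingAssumptions) :
    ∃ L : ℝ, 0 ≤ L ∧ ∀ t₁ t₂ : ℝ, 0 ≤ t₁ → 0 ≤ t₂ → ∀ z₁ z₂ : V,
      ‖fderiv ℝ (D.f t₁) z₁ - fderiv ℝ (D.f t₂) z₂‖ ≤ L * (|t₁ - t₂| + ‖z₁ - z₂‖) := by
  obtain ⟨ν, hν, h⟩ := hD.f_lipschitz
  refine ⟨ν * (1 + ‖D.iZW‖), by positivity, fun t₁ t₂ h₁ h₂ z₁ z₂ => ?_⟩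
  refine ContinuousLinearMap.opNorm_le_bound _ (by positivity) fun v => ?_
  refine (h t₁ t₂ h₁ h₂ z₁ z₂ v).trans ?_
  rw [mul_assoc ν (1 + ‖D.iZW‖)]
  refine mul_le_mul_of_nonneg_right (mul_le_mul_of_nonneg_left ?_ hν.le) (norm_nonneg v)
  have h3 := D.iZW.le_opNorm (z₁ - z₂)
  nlinarith [norm_nonneg (z₁ - z₂), abs_nonneg (t₁ - t₂), norm_nonneg D.iZW,
    mul_nonneg (norm_nonneg D.iZW) (abs_nonneg (t₁ - t₂))]

theorem exists_dzEnergy_lipschitz (hD : D.StandingAssumptions) {M : ℝ} (hM : 0 ≤ M) :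
    ∃ L : ℝ, 0 < L ∧ ∀ t₁ t₂ : ℝ, 0 ≤ t₁ → 0 ≤ t₂ → ∀ z₁ z₂ : V, ‖z₁‖ ≤ M → ‖z₂‖ ≤ M →
      ‖D.dzEnergy t₁ z₁ - D.dzEnergy t₂ z₂‖ ≤ L * (|t₁ - t₂| + ‖z₁ - z₂‖) := by
  obtain ⟨L₁, hL₁, h₁⟩ := hD.exists_fderiv_F_lipschitz hM
  obtain ⟨L₂, hL₂, h₂⟩ := hD.exists_fderiv_f_lipschitz
  refine ⟨‖D.A‖ + L₁ + L₂ + 1, by positivity, fun t₁ t₂ ht₁ ht₂ z₁ z₂ hz₁ hz₂ => ?_⟩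
  have h3 := h₁ z₁ z₂ hz₁ hz₂
  have h4 := h₂ t₁ t₂ ht₁ ht₂ z₁ z₂
  have h5 := D.A.le_opNorm (z₁ - z₂)
  have h6 : D.dzEnergy t₁ z₁ - D.dzEnergy t₂ z₂ =
      D.A (z₁ - z₂) + (fderiv ℝ D.F z₁ - fderiv ℝ D.F z₂) -
        (fderiv ℝ (D.f t₁) z₁ - fderiv ℝ (D.f t₂) z₂) := by
    rw [hD.dzEnergy_eq ht₁, hD.dzEnergy_eq ht₂, map_sub]
    abel
  rw [h6]
  refine (norm_sub_le_of_le ((norm_add_le _ _).trans (add_le_add h5 h3)) h4).trans ?_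
  have h7 := abs_nonneg (t₁ - t₂)
  have h8 := norm_nonneg (z₁ - z₂)
  nlinarith [mul_nonneg (norm_nonneg D.A) h7, mul_nonneg hL₁ h7]

theorem exists_stabDist_lipschitz (hD : D.StandingAssumptions) {M : ℝ} (hM : 0 ≤ M) :
    ∃ L : ℝ, 0 < L ∧ ∀ t₁ t₂ : ℝ, 0 ≤ t₁ → 0 ≤ t₂ → ∀ z₁ z₂ : V, ‖z₁‖ ≤ M → ‖z₂‖ ≤ M →
      D.stabDist t₁ z₁ ≤ D.stabDist t₂ z₂ + L * (|t₁ - t₂| + ‖z₁ - z₂‖) := by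
  obtain ⟨L, hL, h⟩ := hD.exists_dzEnergy_lipschitz hM
  obtain ⟨C, hC, hd⟩ := hD.exists_distSubdiff_lipschitz
  refine ⟨C * L, by positivity, fun t₁ t₂ ht₁ ht₂ z₁ z₂ hz₁ hz₂ => ?_⟩
  refine (hd (-D.dzEnergy t₁ z₁) (-D.dzEnergy t₂ z₂)).trans ?_
  rw [stabDist, mul_assoc]
  gcongr
  rw [← neg_sub', norm_neg]
  exact h t₁ t₂ ht₁ ht₂ z₁ z₂ hz₁ hz₂

theorem stabDist_nonneg (hD : D.StandingAssumptions) (t : ℝ) (z : V) : 0 ≤ D.stabDist t z :=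
  hD.distSubdiff_nonneg _

theorem continuousOn_dzEnergy (hD : D.StandingAssumptions) :
    ContinuousOn (fun p : ℝ × V => D.dzEnergy p.1 p.2) (Ici 0 ×ˢ univ) := by
  obtain ⟨L, hL, h⟩ := hD.exists_fderiv_f_lipschitz
  have h1 : ContinuousOn (fun p : ℝ × V => fderiv ℝ (D.f p.1) p.2) (Ici 0 ×ˢ univ) := by
    refine (LipschitzOnWith.of_dist_le_mul (K := Real.toNNReal (2 * L))
      fun p hp r hr => ?_).continuousOn
    rw [Real.coe_toNNReal _ (by positivity), dist_eq_norm]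
    refine (h p.1 r.1 hp.1 hr.1 p.2 r.2).trans ?_
    have h2 : |p.1 - r.1| ≤ dist p r := le_max_left (dist p.1 r.1) (dist p.2 r.2)
    have h3 : ‖p.2 - r.2‖ ≤ dist p r := by
      rw [← dist_eq_norm]
      exact le_max_right (dist p.1 r.1) (dist p.2 r.2)
    nlinarith
  have h2 : Continuous (fderiv ℝ D.F) := hD.F_contDiff.continuous_fderiv two_ne_zero
  have h3 : ContinuousOn (fun p : ℝ × V => D.A p.2 + fderiv ℝ D.F p.2 - fderiv ℝ (D.f p.1) p.2)
      (Ici 0 ×ˢ univ) := by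
    refine ContinuousOn.sub (Continuous.continuousOn ?_) h1
    fun_prop
  exact h3.congr fun p hp => hD.dzEnergy_eq hp.1 p.2

theorem continuousOn_dzEnergy_comp (hD : D.StandingAssumptions) {t : ℝ → ℝ} {z : ℝ → V} {s : Set ℝ}
    (ht : ContinuousOn t s) (hz : ContinuousOn z s) (h0 : ∀ r ∈ s, 0 ≤ t r) :
    ContinuousOn (fun r => D.dzEnergy (t r) (z r)) s :=
  hD.continuousOn_dzEnergy.comp (ht.prodMk hz) fun r hr => ⟨h0 r hr, mem_univ _⟩

theorem continuous_distSubdiff (hD : D.StandingAssumptions) : Continuous D.distSubdiff := by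
  obtain ⟨C, hC, h⟩ := hD.exists_distSubdiff_lipschitz
  refine (LipschitzWith.of_le_add_mul C.toNNReal fun ξ η => ?_).continuous
  rw [Real.coe_toNNReal _ hC.le, dist_eq_norm]
  exact h ξ η

theorem continuousOn_stabDist_comp (hD : D.StandingAssumptions) {t : ℝ → ℝ} {z : ℝ → V} {s : Set ℝ}
    (ht : ContinuousOn t s) (hz : ContinuousOn z s) (h0 : ∀ r ∈ s, 0 ≤ t r) :
    ContinuousOn (fun r => D.stabDist (t r) (z r)) s :=
  hD.continuous_distSubdiff.comp_continuousOn (hD.continuousOn_dzEnergy_comp ht hz h0).neg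

/-! ### Dependence of the energy on time -/

theorem hasFDerivWithinAt_f (hD : D.StandingAssumptions) {t : ℝ} (ht : t ∈ Icc 0 D.T) (z : V) :
    HasFDerivWithinAt (fun p : ℝ × V => D.f p.1 p.2)
      (fderivWithin ℝ (fun p : ℝ × V => D.f p.1 p.2) (Icc 0 D.T ×ˢ univ) (t, z))
      (Icc 0 D.T ×ˢ univ) (t, z) :=
  (hD.f_contDiffOn.differentiableOn one_ne_zero (t, z) ⟨ht, mem_univ _⟩).hasFDerivWithinAt

theorem hasDerivWithinAt_f (hD : D.StandingAssumptions) {t : ℝ} (ht : t ∈ Icc 0 D.T) (z : V) :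
    HasDerivWithinAt (fun r => D.f r z)
      (fderivWithin ℝ (fun p : ℝ × V => D.f p.1 p.2) (Icc 0 D.T ×ˢ univ) (t, z) (1, 0))
      (Icc 0 D.T) t :=
  HasFDerivWithinAt.comp_hasDerivWithinAt t (f := fun r => (r, z)) (hD.hasFDerivWithinAt_f ht z)
    ((hasDerivWithinAt_id t _).prodMk (hasDerivWithinAt_const t _ z))
    fun _ hr => ⟨hr, mem_univ _⟩

/-- `f` is jointly `C¹` only on the strip `[0,T] × V`, so the chain rule yields a joint derivative
within the strip; its state part has to be identified with the derivative of the slice. -/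
theorem fderiv_f_eq (hD : D.StandingAssumptions) {t : ℝ} (ht : t ∈ Icc 0 D.T) (z v : V) :
    fderiv ℝ (D.f t) z v =
      fderivWithin ℝ (fun p : ℝ × V => D.f p.1 p.2) (Icc 0 D.T ×ˢ univ) (t, z) (0, v) := by
  have h1 : HasFDerivWithinAt (fun w : V => (t, w)) (ContinuousLinearMap.inr ℝ ℝ V) univ z :=
    (hasFDerivAt_prodMk_right t z).hasFDerivWithinAt
  have h2 := (hD.hasFDerivWithinAt_f ht z).comp z h1 fun w _ => ⟨ht, mem_univ _⟩
  have h3 := (hasFDerivWithinAt_univ.1 h2).fderiv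
  exact DFunLike.congr_fun h3 v

theorem hasDerivWithinAt_energy (hD : D.StandingAssumptions) {t : ℝ} (ht : t ∈ Icc 0 D.T) (z : V) :
    HasDerivWithinAt (fun r => D.energy r z) (-D.dtf t z) (Icc 0 D.T) t := by
  have h := hD.hasDerivWithinAt_f ht z
  have h1 : D.dtf t z = _ := h.derivWithin (uniqueDiffOn_Icc hD.T_pos t ht)
  rw [← h1] at h
  exact h.const_sub (1 / 2 * D.A z z + D.F z)

theorem dtEnergy_eq (hD : D.StandingAssumptions) {t : ℝ} (ht : t ∈ Icc 0 D.T) (z : V) :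
    D.dtEnergy t z = -D.dtf t z :=
  (hD.hasDerivWithinAt_energy ht z).derivWithin (uniqueDiffOn_Icc hD.T_pos t ht)

/-- The energy controls its own change in time. -/
theorem exists_energy_time_bound (hD : D.StandingAssumptions) :
    ∃ μ K : ℝ, 0 < μ ∧ (∀ t ∈ Icc 0 D.T, ∀ z, μ * (‖z‖ + 1) ≤ D.energy t z + K) ∧
      ∀ t₁ ∈ Icc 0 D.T, ∀ t₂ ∈ Icc 0 D.T, ∀ z,
        |D.energy t₂ z - D.energy t₁ z| ≤ μ * (‖z‖ + 1) * |t₂ - t₁| := by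
  obtain ⟨c, hc, hf⟩ := hD.f_growth
  obtain ⟨μ, hμ, hdt⟩ := hD.dtf_growth
  obtain ⟨α, hα, hA⟩ := hD.A_coercive
  -- The additive constant comes from completing the square: the quadratic part pays both for the
  -- linear growth of `f` and for `μ (‖z‖ + 1)`.
  refine ⟨μ, (c + μ) + (c + μ) ^ 2 / (2 * α), hμ, fun t ht z => ?_, fun t₁ h₁ t₂ h₂ z => ?_⟩
  · have h1 := hf t ht z
    have h2 := hA z
    have h3 := hD.F_nonneg z
    have h4 : 0 ≤ (α * ‖z‖ - (c + μ)) ^ 2 / (2 * α) := by positivity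
    have h5 : (α * ‖z‖ - (c + μ)) ^ 2 / (2 * α) =
        α / 2 * ‖z‖ ^ 2 - (c + μ) * ‖z‖ + (c + μ) ^ 2 / (2 * α) := by
      field_simp
      ring
    unfold energy
    linarith
  · refine (convex_Icc 0 D.T).norm_image_sub_le_of_norm_hasDerivWithin_le
      (fun t ht => hD.hasDerivWithinAt_energy ht z) (fun t ht => ?_) h₁ h₂
    rw [norm_neg]
    exact hdt t ht z

theorem exists_energy_lipschitz (hD : D.StandingAssumptions) {M : ℝ} (hM : 0 ≤ M) :
    ∃ L : ℝ, 0 < L ∧ ∀ t₁ ∈ Icc 0 D.T, ∀ t₂ ∈ Icc 0 D.T, ∀ z₁ z₂ : V, ‖z₁‖ ≤ M → ‖z₂‖ ≤ M →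
      |D.energy t₁ z₁ - D.energy t₂ z₂| ≤ L * (|t₁ - t₂| + ‖z₁ - z₂‖) := by
  obtain ⟨μ, K, hμ, -, ht⟩ := hD.exists_energy_time_bound
  obtain ⟨L, hL, hdz⟩ := hD.exists_dzEnergy_lipschitz hM
  set B := ‖D.dzEnergy 0 0‖ + L * (D.T + M) with hB
  have hT := hD.T_pos
  refine ⟨μ * (M + 1) + B, by positivity, fun t₁ h₁ t₂ h₂ z₁ z₂ hz₁ hz₂ => ?_⟩
  have h3 : |D.energy t₁ z₁ - D.energy t₁ z₂| ≤ B * ‖z₁ - z₂‖ := by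
    refine (convex_closedBall (0 : V) M).norm_image_sub_le_of_norm_hasFDerivWithin_le (𝕜 := ℝ)
      (fun z _ => (hD.hasFDerivAt_energy h₁.1 z).hasFDerivWithinAt) (fun z hz => ?_)
      (mem_closedBall_zero_iff.2 hz₂) (mem_closedBall_zero_iff.2 hz₁)
    have hz' : ‖z‖ ≤ M := mem_closedBall_zero_iff.1 hz
    have h4 := hdz t₁ 0 h₁.1 le_rfl z 0 hz' (by simpa using hM)
    rw [sub_zero, sub_zero, abs_of_nonneg h₁.1] at h4
    refine (norm_le_norm_add_norm_sub' _ (D.dzEnergy 0 0)).trans (add_le_add_right ?_ _)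
    refine h4.trans ?_
    gcongr
    exact h₁.2
  have h5 : |D.energy t₁ z₂ - D.energy t₂ z₂| ≤ μ * (M + 1) * |t₁ - t₂| := by
    refine (ht t₂ h₂ t₁ h₁ z₂).trans ?_
    gcongr
  have h6 := abs_sub_le (D.energy t₁ z₁) (D.energy t₁ z₂) (D.energy t₂ z₂)
  have h7 : 0 ≤ B := by positivity
  nlinarith [mul_nonneg h7 (abs_nonneg (t₁ - t₂)),
    mul_nonneg (mul_nonneg hμ.le (by linarith : 0 ≤ M + 1)) (norm_nonneg (z₁ - z₂))]

/-- Chain rule for the energy along a curve. -/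
theorem hasDerivAt_energy_comp (hD : D.StandingAssumptions) {t : ℝ → ℝ} {z : ℝ → V} {s t' : ℝ}
    {z' : V} (ht : HasDerivAt t t' s) (hz : HasDerivAt z z' s)
    (hT : ∀ᶠ r in 𝓝 s, t r ∈ Icc 0 D.T) :
    HasDerivAt (fun r => D.energy (t r) (z r))
      (D.dtEnergy (t s) (z s) * t' + D.dzEnergy (t s) (z s) z') s := by
  have hts : t s ∈ Icc 0 D.T := hT.self_of_nhds
  have h2 := HasFDerivWithinAt.comp_hasDerivAt s (f := fun r => (t r, z r))
    (hD.hasFDerivWithinAt_f hts (z s)) (ht.prodMk hz) (hT.mono fun r hr => ⟨hr, mem_univ _⟩)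
  have h3 := (hasFDerivAt_half_quadratic hD.A_symm (z s)).add
    (hD.F_contDiff.differentiable two_ne_zero (z s)).hasFDerivAt
  have h4 := (h3.comp_hasDerivAt s hz).sub h2
  refine h4.congr_deriv ?_
  have h5 : ((t', z') : ℝ × V) = t' • ((1, 0) : ℝ × V) + (0, z') := by simp
  have h6 : D.dtf (t s) (z s) = _ :=
    (hD.hasDerivWithinAt_f hts (z s)).derivWithin (uniqueDiffOn_Icc hD.T_pos _ hts)
  rw [h5, map_add, map_smul, ← h6, ← hD.fderiv_f_eq hts, hD.dtEnergy_eq hts,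
    hD.dzEnergy_eq hts.1]
  simp only [sub_apply, add_apply, smul_eq_mul]
  ring

end StandingAssumptions

end RISData

/-- The integral of a nonnegative continuous function dominates that of a constant lower bound on
a subinterval. -/
theorem ContinuousOn.mul_le_intervalIntegral_of_nonneg {f : ℝ → ℝ} {a b c c' m : ℝ}
    (hf : ContinuousOn f (Icc a b)) (h0 : ∀ s ∈ Icc a b, 0 ≤ f s) (hac : a ≤ c) (hcc : c ≤ c')
    (hcb : c' ≤ b) (hm : ∀ s ∈ Icc c c', m ≤ f s) : (c' - c) * m ≤ ∫ s in a..b, f s := by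
  have hab : a ≤ b := hac.trans (hcc.trans hcb)
  have hint : IntervalIntegrable f volume a b := hf.intervalIntegrable_of_Icc hab
  calc (c' - c) * m = ∫ _ in c..c', m := by simp
    _ ≤ ∫ s in c..c', f s :=
        intervalIntegral.integral_mono_on hcc intervalIntegrable_const
          ((hf.mono (Icc_subset_Icc hac hcb)).intervalIntegrable_of_Icc hcc) hm
    _ ≤ ∫ s in a..b, f s := by
        refine intervalIntegral.integral_mono_interval hac hcc hcb ?_ hint
        filter_upwards [ae_restrict_mem measurableSet_Ioc] with s hs
        exact h0 s (Ioc_subset_Icc_self hs)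

/-! ### One step of the scheme: existence of iterates and estimates for the residuals. -/

namespace RISData

variable {V W X : Type*} [NormedAddCommGroup V] [InnerProductSpace ℝ V]
  [NormedAddCommGroup W] [NormedSpace ℝ W] [NormedAddCommGroup X] [NormedSpace ℝ X]
  {D : RISData V W X}

namespace StandingAssumptions

/-! ### A single step of the scheme -/

/-- The incremental minimization problem yields an admissible iterate. -/
theorem exists_isIterate (hD : D.StandingAssumptions) {t₀ τ : ℝ} (ht : 0 ≤ t₀) (hτ : 0 ≤ τ)
    (z₀ : V) : ∃ z, D.IsIterate t₀ z₀ τ z := by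
  have := hD.finiteDimensional
  have : ProperSpace V := FiniteDimensional.proper ℝ V
  obtain ⟨C, hC, hCn⟩ := hD.exists_norm_le_normV
  set K : Set V := {z | D.normV (z - z₀) ≤ τ} with hK
  have hnorm : Continuous D.normV := continuous_normV
  have hclosed : IsClosed K :=
    isClosed_le (hnorm.comp (continuous_id.sub continuous_const)) continuous_const
  have hKcpt : IsCompact K := by
    refine Metric.isCompact_of_isClosed_isBounded hclosed
      ((Metric.isBounded_closedBall (x := z₀) (r := C * τ)).subset fun z hz => ?_)
    rw [Metric.mem_closedBall, dist_eq_norm]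
    exact (hCn _).trans (mul_le_mul_of_nonneg_left hz hC.le)
  have hz₀ : z₀ ∈ K := by simp [hK, normV_zero, hτ]
  have hcont : Continuous fun z => D.energy t₀ z + D.Rv (z - z₀) := by
    have h1 : Continuous (D.energy t₀) :=
      continuous_iff_continuousAt.2 fun z => (hD.hasFDerivAt_energy ht z).continuousAt
    exact h1.add (hD.continuous_Rv.comp (continuous_id.sub continuous_const))
  -- One minimizer serves both requirements: its first order condition is the inclusion, and
  -- comparison with `z₀` is the energy estimate.
  obtain ⟨z, hz, hmin⟩ := hKcpt.exists_isMinOn ⟨z₀, hz₀⟩ hcont.continuousOn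
  have hKconv : Convex ℝ K := by
    intro x hx y hy p q hp hq hpq
    have h1 : p • x + q • y - z₀ = p • (x - z₀) + q • (y - z₀) := by
      have h0 : z₀ = p • z₀ + q • z₀ := by rw [← add_smul, hpq, one_smul]
      nth_rw 1 [h0]
      module
    have h2 := hD.normV_add_le (p • (x - z₀)) (q • (y - z₀))
    rw [normV_smul, normV_smul, abs_of_nonneg hp, abs_of_nonneg hq] at h2
    simp only [hK, mem_ofPred_eq] at hx hy ⊢
    rw [h1]
    calc _ ≤ p * D.normV (x - z₀) + q * D.normV (y - z₀) := h2
      _ ≤ p * τ + q * τ := by gcongr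
      _ = τ := by rw [← add_mul, hpq, one_mul]
  have hRconv : ConvexOn ℝ univ fun z => D.Rv (z - z₀) := by
    have h := hD.Rv_convexOn.translate_left (-z₀)
    simpa [Function.comp_def, sub_eq_add_neg, preimage_univ] using h
  refine ⟨z, (hD.mem_convexSubdiff_ball_iff hτ).2 ⟨hz, fun w hw => ?_⟩, ?_⟩
  · have h1 := hmin.fderiv_add_convex_nonneg hKconv hRconv (hD.hasFDerivAt_energy ht z) hz
      (w := w + z₀) (by simpa [hK] using hw)
    have h2 : w + z₀ - z = w - (z - z₀) := by abel
    rw [add_sub_cancel_right, h2] at h1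
    rw [neg_apply]
    linarith
  · have h1 := hmin hz₀
    simpa [hD.Rv_zero] using h1

theorem isIterate_eq (hD : D.StandingAssumptions) {t₀ τ : ℝ} (hτ : 0 ≤ τ) {z₀ z : V}
    (h : D.IsIterate t₀ z₀ τ z) : D.normV (z - z₀) ≤ τ ∧
      -D.dzEnergy t₀ z (z - z₀) = D.Rv (z - z₀) + D.normV (z - z₀) * D.stabDist t₀ z ∧
      (τ - D.normV (z - z₀)) * D.stabDist t₀ z = 0 :=
  hD.convexSubdiff_ball_eq hτ h.1

/-- The rates of a step: time rate and state rate add up to one, the step is stable unless time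
stands still, and the force does the dissipated work. -/
theorem isIterate_rates (hD : D.StandingAssumptions) {t₀ τ : ℝ} (hτ : 0 < τ) {z₀ z : V}
    (h : D.IsIterate t₀ z₀ τ z) :
    0 ≤ (D.newTime t₀ z₀ τ z - t₀) / τ ∧
      (D.newTime t₀ z₀ τ z - t₀) / τ + D.normV (τ⁻¹ • (z - z₀)) = 1 ∧
      (D.newTime t₀ z₀ τ z - t₀) / τ * D.stabDist t₀ z = 0 ∧
      -D.dzEnergy t₀ z (τ⁻¹ • (z - z₀)) = D.Rv (τ⁻¹ • (z - z₀)) +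
        D.normV (τ⁻¹ • (z - z₀)) * D.stabDist t₀ z := by
  obtain ⟨h1, h2, h3⟩ := hD.isIterate_eq hτ.le h
  have h4 : D.newTime t₀ z₀ τ z - t₀ = τ - D.normV (z - z₀) := by unfold newTime; ring
  have h5 : D.normV (τ⁻¹ • (z - z₀)) = τ⁻¹ * D.normV (z - z₀) := by
    rw [normV_smul, abs_of_pos (inv_pos.2 hτ)]
  rw [h4, h5, hD.Rv_smul (inv_pos.2 hτ).le, map_smul, smul_eq_mul]
  refine ⟨div_nonneg (by linarith) hτ.le, ?_, ?_, ?_⟩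
  · field_simp
    ring
  · rw [div_mul_eq_mul_div, h3, zero_div]
  · rw [← mul_neg, h2]
    ring

theorem le_newTime (hD : D.StandingAssumptions) {t₀ τ : ℝ} (hτ : 0 ≤ τ) {z₀ z : V}
    (h : D.IsIterate t₀ z₀ τ z) : t₀ ≤ D.newTime t₀ z₀ τ z := by
  have := (hD.isIterate_eq hτ h).1
  unfold newTime
  linarith

/-- The integrand of the second residual is the defect of the energy balance. -/
theorem resid₂_eq (hD : D.StandingAssumptions) (s₀ : ℝ) {t₀ τ : ℝ} (hτ : 0 < τ) {z₀ z : V}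
    (h : D.IsIterate t₀ z₀ τ z) {t' : ℝ} {z' : V} (ht' : t' = (D.newTime t₀ z₀ τ z - t₀) / τ)
    (hz' : z' = τ⁻¹ • (z - z₀)) :
    D.resid₂ s₀ t₀ z₀ τ z = ∫ s in s₀..(s₀ + τ),
      (D.dzEnergy (t₀ + (s - s₀) * t') (z₀ + (s - s₀) • z') z' + D.Rv z' +
        D.normV z' * D.stabDist (t₀ + (s - s₀) * t') (z₀ + (s - s₀) • z')) := by
  subst ht' hz'
  refine intervalIntegral.integral_congr fun s _ => ?_
  have h1 := (hD.isIterate_rates hτ h).2.2.2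
  simp only [sub_apply]
  linarith

/-- Duality applied to the force `-D_z I`. It is used twice: it makes the second residual monotone
in the domain of integration, and in the limit it supplies the inequality that the scheme does not.
-/
theorem balance_defect_nonneg (hD : D.StandingAssumptions) (t : ℝ) (z v : V) :
    0 ≤ D.dzEnergy t z v + D.Rv v + D.normV v * D.stabDist t z := by
  have h := hD.apply_le_Rv_add (-D.dzEnergy t z) v
  rw [neg_apply] at h
  unfold stabDist
  linarith

theorem continuousOn_step (hD : D.StandingAssumptions) {s₀ t₀ τ t' : ℝ} (ht : 0 ≤ t₀) (ht' : 0 ≤ t')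
    (z₀ z' : V) :
    ContinuousOn (fun s => D.dzEnergy (t₀ + (s - s₀) * t') (z₀ + (s - s₀) • z'))
        (Icc s₀ (s₀ + τ)) ∧
      ContinuousOn (fun s => D.stabDist (t₀ + (s - s₀) * t') (z₀ + (s - s₀) • z'))
        (Icc s₀ (s₀ + τ)) := by
  have h1 : Continuous fun s => t₀ + (s - s₀) * t' := by fun_prop
  have h2 : Continuous fun s => z₀ + (s - s₀) • z' := by fun_prop
  have h3 : ∀ s ∈ Icc s₀ (s₀ + τ), 0 ≤ t₀ + (s - s₀) * t' := fun s hs =>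
    add_nonneg ht (mul_nonneg (by linarith [hs.1]) ht')
  exact ⟨hD.continuousOn_dzEnergy_comp h1.continuousOn h2.continuousOn h3,
    hD.continuousOn_stabDist_comp h1.continuousOn h2.continuousOn h3⟩

/-- Since the integrand is nonnegative, the residual of the whole step controls every part of it.
This is needed because the ends of the intervals considered later may cut a step. -/
theorem mul_le_resid₁ (hD : D.StandingAssumptions) {s₀ t₀ τ c c' m : ℝ} (ht : 0 ≤ t₀) (hτ : 0 < τ)
    {z₀ z : V} (h : D.IsIterate t₀ z₀ τ z) {t' : ℝ} {z' : V}
    (ht' : t' = (D.newTime t₀ z₀ τ z - t₀) / τ) (hz' : z' = τ⁻¹ • (z - z₀)) (hc : s₀ ≤ c)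
    (hcc : c ≤ c') (hc' : c' ≤ s₀ + τ)
    (hm : ∀ s ∈ Icc c c', m ≤ t' * D.stabDist (t₀ + (s - s₀) * t') (z₀ + (s - s₀) • z')) :
    (c' - c) * m ≤ D.resid₁ s₀ t₀ z₀ τ z := by
  have h0 : 0 ≤ t' := ht' ▸ (hD.isIterate_rates hτ h).1
  have hcont := (hD.continuousOn_step (s₀ := s₀) (τ := τ) ht h0 z₀ z').2
  have h1 := (continuousOn_const (c := t')).mul hcont
    |>.mul_le_intervalIntegral_of_nonneg (fun s _ => mul_nonneg h0 (hD.stabDist_nonneg _ _))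
      hc hcc hc' hm
  subst ht' hz'
  exact h1

theorem mul_le_resid₂ (hD : D.StandingAssumptions) {s₀ t₀ τ c c' m : ℝ} (ht : 0 ≤ t₀) (hτ : 0 < τ)
    {z₀ z : V} (h : D.IsIterate t₀ z₀ τ z) {t' : ℝ} {z' : V}
    (ht' : t' = (D.newTime t₀ z₀ τ z - t₀) / τ) (hz' : z' = τ⁻¹ • (z - z₀)) (hc : s₀ ≤ c)
    (hcc : c ≤ c') (hc' : c' ≤ s₀ + τ)
    (hm : ∀ s ∈ Icc c c', m ≤ D.dzEnergy (t₀ + (s - s₀) * t') (z₀ + (s - s₀) • z') z' + D.Rv z' +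
        D.normV z' * D.stabDist (t₀ + (s - s₀) * t') (z₀ + (s - s₀) • z')) :
    (c' - c) * m ≤ D.resid₂ s₀ t₀ z₀ τ z := by
  have h0 : 0 ≤ t' := ht' ▸ (hD.isIterate_rates hτ h).1
  obtain ⟨hc1, hc2⟩ := hD.continuousOn_step (s₀ := s₀) (τ := τ) ht h0 z₀ z'
  rw [hD.resid₂_eq s₀ hτ h ht' hz']
  exact ((hc1.clm_apply continuousOn_const).add continuousOn_const).add
      (continuousOn_const.mul hc2)
    |>.mul_le_intervalIntegral_of_nonneg (fun s _ => hD.balance_defect_nonneg _ _ _) hc hcc hc' hm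

/-- The residuals are of second order in the step size, uniformly on bounded sets. -/
theorem exists_resid_le (hD : D.StandingAssumptions) {M : ℝ} (hM : 0 ≤ M) :
    ∃ C : ℝ, 0 < C ∧ ∀ s₀ t₀ τ : ℝ, 0 ≤ t₀ → 0 < τ → ∀ z₀ z : V, ‖z₀‖ ≤ M → ‖z‖ ≤ M →
      D.IsIterate t₀ z₀ τ z →
        D.resid₁ s₀ t₀ z₀ τ z ≤ C * τ ^ 2 ∧ D.resid₂ s₀ t₀ z₀ τ z ≤ C * τ ^ 2 := by
  obtain ⟨L₁, hL₁, h₁⟩ := hD.exists_dzEnergy_lipschitz hM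
  obtain ⟨L₂, hL₂, h₂⟩ := hD.exists_stabDist_lipschitz hM
  obtain ⟨N, hN, hn⟩ := hD.exists_norm_le_normV
  -- Both integrands vanish when the forces are evaluated at `(t₀, z)`. Points of the segment are
  -- within `(1 + N) τ` of `(t₀, z)`, which gives one power of `τ`; the length of the interval gives
  -- the other.
  refine ⟨L₁ * (1 + N) * N + L₂ * (1 + N), by positivity, ?_⟩
  intro s₀ t₀ τ ht hτ z₀ z hz₀ hz h
  obtain ⟨hr1, hr2, hr3, hr4⟩ := hD.isIterate_rates hτ h
  have hres₂ := hD.resid₂_eq s₀ hτ h rfl rfl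
  have hres₁ : D.resid₁ s₀ t₀ z₀ τ z = ∫ s in s₀..(s₀ + τ), (D.newTime t₀ z₀ τ z - t₀) / τ *
    D.stabDist (t₀ + (s - s₀) * ((D.newTime t₀ z₀ τ z - t₀) / τ))
      (z₀ + (s - s₀) • (τ⁻¹ • (z - z₀))) := rfl
  generalize (D.newTime t₀ z₀ τ z - t₀) / τ = t' at hr1 hr2 hr3 hres₁ hres₂
  generalize hz'def : τ⁻¹ • (z - z₀) = z' at hr2 hr4 hres₁ hres₂
  have hz' : ‖z'‖ ≤ N := (hn z').trans (by
    have : D.normV z' ≤ 1 := by linarith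
    nlinarith)
  have hpt : ∀ s ∈ Icc s₀ (s₀ + τ), 0 ≤ t₀ + (s - s₀) * t' ∧ ‖z₀ + (s - s₀) • z'‖ ≤ M ∧
      |t₀ + (s - s₀) * t' - t₀| + ‖z₀ + (s - s₀) • z' - z‖ ≤ (1 + N) * τ := by
    intro s hs
    have hs1 : 0 ≤ s - s₀ := by linarith [hs.1]
    have hs2 : s - s₀ ≤ τ := by linarith [hs.2]
    have ht1 : t' ≤ 1 := by linarith [normV_nonneg (D := D) z']
    have hzz : z - z₀ = τ • z' := by rw [← hz'def, smul_inv_smul₀ hτ.ne']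
    refine ⟨by positivity, ?_, ?_⟩
    · have hcomb : z₀ + (s - s₀) • z' = (1 - (s - s₀) / τ) • z₀ + ((s - s₀) / τ) • z := by
        rw [← hz'def, smul_smul, ← div_eq_mul_inv]
        module
      have hp : (s - s₀) / τ ≤ 1 := (div_le_one hτ).2 hs2
      have hp0 : 0 ≤ (s - s₀) / τ := by positivity
      rw [hcomb]
      refine (norm_add_le _ _).trans ?_
      rw [norm_smul, norm_smul, Real.norm_of_nonneg hp0, Real.norm_of_nonneg (by linarith)]
      calc _ ≤ (1 - (s - s₀) / τ) * M + (s - s₀) / τ * M := by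
            gcongr
        _ = M := by ring
    · have h3 : z₀ + (s - s₀) • z' - z = -((τ - (s - s₀)) • z') := by
        rw [sub_smul τ, ← hzz]
        abel
      rw [h3, norm_neg, norm_smul, Real.norm_of_nonneg (by linarith), add_sub_cancel_left,
        abs_of_nonneg (by positivity)]
      nlinarith [norm_nonneg z']
  have hbound : ∀ f : ℝ → ℝ, ∀ B : ℝ, (∀ s ∈ Icc s₀ (s₀ + τ), 0 ≤ f s ∧ f s ≤ B * τ) →
      ∫ s in s₀..(s₀ + τ), f s ≤ B * τ ^ 2 := by
    intro f B hf
    have h3 := intervalIntegral.norm_integral_le_of_norm_le_const (f := f) (C := B * τ)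
      (a := s₀) (b := s₀ + τ) (fun s hs => by
        rw [uIoc_of_le (by linarith)] at hs
        obtain ⟨h4, h5⟩ := hf s (Ioc_subset_Icc_self hs)
        rwa [Real.norm_of_nonneg h4])
    rw [add_sub_cancel_left, abs_of_pos hτ] at h3
    exact (le_abs_self _).trans (h3.trans (by rw [sq, mul_assoc]))
  have hd : ∀ s ∈ Icc s₀ (s₀ + τ), D.stabDist (t₀ + (s - s₀) * t') (z₀ + (s - s₀) • z') ≤
      D.stabDist t₀ z + L₂ * ((1 + N) * τ) := by
    intro s hs
    obtain ⟨h3, h4, h5⟩ := hpt s hs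
    refine (h₂ _ t₀ h3 ht _ z h4 hz).trans ?_
    gcongr
  have hpos : 0 ≤ L₁ * (1 + N) * N := by positivity
  constructor
  · rw [hres₁]
    refine (hbound _ (L₂ * (1 + N)) fun s hs =>
      ⟨mul_nonneg hr1 (hD.stabDist_nonneg _ _), ?_⟩).trans (by gcongr; linarith)
    have h3 := mul_le_mul_of_nonneg_left (hd s hs) hr1
    rw [mul_add, hr3, zero_add] at h3
    refine h3.trans ((mul_le_of_le_one_left (by positivity) ?_).trans (by rw [mul_assoc]))
    linarith [normV_nonneg (D := D) z']
  · rw [hres₂]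
    refine hbound _ _ fun s hs => ⟨hD.balance_defect_nonneg _ _ _, ?_⟩
    obtain ⟨h3, h4, h5⟩ := hpt s hs
    have h6 : (D.dzEnergy (t₀ + (s - s₀) * t') (z₀ + (s - s₀) • z') - D.dzEnergy t₀ z) z' ≤
        L₁ * ((1 + N) * τ) * N := by
      refine (Real.le_norm_self _).trans ((ContinuousLinearMap.le_opNorm _ z').trans ?_)
      gcongr
      exact (h₁ _ t₀ h3 ht _ z h4 hz).trans (by gcongr)
    have h7 := mul_le_mul_of_nonneg_left (hd s hs) (normV_nonneg (D := D) z')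
    have h8 : D.normV z' * (L₂ * ((1 + N) * τ)) ≤ L₂ * ((1 + N) * τ) :=
      mul_le_of_le_one_left (by positivity) (by linarith)
    rw [sub_apply] at h6
    linarith

end StandingAssumptions

end RISData

/-! ### Affine interpolants as weighted sums of velocities. -/

section AffineInterpolation

theorem exists_mem_Ico_of_lt {σ : ℕ → ℝ} {N : ℕ} {s : ℝ} (h0 : σ 0 ≤ s) (hN : s < σ N) :
    ∃ k < N, s ∈ Ico (σ k) (σ (k + 1)) := by
  classical
  have hex : ∃ k, s < σ k := ⟨N, hN⟩
  obtain ⟨k, hk⟩ : ∃ k, Nat.find hex = k + 1 := by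
    refine Nat.exists_eq_succ_of_ne_zero fun h1 => ?_
    have := Nat.find_spec hex
    rw [h1] at this
    exact this.not_ge h0
  refine ⟨k, ?_, ?_, hk ▸ Nat.find_spec hex⟩
  · have := Nat.find_min' hex hN
    omega
  · exact not_lt.1 (Nat.find_min hex (by omega))

variable {E : Type*} [NormedAddCommGroup E] [NormedSpace ℝ E]

/-- The velocity of the affine interpolant on `[σ j, σ (j + 1))`. -/
noncomputable def interpVelocity (σ : ℕ → ℝ) (x : ℕ → E) (j : ℕ) : E :=
  (σ (j + 1) - σ j)⁻¹ • (x (j + 1) - x j)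

/-- The length of `[a,b] ∩ [σ j, σ (j + 1)]`. -/
noncomputable def interpWeight (σ : ℕ → ℝ) (a b : ℝ) (j : ℕ) : ℝ :=
  (min b (σ (j + 1)) - min b (σ j)) - (min a (σ (j + 1)) - min a (σ j))

/-- Nodes `(σ j, x j)` that an affine interpolant can join: the parameters increase and become
constant from `N` on, and equal consecutive parameters have equal values. -/
structure InterpNodes (σ : ℕ → ℝ) (x : ℕ → E) (N : ℕ) : Prop where
  mono : Monotone σ
  eq_of_eq : ∀ j, σ j = σ (j + 1) → x j = x (j + 1)
  const : ∀ j, N ≤ j → σ j = σ N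

variable {σ : ℕ → ℝ} {x : ℕ → E} {N : ℕ}

omit [NormedSpace ℝ E] in
theorem interpWeight_nonneg (hσ : Monotone σ) {a b : ℝ} (hab : a ≤ b) (j : ℕ) :
    0 ≤ interpWeight σ a b j := by
  have h := hσ j.le_succ
  simp only [Nat.succ_eq_add_one] at h
  unfold interpWeight
  grind

theorem interpWeight_eq_of_pos (hσ : Monotone σ) {a b : ℝ} (hab : a ≤ b) {j : ℕ}
    (h : 0 < interpWeight σ a b j) :
    max a (σ j) ≤ min b (σ (j + 1)) ∧
      interpWeight σ a b j = min b (σ (j + 1)) - max a (σ j) := by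
  have h1 := hσ j.le_succ
  simp only [Nat.succ_eq_add_one] at h1
  unfold interpWeight at h ⊢
  grind

theorem sum_interpWeight_le {a b : ℝ} (ha : σ 0 ≤ a) (hab : a ≤ b) (N : ℕ) :
    ∑ j ∈ Finset.range N, interpWeight σ a b j ≤ b - a := by
  simp only [interpWeight, Finset.sum_sub_distrib]
  rw [← Finset.sum_sub_distrib, ← Finset.sum_sub_distrib,
    Finset.sum_range_sub (fun j => min b (σ j)), Finset.sum_range_sub (fun j => min a (σ j))]
  grind

namespace InterpNodes

/-- On an empty interval, such as one from a rejected pass, the velocity is zero by the convention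
`0⁻¹ = 0`; the nodes then coincide, so the identity persists. -/
theorem smul_velocity (h : InterpNodes σ x N) (j : ℕ) :
    (σ (j + 1) - σ j) • interpVelocity σ x j = x (j + 1) - x j := by
  unfold interpVelocity
  by_cases hj : σ j = σ (j + 1)
  · rw [h.eq_of_eq j hj]
    simp
  · exact smul_inv_smul₀ (sub_ne_zero.2 (Ne.symm hj)) _

theorem eq_add_sum (h : InterpNodes σ x N) (k : ℕ) :
    x k = x 0 + ∑ j ∈ Finset.range k, (σ (j + 1) - σ j) • interpVelocity σ x j := by
  simp only [h.smul_velocity, Finset.sum_range_sub, add_sub_cancel]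

/-- Closed form of the interpolant. -/
noncomputable def _root_.interpSum (σ : ℕ → ℝ) (x : ℕ → E) (N : ℕ) (s : ℝ) : E :=
  x 0 + ∑ j ∈ Finset.range N, (min s (σ (j + 1)) - min s (σ j)) • interpVelocity σ x j

/-- Intervals after the `k`-th contribute nothing, and those before it contribute their full
increments, which telescope to `x k`. -/
theorem interpSum_of_mem (h : InterpNodes σ x N) {k : ℕ} (hk : k < N) {s : ℝ}
    (hs : s ∈ Icc (σ k) (σ (k + 1))) :
    interpSum σ x N s = x k + (s - σ k) • interpVelocity σ x k := by
  have h1 : ∑ j ∈ Finset.range N, (min s (σ (j + 1)) - min s (σ j)) • interpVelocity σ x j =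
      ∑ j ∈ Finset.range (k + 1), (min s (σ (j + 1)) - min s (σ j)) • interpVelocity σ x j := by
    refine (Finset.sum_subset (Finset.range_mono hk) fun j _ hj => ?_).symm
    have hkj : k + 1 ≤ j := by simpa using hj
    have h2 : s ≤ σ j := hs.2.trans (h.mono hkj)
    rw [min_eq_left h2, min_eq_left (h2.trans (h.mono j.le_succ)), sub_self, zero_smul]
  rw [interpSum, h1, Finset.sum_range_succ, min_eq_left hs.2, min_eq_right hs.1, ← add_assoc,
    h.eq_add_sum k]
  congr 2
  refine Finset.sum_congr rfl fun j hj => ?_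
  have hjk : j + 1 ≤ k := Finset.mem_range.1 hj
  have h2 : σ (j + 1) ≤ s := (h.mono hjk).trans hs.1
  rw [min_eq_right h2, min_eq_right ((h.mono j.le_succ).trans h2)]

theorem interpSum_of_le (h : InterpNodes σ x N) {s : ℝ} (hs : σ N ≤ s) :
    interpSum σ x N s = x N := by
  rw [interpSum, h.eq_add_sum N]
  congr 1
  refine Finset.sum_congr rfl fun j hj => ?_
  have hjk : j + 1 ≤ N := Finset.mem_range.1 hj
  have h2 : σ (j + 1) ≤ s := (h.mono hjk).trans hs
  rw [min_eq_right h2, min_eq_right ((h.mono j.le_succ).trans h2)]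

/-- The definition picks an arbitrary interval containing `s`; the closed form does not depend on
the choice and exhibits increments as linear in the velocities. -/
theorem affineInterp_eq (h : InterpNodes σ x N) {s : ℝ} (hs : σ 0 ≤ s) :
    affineInterp σ x N s = interpSum σ x N s := by
  unfold affineInterp
  split_ifs with hex
  · have hmem := hex.choose_spec
    generalize hex.choose = k at hmem
    -- From `N` on the intervals `[σ k, σ (k + 1))` are empty.
    have hk : k < N := by
      by_contra hk
      have h1 := h.const k (not_lt.1 hk)
      have h2 := h.const (k + 1) (by omega)
      have := hmem.1.trans_lt hmem.2
      rw [h1, h2] at this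
      exact this.false
    rw [h.interpSum_of_mem hk (Ico_subset_Icc_self hmem), interpVelocity, smul_smul,
      div_eq_mul_inv]
  · rw [h.interpSum_of_le]
    by_contra hlt
    obtain ⟨k, -, hk⟩ := exists_mem_Ico_of_lt hs (not_le.1 hlt)
    exact hex ⟨k, hk⟩

theorem affineInterp_of_mem (h : InterpNodes σ x N) {k : ℕ} (hk : k < N) {s : ℝ}
    (hs : s ∈ Icc (σ k) (σ (k + 1))) :
    affineInterp σ x N s = x k + (s - σ k) • interpVelocity σ x k := by
  rw [h.affineInterp_eq ((h.mono (Nat.zero_le _)).trans hs.1), h.interpSum_of_mem hk hs]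

theorem affineInterp_of_le (h : InterpNodes σ x N) {s : ℝ} (hs : σ N ≤ s) :
    affineInterp σ x N s = x N := by
  rw [h.affineInterp_eq ((h.mono (Nat.zero_le _)).trans hs), h.interpSum_of_le hs]

theorem affineInterp_zero (h : InterpNodes σ x N) : affineInterp σ x N (σ 0) = x 0 := by
  have h1 : ∀ j, σ 0 ≤ σ j := fun j => h.mono (Nat.zero_le _)
  rw [h.affineInterp_eq le_rfl, interpSum]
  simp [h1]

/-- The increments of the interpolant are weighted sums of the velocities. -/
theorem affineInterp_sub (h : InterpNodes σ x N) {a b : ℝ} (ha : σ 0 ≤ a) (hab : a ≤ b) :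
    affineInterp σ x N b - affineInterp σ x N a =
      ∑ j ∈ Finset.range N, interpWeight σ a b j • interpVelocity σ x j := by
  rw [h.affineInterp_eq ha, h.affineInterp_eq (ha.trans hab), interpSum, interpSum,
    add_sub_add_left_eq_sub, ← Finset.sum_sub_distrib]
  simp only [interpWeight, sub_smul]

/-- A sublinear functional of an increment is bounded by its values at the velocities. -/
theorem sublinear_affineInterp_sub_le (h : InterpNodes σ x N) {p : E → ℝ} (h0 : p 0 = 0)
    (hadd : ∀ v w, p (v + w) ≤ p v + p w) (hsmul : ∀ c : ℝ, 0 ≤ c → ∀ v, p (c • v) = c * p v)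
    {a b : ℝ} (ha : σ 0 ≤ a) (hab : a ≤ b) :
    p (affineInterp σ x N b - affineInterp σ x N a) ≤
      ∑ j ∈ Finset.range N, interpWeight σ a b j * p (interpVelocity σ x j) := by
  rw [h.affineInterp_sub ha hab]
  refine (Finset.le_sum_of_subadditive p h0.le hadd _ _).trans_eq ?_
  exact Finset.sum_congr rfl fun j _ => hsmul _ (interpWeight_nonneg h.mono hab j) _

theorem lipschitzOnWith (h : InterpNodes σ x N) {K : NNReal}
    (hK : ∀ j < N, ‖interpVelocity σ x j‖ ≤ K) :
    LipschitzOnWith K (affineInterp σ x N) (Ici (σ 0)) := by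
  have key : ∀ a b, σ 0 ≤ a → a ≤ b →
      dist (affineInterp σ x N b) (affineInterp σ x N a) ≤ K * dist b a := by
    intro a b ha hab
    rw [dist_eq_norm, Real.dist_eq, abs_of_nonneg (sub_nonneg.2 hab)]
    refine (h.sublinear_affineInterp_sub_le norm_zero norm_add_le
      (fun c hc v => by rw [norm_smul, Real.norm_of_nonneg hc]) ha hab).trans ?_
    calc _ ≤ ∑ j ∈ Finset.range N, interpWeight σ a b j * K :=
          Finset.sum_le_sum fun j hj => mul_le_mul_of_nonneg_left (hK j (Finset.mem_range.1 hj))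
            (interpWeight_nonneg h.mono hab j)
      _ ≤ K * (b - a) := by
          rw [← Finset.sum_mul, mul_comm]
          exact mul_le_mul_of_nonneg_left (sum_interpWeight_le ha hab N) K.2
  refine LipschitzOnWith.of_dist_le_mul fun a ha b hb => ?_
  rcases le_total a b with hab | hab
  · rw [dist_comm, dist_comm a]
    exact key a b ha hab
  · exact key b a hb hab

theorem affineInterp_mem (h : InterpNodes σ x N) {K : Set E} (hK : Convex ℝ K)
    (hx : ∀ j ≤ N, x j ∈ K) {s : ℝ} (hs : σ 0 ≤ s) : affineInterp σ x N s ∈ K := by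
  rcases le_or_gt (σ N) s with hN | hN
  · rw [h.affineInterp_of_le hN]
    exact hx N le_rfl
  · obtain ⟨k, hk, hmem⟩ := exists_mem_Ico_of_lt hs hN
    rw [h.affineInterp_of_mem hk (Ico_subset_Icc_self hmem), interpVelocity, smul_smul]
    have hpos : 0 < σ (k + 1) - σ k := by linarith [hmem.1, hmem.2]
    have h1 : 0 ≤ (s - σ k) * (σ (k + 1) - σ k)⁻¹ :=
      mul_nonneg (sub_nonneg.2 hmem.1) (inv_pos.2 hpos).le
    have h2 : (s - σ k) * (σ (k + 1) - σ k)⁻¹ ≤ 1 := by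
      rw [← div_eq_mul_inv, div_le_one hpos]
      linarith [hmem.2]
    have := hK.add_smul_sub_mem (hx k hk.le) (hx (k + 1) hk) ⟨h1, h2⟩
    exact this

end InterpNodes

end AffineInterpolation

/-! ### Executions: existence, a priori bounds and termination. -/

namespace RISData

variable {V W X : Type*} [NormedAddCommGroup V] [InnerProductSpace ℝ V]
  [NormedAddCommGroup W] [NormedSpace ℝ W] [NormedAddCommGroup X] [NormedSpace ℝ X]
  {D : RISData V W X} {tol τ₁ : ℝ} {a : ℕ → AlgState V}

namespace StandingAssumptions

/-! ### Executions of the scheme -/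

theorem exists_loopPass (hD : D.StandingAssumptions) (tol : ℝ) {a : AlgState V} (ht : 0 ≤ a.t)
    (hτ : 0 < a.τ) : ∃ b, D.LoopPass tol a b := by
  classical
  obtain ⟨z, hz⟩ := hD.exists_isIterate ht hτ.le a.z
  by_cases h1 : D.resid₁ a.s a.t a.z a.τ z < tol ∧ D.resid₂ a.s a.t a.z a.τ z < tol
  · by_cases h2 : D.resid₁ a.s a.t a.z a.τ z < tol / 2 ∧ D.resid₂ a.s a.t a.z a.τ z < tol / 2
    · exact ⟨⟨a.s + a.τ, D.newTime a.t a.z a.τ z, z, 2 * a.τ⟩, z, hz,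
        .inl ⟨h1, rfl, rfl, rfl, .inl ⟨h2.1, h2.2, rfl⟩⟩⟩
    · exact ⟨⟨a.s + a.τ, D.newTime a.t a.z a.τ z, z, a.τ⟩, z, hz,
        .inl ⟨h1, rfl, rfl, rfl, .inr ⟨h2, rfl⟩⟩⟩
  · exact ⟨⟨a.s, a.t, a.z, a.τ / 2⟩, z, hz, .inr ⟨h1, rfl, rfl, rfl, rfl⟩⟩

theorem loopPass_nonneg (hD : D.StandingAssumptions) {a b : AlgState V} (ht : 0 ≤ a.t)
    (hτ : 0 < a.τ) (h : D.LoopPass tol a b) : 0 ≤ b.t ∧ 0 < b.τ := by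
  obtain ⟨z, hz, ⟨-, -, hbt, -, hbτ⟩ | ⟨-, -, hbt, -, hbτ⟩⟩ := h
  · refine ⟨hbt ▸ ht.trans (hD.le_newTime hτ.le hz), ?_⟩
    rcases hbτ with ⟨-, -, h⟩ | ⟨-, h⟩ <;> rw [h] <;> positivity
  · exact ⟨hbt ▸ ht, by rw [hbτ]; positivity⟩

/-- Dependent choice on states with `0 ≤ t` and `0 < τ`, the invariant under which an iterate
exists. -/
theorem exists_execution (hD : D.StandingAssumptions) (tol : ℝ) (hτ₁ : 0 < τ₁) :
    ∃ a : ℕ → AlgState V, D.IsExecution tol τ₁ a := by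
  classical
  have hnext : ∀ a : {a : AlgState V // 0 ≤ a.t ∧ 0 < a.τ}, ∃ b : {a : AlgState V //
      0 ≤ a.t ∧ 0 < a.τ}, (a.1.t < D.T → D.LoopPass tol a.1 b.1) ∧ (D.T ≤ a.1.t → b = a) := by
    rintro ⟨a, ht, hτ⟩
    by_cases h : a.t < D.T
    · obtain ⟨b, hb⟩ := hD.exists_loopPass tol ht hτ
      exact ⟨⟨b, hD.loopPass_nonneg ht hτ hb⟩, fun _ => hb, fun h' => absurd h h'.not_gt⟩
    · exact ⟨⟨a, ht, hτ⟩, fun h' => absurd h' h, fun _ => rfl⟩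
  choose next hnext using hnext
  let a : ℕ → {a : AlgState V // 0 ≤ a.t ∧ 0 < a.τ} := fun j =>
    Nat.rec ⟨⟨0, 0, D.z₀, τ₁⟩, le_rfl, hτ₁⟩ (fun _ b => next b) j
  exact ⟨fun j => (a j).1, rfl, fun j hj => (hnext (a j)).1 hj,
    fun j hj => congrArg Subtype.val ((hnext (a j)).2 hj)⟩

theorem execution_nonneg (hD : D.StandingAssumptions) (hτ₁ : 0 < τ₁)
    (ha : D.IsExecution tol τ₁ a) (j : ℕ) : 0 ≤ (a j).t ∧ 0 < (a j).τ := by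
  induction j with
  | zero => rw [ha.init]; exact ⟨le_rfl, hτ₁⟩
  | succ j ih =>
    rcases lt_or_ge (a j).t D.T with h | h
    · exact hD.loopPass_nonneg ih.1 ih.2 (ha.pass j h)
    · rwa [ha.final j h]

theorem execution_t_mono (hD : D.StandingAssumptions) (hτ₁ : 0 < τ₁)
    (ha : D.IsExecution tol τ₁ a) : Monotone fun j => (a j).t := by
  refine monotone_nat_of_le_succ fun j => ?_
  rcases lt_or_ge (a j).t D.T with h | h
  · obtain ⟨z, hz, ⟨-, -, h, -⟩ | ⟨-, -, h, -⟩⟩ := ha.pass j h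
    · rw [h]
      exact hD.le_newTime (hD.execution_nonneg hτ₁ ha j).2.le hz
    · exact h.ge
  · rw [ha.final j h]

theorem execution_s_mono (hD : D.StandingAssumptions) (hτ₁ : 0 < τ₁)
    (ha : D.IsExecution tol τ₁ a) : Monotone fun j => (a j).s := by
  refine monotone_nat_of_le_succ fun j => ?_
  rcases lt_or_ge (a j).t D.T with h | h
  · obtain ⟨z, hz, ⟨-, h, -⟩ | ⟨-, h, -⟩⟩ := ha.pass j h
    · rw [h]
      linarith [(hD.execution_nonneg hτ₁ ha j).2]
    · exact h.ge
  · rw [ha.final j h]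

/-- A priori estimate: as long as the final time is not reached, states, new iterates and curve
parameters are bounded, uniformly over all executions. -/
theorem exists_apriori_bound (hD : D.StandingAssumptions) :
    ∃ M S : ℝ, 0 ≤ M ∧ 0 ≤ S ∧ ∀ (tol τ₁ : ℝ) (a : ℕ → AlgState V), 0 < τ₁ →
      D.IsExecution tol τ₁ a → ∀ j, (a j).t < D.T →
        ‖(a j).z‖ ≤ M ∧ (a j).s ≤ S ∧ ∀ z, D.IsIterate (a j).t (a j).z (a j).τ z → ‖z‖ ≤ M := by
  obtain ⟨μ, K, hμ, hcoer, htime⟩ := hD.exists_energy_time_bound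
  obtain ⟨C, hC, hCn⟩ := hD.exists_normV_le
  obtain ⟨κ, hκ, hκR⟩ := hD.exists_norm_le_Rv
  have hT := hD.T_pos
  have hnR : ∀ v, D.normV v ≤ C * κ * D.Rv v := fun v =>
    (hCn v).trans (by rw [mul_assoc]; exact mul_le_mul_of_nonneg_left (hκR v) hC.le)
  set e₀ := D.energy 0 D.z₀ + K with he₀
  have he₀0 : 0 < e₀ :=
    lt_of_lt_of_le (by positivity) (hcoer 0 ⟨le_rfl, hT.le⟩ D.z₀)
  have hexp : 0 < Real.exp D.T := Real.exp_pos _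
  -- The first bound is a discrete Gronwall estimate. In the second, `s - t` is the accumulated
  -- `𝕍`-length of the increments, which is paid for by the dissipated energy.
  have key : ∀ (tol τ₁ : ℝ) (a : ℕ → AlgState V), 0 < τ₁ → D.IsExecution tol τ₁ a → ∀ j,
      (a j).t < D.T → D.energy (a j).t (a j).z + K ≤ e₀ * Real.exp (a j).t ∧
        (a j).s - (a j).t + C * κ * (D.energy (a j).t (a j).z + K) ≤
          C * κ * (e₀ + e₀ * Real.exp D.T * (a j).t) := by
    intro tol τ₁ a hτ₁ ha j
    induction j with
    | zero => intro _; simp [ha.init, he₀]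
    | succ j ih =>
      intro hlt
      have hj : (a j).t < D.T := ((hD.execution_t_mono hτ₁ ha) j.le_succ).trans_lt hlt
      obtain ⟨ih1, ih2⟩ := ih hj
      obtain ⟨ht0, hτ0⟩ := hD.execution_nonneg hτ₁ ha j
      obtain ⟨z, hz, ⟨-, hs, ht, hzz, -⟩ | ⟨-, hs, ht, hzz, -⟩⟩ := ha.pass j hj
      · have hle := hD.le_newTime hτ0.le hz
        rw [← ht] at hle
        have hmem : (a j).t ∈ Icc 0 D.T := ⟨ht0, hj.le⟩
        have h1 := hcoer _ hmem z
        have h2 := hz.2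
        have h3 := le_of_abs_le (htime _ hmem (a (j + 1)).t ⟨ht0.trans hle, hlt.le⟩ z)
        have h4 := hnR (z - (a j).z)
        have h5 := hD.Rv_nonneg (z - (a j).z)
        have hR : (a (j + 1)).s - (a (j + 1)).t = (a j).s - (a j).t + D.normV (z - (a j).z) := by
          rw [hs, ht]
          unfold newTime
          ring
        rw [hR, hzz]
        set Δ := (a (j + 1)).t - (a j).t with hΔ
        have hΔ0 : 0 ≤ Δ := sub_nonneg.2 hle
        rw [abs_of_nonneg hΔ0] at h3
        -- The change of energy in time at the new state is bounded through the old state, because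
        -- the energy at the old time does not increase in the step.
        have h6 : μ * (‖z‖ + 1) * Δ ≤ (D.energy (a j).t (a j).z + K) * Δ :=
          mul_le_mul_of_nonneg_right (by linarith) hΔ0
        have h7 : D.energy (a (j + 1)).t z + K + D.Rv (z - (a j).z) ≤
            (D.energy (a j).t (a j).z + K) + (D.energy (a j).t (a j).z + K) * Δ := by linarith
        have ht1 : (a (j + 1)).t = (a j).t + Δ := by rw [hΔ]; ring
        constructor
        · rw [ht1, Real.exp_add]
          have h8 := mul_le_mul_of_nonneg_right ih1 (by linarith : (0 : ℝ) ≤ 1 + Δ)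
          have h9 : e₀ * Real.exp (a j).t * (1 + Δ) ≤ e₀ * Real.exp (a j).t * Real.exp Δ :=
            mul_le_mul_of_nonneg_left (by linarith [Real.add_one_le_exp Δ])
              (mul_nonneg he₀0.le (Real.exp_pos _).le)
          rw [← ht1]
          linarith
        · have h8 : (D.energy (a j).t (a j).z + K) * Δ ≤ e₀ * Real.exp D.T * Δ := by
            refine mul_le_mul_of_nonneg_right (ih1.trans ?_) hΔ0
            exact mul_le_mul_of_nonneg_left (Real.exp_le_exp.2 hj.le) he₀0.le
          have h9 := mul_le_mul_of_nonneg_left (h7.trans (add_le_add_right h8 _))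
            (mul_pos hC hκ).le
          rw [show e₀ * Real.exp D.T * (a (j + 1)).t =
            e₀ * Real.exp D.T * (a j).t + e₀ * Real.exp D.T * Δ by rw [hΔ]; ring]
          linarith
      · rw [hs, ht, hzz]
        exact ⟨ih1, ih2⟩
  refine ⟨e₀ * Real.exp D.T / μ, D.T + C * κ * (e₀ + e₀ * Real.exp D.T * D.T), by positivity,
    by positivity, fun tol τ₁ a hτ₁ ha j hj => ?_⟩
  obtain ⟨h1, h2⟩ := key tol τ₁ a hτ₁ ha j hj
  have ht0 := (hD.execution_nonneg hτ₁ ha j).1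
  have hmem : (a j).t ∈ Icc 0 D.T := ⟨ht0, hj.le⟩
  have h3 : e₀ * Real.exp (a j).t ≤ e₀ * Real.exp D.T :=
    mul_le_mul_of_nonneg_left (Real.exp_le_exp.2 hj.le) he₀0.le
  have hbound : ∀ z, D.energy (a j).t z ≤ D.energy (a j).t (a j).z →
      ‖z‖ ≤ e₀ * Real.exp D.T / μ := by
    intro z hz
    rw [le_div_iff₀ hμ]
    have h4 := hcoer _ hmem z
    nlinarith
  refine ⟨hbound _ le_rfl, ?_, fun z hz => hbound z ?_⟩
  · have h4 := hcoer _ hmem (a j).z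
    have h5 : 0 ≤ C * κ * (D.energy (a j).t (a j).z + K) :=
      mul_nonneg (mul_pos hC hκ).le (le_trans (by positivity) h4)
    have h6 : C * κ * (e₀ + e₀ * Real.exp D.T * (a j).t) ≤
        C * κ * (e₀ + e₀ * Real.exp D.T * D.T) := by gcongr
    linarith
  · linarith [hz.2, hD.Rv_nonneg (z - (a j).z)]

/-- Uniform bounds for all passes of all executions. -/
theorem exists_pass_bound (hD : D.StandingAssumptions) :
    ∃ M S C : ℝ, 0 ≤ M ∧ 0 ≤ S ∧ 0 < C ∧ ∀ (tol τ₁ : ℝ) (a : ℕ → AlgState V), 0 < τ₁ →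
      D.IsExecution tol τ₁ a → ∀ j, (a j).t < D.T →
        ‖(a j).z‖ ≤ M ∧ (a j).s ≤ S ∧ ∀ z, D.IsIterate (a j).t (a j).z (a j).τ z → ‖z‖ ≤ M ∧
          D.resid₁ (a j).s (a j).t (a j).z (a j).τ z ≤ C * (a j).τ ^ 2 ∧
          D.resid₂ (a j).s (a j).t (a j).z (a j).τ z ≤ C * (a j).τ ^ 2 := by
  obtain ⟨M, S, hM, hS, h⟩ := hD.exists_apriori_bound
  obtain ⟨C, hC, hres⟩ := hD.exists_resid_le hM
  refine ⟨M, S, C, hM, hS, hC, fun tol τ₁ a hτ₁ ha j hj => ?_⟩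
  obtain ⟨h1, h2, h3⟩ := h tol τ₁ a hτ₁ ha j hj
  obtain ⟨ht0, hτ0⟩ := hD.execution_nonneg hτ₁ ha j
  exact ⟨h1, h2, fun z hz => ⟨h3 z hz, hres _ _ _ ht0 hτ0 _ _ h1 (h3 z hz) hz⟩⟩

/-- Every execution reaches the final time. -/
theorem exists_final (hD : D.StandingAssumptions) (htol : 0 < tol) (hτ₁ : 0 < τ₁)
    (ha : D.IsExecution tol τ₁ a) : ∃ j, D.T ≤ (a j).t := by
  by_contra! hlt
  obtain ⟨M, S, C, -, -, hC, h⟩ := hD.exists_pass_bound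
  have hpos := fun j => (hD.execution_nonneg hτ₁ ha j).2
  -- A rejection forces `tol ≤ C τ²`, so the halved step is still at least `√(tol / (4 C))`.
  set q := min τ₁ (Real.sqrt (tol / (4 * C))) with hq
  have hq0 : 0 < q := lt_min hτ₁ (by positivity)
  have hτ : ∀ j, q ≤ (a j).τ := by
    intro j
    induction j with
    | zero => rw [ha.init]; exact min_le_left _ _
    | succ j ih =>
      obtain ⟨z, hz, ⟨-, -, -, -, ⟨-, -, hτ⟩ | ⟨-, hτ⟩⟩ | ⟨hrej, -, -, -, hτ⟩⟩ := ha.pass j (hlt j)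
      · rw [hτ]
        linarith [hpos j]
      · rwa [hτ]
      · obtain ⟨-, h1, h2⟩ := (h tol τ₁ a hτ₁ ha j (hlt j)).2.2 z hz
        have h3 : tol ≤ C * (a j).τ ^ 2 := by
          by_contra hlt'
          exact hrej ⟨by linarith, by linarith⟩
        rw [hτ]
        refine (min_le_right _ _).trans (Real.sqrt_le_iff.2 ⟨by linarith [hpos j], ?_⟩)
        rw [div_le_iff₀ (by positivity)]
        nlinarith
  -- The parameters `s` increase and are bounded, so their increments eventually stay below `q`. An
  -- accepted step adds at least `q`; hence from `J` on every pass is a rejection, and halving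
  -- pushes `τ` below `q`, a contradiction.
  have hbdd : BddAbove (range fun j => (a j).s) :=
    ⟨S, by rintro _ ⟨j, rfl⟩; exact (h tol τ₁ a hτ₁ ha j (hlt j)).2.1⟩
  have hlim := tendsto_atTop_ciSup (hD.execution_s_mono hτ₁ ha) hbdd
  have hdiff := ((tendsto_add_atTop_iff_nat 1).2 hlim).sub hlim
  rw [sub_self] at hdiff
  obtain ⟨J, hJ⟩ := eventually_atTop.1 (hdiff.eventually_lt_const hq0)
  have hhalf : ∀ i, (a (J + i)).τ = (a J).τ * (1 / 2) ^ i := by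
    intro i
    induction i with
    | zero => simp
    | succ i ih =>
      obtain ⟨z, hz, ⟨-, hs, -⟩ | ⟨-, -, -, -, hτ'⟩⟩ := ha.pass (J + i) (hlt _)
      · have h1 := hJ (J + i) (Nat.le_add_right J i)
        rw [hs] at h1
        linarith [hτ (J + i)]
      · rw [← add_assoc, hτ', ih, pow_succ]
        ring
  have hzero : Tendsto (fun i => (a J).τ * (1 / 2 : ℝ) ^ i) atTop (𝓝 ((a J).τ * 0)) :=
    (tendsto_pow_atTop_nhds_zero_of_lt_one (by norm_num) (by norm_num)).const_mul _
  rw [mul_zero] at hzero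
  obtain ⟨i, hi⟩ := (hzero.eventually_lt_const hq0).exists
  exact absurd (hτ (J + i)) (by rw [hhalf]; exact hi.not_ge)

end StandingAssumptions

end RISData

theorem interpWeight_eq_zero {σ : ℕ → ℝ} {j : ℕ} (h : σ (j + 1) = σ j) (a b : ℝ) :
    interpWeight σ a b j = 0 := by
  simp [interpWeight, h]

/-! ### Interpolants of an execution: uniform bounds and the discrete local balance. -/

namespace RISData

variable {V W X : Type*} [NormedAddCommGroup V] [InnerProductSpace ℝ V]
  [NormedAddCommGroup W] [NormedSpace ℝ W] [NormedAddCommGroup X] [NormedSpace ℝ X]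
  {D : RISData V W X} {tol τ₁ : ℝ} {a : ℕ → AlgState V}

/-- The curve parameters of the nodes that are joined by the interpolants of an execution. -/
abbrev sNode (a : ℕ → AlgState V) (j : ℕ) : ℝ := (a j).s

/-- The times of the nodes. -/
abbrev tNode (a : ℕ → AlgState V) (j : ℕ) : ℝ := (a j).t

/-- The states of the nodes. -/
abbrev zNode (a : ℕ → AlgState V) (j : ℕ) : V := (a j).z

namespace StandingAssumptions

/-! ### The interpolants of an execution -/

theorem le_stopIndex (hD : D.StandingAssumptions) (htol : 0 < tol) (hτ₁ : 0 < τ₁)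
    (ha : D.IsExecution tol τ₁ a) : D.T ≤ (a (D.stopIndex a)).t :=
  Nat.sInf_mem (s := {j | D.T ≤ (a j).t}) (hD.exists_final htol hτ₁ ha)

theorem lt_of_lt_stopIndex {j : ℕ} (hj : j < D.stopIndex a) : (a j).t < D.T :=
  not_le.1 (Nat.notMem_of_lt_sInf (s := {j | D.T ≤ (a j).t}) hj)

theorem exists_stopIndex_eq (hD : D.StandingAssumptions) (htol : 0 < tol) (hτ₁ : 0 < τ₁)
    (ha : D.IsExecution tol τ₁ a) : ∃ m, D.stopIndex a = m + 1 := by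
  refine Nat.exists_eq_succ_of_ne_zero fun h => ?_
  have h1 := hD.le_stopIndex htol hτ₁ ha
  rw [h, ha.init] at h1
  exact hD.T_pos.not_ge h1

theorem eq_of_stopIndex_le (hD : D.StandingAssumptions) (htol : 0 < tol) (hτ₁ : 0 < τ₁)
    (ha : D.IsExecution tol τ₁ a) {j : ℕ} (hj : D.stopIndex a ≤ j) :
    a j = a (D.stopIndex a) := by
  induction j, hj using Nat.le_induction with
  | base => rfl
  | succ j hj ih =>
    rw [ha.final j (by rw [ih]; exact hD.le_stopIndex htol hτ₁ ha), ih]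

theorem node_eq_of_s_eq (hD : D.StandingAssumptions) (hτ₁ : 0 < τ₁) (ha : D.IsExecution tol τ₁ a)
    {j : ℕ} (hj : (a j).s = (a (j + 1)).s) :
    (a j).t = (a (j + 1)).t ∧ (a j).z = (a (j + 1)).z := by
  rcases lt_or_ge (a j).t D.T with h | h
  · obtain ⟨z, hz, ⟨-, hs, -⟩ | ⟨-, -, ht, hz', -⟩⟩ := ha.pass j h
    · have := (hD.execution_nonneg hτ₁ ha j).2
      linarith
    · exact ⟨ht.symm, hz'.symm⟩
  · rw [ha.final j h]
    exact ⟨rfl, rfl⟩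

theorem interpNodes_t (hD : D.StandingAssumptions) (htol : 0 < tol) (hτ₁ : 0 < τ₁)
    (ha : D.IsExecution tol τ₁ a) : InterpNodes (sNode a) (tNode a) (D.stopIndex a) where
  mono := hD.execution_s_mono hτ₁ ha
  eq_of_eq _ hj := (hD.node_eq_of_s_eq hτ₁ ha hj).1
  const _ hj := congrArg AlgState.s (hD.eq_of_stopIndex_le htol hτ₁ ha hj)

theorem interpNodes_z (hD : D.StandingAssumptions) (htol : 0 < tol) (hτ₁ : 0 < τ₁)
    (ha : D.IsExecution tol τ₁ a) : InterpNodes (sNode a) (zNode a) (D.stopIndex a) where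
  mono := hD.execution_s_mono hτ₁ ha
  eq_of_eq _ hj := (hD.node_eq_of_s_eq hτ₁ ha hj).2
  const _ hj := congrArg AlgState.s (hD.eq_of_stopIndex_le htol hτ₁ ha hj)

/-- A pass is rejected, or its velocities are the rates of an accepted step. -/
theorem pass_cases (ha : D.IsExecution tol τ₁ a) {j : ℕ} (hj : (a j).t < D.T) :
    (sNode a (j + 1) = sNode a j ∧ tNode a (j + 1) = tNode a j ∧ zNode a (j + 1) = zNode a j) ∨
      ∃ z, D.IsIterate (a j).t (a j).z (a j).τ z ∧ sNode a (j + 1) = sNode a j + (a j).τ ∧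
        zNode a (j + 1) = z ∧
        interpVelocity (sNode a) (tNode a) j =
          (D.newTime (a j).t (a j).z (a j).τ z - (a j).t) / (a j).τ ∧
        interpVelocity (sNode a) (zNode a) j = (a j).τ⁻¹ • (z - (a j).z) ∧
        D.resid₁ (a j).s (a j).t (a j).z (a j).τ z < tol ∧
        D.resid₂ (a j).s (a j).t (a j).z (a j).τ z < tol := by
  obtain ⟨z, hz, ⟨⟨h1, h2⟩, hs, ht, hz', -⟩ | ⟨-, hs, ht, hz', -⟩⟩ := ha.pass j hj
  · refine .inr ⟨z, hz, hs, hz', ?_, ?_, h1, h2⟩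
    · simp only [interpVelocity, sNode, tNode, hs, ht, add_sub_cancel_left, smul_eq_mul,
        div_eq_inv_mul]
    · simp only [interpVelocity, sNode, zNode, hs, hz', add_sub_cancel_left]
  · exact .inl ⟨hs, ht, hz'⟩

theorem velocity_bounds (hD : D.StandingAssumptions) (hτ₁ : 0 < τ₁) (ha : D.IsExecution tol τ₁ a)
    {j : ℕ} (hj : (a j).t < D.T) :
    0 ≤ interpVelocity (sNode a) (tNode a) j ∧
      interpVelocity (sNode a) (tNode a) j + D.normV (interpVelocity (sNode a) (zNode a) j) ≤ 1 := by
  rcases pass_cases ha hj with ⟨-, ht, hz⟩ | ⟨z, hz, -, -, ht', hz', -⟩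
  · simp [interpVelocity, ht, hz, normV_zero]
  · rw [ht', hz']
    obtain ⟨h1, h2, -⟩ := hD.isIterate_rates (hD.execution_nonneg hτ₁ ha j).2 hz
    exact ⟨h1, h2.le⟩

theorem sNode_zero (ha : D.IsExecution tol τ₁ a) : sNode a 0 = 0 := by simp [sNode, ha.init]

theorem tHat_nonneg (hD : D.StandingAssumptions) (htol : 0 < tol) (hτ₁ : 0 < τ₁)
    (ha : D.IsExecution tol τ₁ a) {s : ℝ} (hs : 0 ≤ s) : 0 ≤ D.tHat a s :=
  (hD.interpNodes_t htol hτ₁ ha).affineInterp_mem (convex_Ici 0)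
    (fun j _ => (hD.execution_nonneg hτ₁ ha j).1) (by rwa [sNode_zero ha])

theorem tHat_zero (hD : D.StandingAssumptions) (htol : 0 < tol) (hτ₁ : 0 < τ₁)
    (ha : D.IsExecution tol τ₁ a) : D.tHat a 0 = 0 := by
  have h := (hD.interpNodes_t htol hτ₁ ha).affineInterp_zero
  rw [sNode_zero ha, tNode, ha.init] at h
  exact h

theorem zHat_zero (hD : D.StandingAssumptions) (htol : 0 < tol) (hτ₁ : 0 < τ₁)
    (ha : D.IsExecution tol τ₁ a) : D.zHat a 0 = D.z₀ := by
  have h := (hD.interpNodes_z htol hτ₁ ha).affineInterp_zero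
  rw [sNode_zero ha, zNode, ha.init] at h
  exact h

theorem tHat_increment (hD : D.StandingAssumptions) (htol : 0 < tol) (hτ₁ : 0 < τ₁)
    (ha : D.IsExecution tol τ₁ a) {r s : ℝ} (hr : 0 ≤ r) (hrs : r ≤ s) :
    D.tHat a s - D.tHat a r = ∑ j ∈ Finset.range (D.stopIndex a),
      interpWeight (sNode a) r s j * interpVelocity (sNode a) (tNode a) j :=
  (hD.interpNodes_t htol hτ₁ ha).affineInterp_sub (by rwa [sNode_zero ha]) hrs

theorem sublinear_zHat_sub_le (hD : D.StandingAssumptions) (htol : 0 < tol) (hτ₁ : 0 < τ₁)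
    (ha : D.IsExecution tol τ₁ a) {p : V → ℝ} (h0 : p 0 = 0)
    (hadd : ∀ v w, p (v + w) ≤ p v + p w) (hsmul : ∀ c : ℝ, 0 ≤ c → ∀ v, p (c • v) = c * p v)
    {r s : ℝ} (hr : 0 ≤ r) (hrs : r ≤ s) :
    p (D.zHat a s - D.zHat a r) ≤ ∑ j ∈ Finset.range (D.stopIndex a),
      interpWeight (sNode a) r s j * p (interpVelocity (sNode a) (zNode a) j) :=
  (hD.interpNodes_z htol hτ₁ ha).sublinear_affineInterp_sub_le h0 hadd hsmul
    (by rwa [sNode_zero ha]) hrs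

theorem tHat_mono (hD : D.StandingAssumptions) (htol : 0 < tol) (hτ₁ : 0 < τ₁)
    (ha : D.IsExecution tol τ₁ a) {r s : ℝ} (hr : 0 ≤ r) (hrs : r ≤ s) :
    D.tHat a r ≤ D.tHat a s := by
  rw [← sub_nonneg, hD.tHat_increment htol hτ₁ ha hr hrs]
  exact Finset.sum_nonneg fun j hj =>
    mul_nonneg (interpWeight_nonneg (hD.execution_s_mono hτ₁ ha) hrs j)
      (hD.velocity_bounds hτ₁ ha (lt_of_lt_stopIndex (Finset.mem_range.1 hj))).1

/-- The constraint on the rates in integrated form, which survives pointwise limits. -/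
theorem increment_add_le (hD : D.StandingAssumptions) (htol : 0 < tol) (hτ₁ : 0 < τ₁)
    (ha : D.IsExecution tol τ₁ a) {r s : ℝ} (hr : 0 ≤ r) (hrs : r ≤ s) :
    D.tHat a s - D.tHat a r + D.normV (D.zHat a s - D.zHat a r) ≤ s - r := by
  have h1 := hD.sublinear_zHat_sub_le htol hτ₁ ha normV_zero hD.normV_add_le
    (fun c hc v => by rw [normV_smul, abs_of_nonneg hc]) hr hrs
  rw [hD.tHat_increment htol hτ₁ ha hr hrs]
  refine (add_le_add_right h1 _).trans ?_
  rw [← Finset.sum_add_distrib]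
  refine (Finset.sum_le_sum fun j hj => ?_).trans
    (sum_interpWeight_le (σ := sNode a) (by rw [sNode_zero ha]; exact hr) hrs (D.stopIndex a))
  rw [← mul_add]
  exact mul_le_of_le_one_right (interpWeight_nonneg (hD.execution_s_mono hτ₁ ha) hrs j)
    (hD.velocity_bounds hτ₁ ha (lt_of_lt_stopIndex (Finset.mem_range.1 hj))).2

theorem lipschitzOnWith_tHat (hD : D.StandingAssumptions) (htol : 0 < tol) (hτ₁ : 0 < τ₁)
    (ha : D.IsExecution tol τ₁ a) : LipschitzOnWith 1 (D.tHat a) (Ici 0) := by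
  have h := (hD.interpNodes_t htol hτ₁ ha).lipschitzOnWith (K := 1) fun j hj => by
    obtain ⟨h1, h2⟩ := hD.velocity_bounds hτ₁ ha (lt_of_lt_stopIndex hj)
    rw [Real.norm_of_nonneg h1, NNReal.coe_one]
    linarith [normV_nonneg (D := D) (interpVelocity (sNode a) (zNode a) j)]
  rwa [sNode_zero ha] at h

theorem exists_lipschitzOnWith_zHat (hD : D.StandingAssumptions) :
    ∃ K : NNReal, ∀ (tol τ₁ : ℝ) (a : ℕ → AlgState V), 0 < tol → 0 < τ₁ →
      D.IsExecution tol τ₁ a → LipschitzOnWith K (D.zHat a) (Ici 0) ∧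
        ∀ j < D.stopIndex a, ‖interpVelocity (sNode a) (zNode a) j‖ ≤ K := by
  obtain ⟨C, hC, hCn⟩ := hD.exists_norm_le_normV
  refine ⟨C.toNNReal, fun tol τ₁ a htol hτ₁ ha => ?_⟩
  have hvel : ∀ j < D.stopIndex a,
      ‖interpVelocity (sNode a) (zNode a) j‖ ≤ C.toNNReal := fun j hj => by
    obtain ⟨h1, h2⟩ := hD.velocity_bounds hτ₁ ha (lt_of_lt_stopIndex hj)
    rw [Real.coe_toNNReal _ hC.le]
    exact (hCn _).trans (mul_le_of_le_one_right hC.le (by linarith))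
  have h := (hD.interpNodes_z htol hτ₁ ha).lipschitzOnWith hvel
  rw [sNode_zero ha] at h
  exact ⟨h, hvel⟩

/-- The end parameter is attained and bounded, uniformly over all executions; so are the
interpolated states. -/
theorem exists_endParam_bound (hD : D.StandingAssumptions) :
    ∃ M S : ℝ, 0 ≤ M ∧ ∀ (tol τ₁ : ℝ) (a : ℕ → AlgState V), 0 < tol → 0 < τ₁ →
      D.IsExecution tol τ₁ a →
        IsLeast {s | 0 ≤ s ∧ D.tHat a s = D.T} (D.endParam a) ∧ D.T ≤ D.endParam a ∧
          D.endParam a ≤ S ∧ ∀ s, 0 ≤ s → ‖D.zHat a s‖ ≤ M := by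
  obtain ⟨M, S, C, hM, hS, -, h⟩ := hD.exists_pass_bound
  obtain ⟨N, hN, hn⟩ := hD.exists_normV_le
  refine ⟨M, S + (D.T + N * (M + M)), hM, fun tol τ₁ a htol hτ₁ ha => ?_⟩
  obtain ⟨m, hm⟩ := hD.exists_stopIndex_eq htol hτ₁ ha
  have hmlt : (a m).t < D.T := lt_of_lt_stopIndex (by omega)
  have hfin : D.T ≤ (a (m + 1)).t := hm ▸ hD.le_stopIndex htol hτ₁ ha
  obtain ⟨hzm, hsm, hiter⟩ := h tol τ₁ a hτ₁ ha m hmlt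
  obtain ⟨ht0, hτ0⟩ := hD.execution_nonneg hτ₁ ha m
  -- The last pass moves the time past `T`, so it cannot be a rejection.
  obtain ⟨z, hz, hs, hzz, ht', hz', -⟩ : ∃ z, _ :=
    (pass_cases ha hmlt).resolve_left fun h1 => by
      have : (a (m + 1)).t = (a m).t := h1.2.1
      linarith
  have hzM := (hiter z hz).1
  obtain ⟨hr1, hr2, -⟩ := hD.isIterate_rates hτ0 hz
  have hnode := hD.interpNodes_t htol hτ₁ ha
  rw [← ht', ← hz'] at hr2
  rw [← ht'] at hr1
  have hsmul := hnode.smul_velocity m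
  rw [hs, add_sub_cancel_left, smul_eq_mul] at hsmul
  set v := interpVelocity (sNode a) (tNode a) m with hv
  have hsmul' : (a m).τ * v = (a (m + 1)).t - (a m).t := hsmul
  have hv0 : 0 < v := hr1.lt_of_ne fun h0 => by
    rw [← h0, mul_zero] at hsmul'
    linarith
  -- The parameter length after which the last step crosses time `T`.
  set q := (D.T - (a m).t) / v with hq
  have hqv : q * v = D.T - (a m).t := div_mul_cancel₀ _ hv0.ne'
  have hq0 : 0 ≤ q := div_nonneg (by linarith) hv0.le
  have hqτ : q ≤ (a m).τ := by
    rw [hq, div_le_iff₀ hv0]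
    linarith
  have hs0 : 0 ≤ (a m).s := by
    have := hD.execution_s_mono hτ₁ ha (Nat.zero_le m)
    simpa [ha.init] using this
  have hmem : sNode a m + q ∈ Icc (sNode a m) (sNode a (m + 1)) := by
    rw [hs]
    exact ⟨by linarith, by linarith⟩
  have hattain : D.tHat a (sNode a m + q) = D.T := by
    have h1 := hnode.affineInterp_of_mem (by omega) hmem
    rw [add_sub_cancel_left, smul_eq_mul, ← hv, hqv] at h1
    refine h1.trans ?_
    simp
  have hne : {s | 0 ≤ s ∧ D.tHat a s = D.T}.Nonempty :=
    ⟨sNode a m + q, add_nonneg hs0 hq0, hattain⟩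
  have hbelow : BddBelow {s | 0 ≤ s ∧ D.tHat a s = D.T} := ⟨0, fun s hs => hs.1⟩
  have hlip := hD.lipschitzOnWith_tHat htol hτ₁ ha
  have hclosed : IsClosed {s | 0 ≤ s ∧ D.tHat a s = D.T} :=
    hlip.continuousOn.preimage_isClosed_of_isClosed isClosed_Ici isClosed_singleton
  have hleast : IsLeast {s | 0 ≤ s ∧ D.tHat a s = D.T} (D.endParam a) :=
    ⟨hclosed.csInf_mem hne hbelow, fun s hs => csInf_le hbelow hs⟩
  refine ⟨hleast, ?_, ?_, fun s hs => ?_⟩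
  · have h1 := hD.increment_add_le htol hτ₁ ha le_rfl hleast.1.1
    rw [hleast.1.2, hD.tHat_zero htol hτ₁ ha] at h1
    linarith [normV_nonneg (D := D) (D.zHat a (D.endParam a) - D.zHat a 0)]
  · refine (hleast.2 ⟨add_nonneg hs0 hq0, hattain⟩).trans (add_le_add hsm ?_)
    -- The last step size has no a priori bound, but the part used up to `T` splits into the
    -- remaining time and a `𝕍`-length of at most `‖z - z_m‖_𝕍`.
    have h1 : q = q * v + q * D.normV (interpVelocity (sNode a) (zNode a) m) := by
      rw [← mul_add, hr2, mul_one]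
    have h2 : q * D.normV (interpVelocity (sNode a) (zNode a) m) ≤ D.normV (z - (a m).z) := by
      rw [hz', normV_smul, abs_of_pos (inv_pos.2 hτ0), ← mul_assoc, ← div_eq_mul_inv]
      exact mul_le_of_le_one_left (normV_nonneg _) ((div_le_one hτ0).2 hqτ)
    have h3 : D.normV (z - (a m).z) ≤ N * (M + M) :=
      (hn _).trans (mul_le_mul_of_nonneg_left (norm_sub_le_of_le hzM hzm) hN.le)
    linarith
  · have hball := (hD.interpNodes_z htol hτ₁ ha).affineInterp_mem (convex_closedBall (0 : V) M)
      (fun j hj => ?_) (by rwa [sNode_zero ha] : sNode a 0 ≤ s)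
    · exact mem_closedBall_zero_iff.1 hball
    · rw [mem_closedBall_zero_iff]
      rcases hj.lt_or_eq with hj | hj
      · exact (h tol τ₁ a hτ₁ ha j (lt_of_lt_stopIndex hj)).1
      · rw [hj, hm, hzz]
        exact hzM

/-- The residuals of an accepted pass, summed over all passes, are controlled by the tolerance. -/
theorem exists_resid_sum_bound (hD : D.StandingAssumptions) :
    ∃ C S : ℝ, ∀ (tol τ₁ : ℝ) (a : ℕ → AlgState V), 0 < tol → 0 < τ₁ →
      D.IsExecution tol τ₁ a → ∃ ρ : ℕ → ℝ, (∀ j, 0 ≤ ρ j) ∧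
        ∑ j ∈ Finset.range (D.stopIndex a), ρ j ≤ Real.sqrt (tol * C) * S + tol ∧
        ∀ j < D.stopIndex a, ∀ z, D.IsIterate (a j).t (a j).z (a j).τ z →
          sNode a (j + 1) = sNode a j + (a j).τ →
          D.resid₁ (a j).s (a j).t (a j).z (a j).τ z < tol →
          D.resid₂ (a j).s (a j).t (a j).z (a j).τ z < tol →
          D.resid₁ (a j).s (a j).t (a j).z (a j).τ z ≤ ρ j ∧
          D.resid₂ (a j).s (a j).t (a j).z (a j).τ z ≤ ρ j := by
  obtain ⟨M, S, C, hM, hS, hC, h⟩ := hD.exists_pass_bound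
  refine ⟨C, S, fun tol τ₁ a htol hτ₁ ha => ?_⟩
  -- The geometric mean of the bounds `tol` and `C τ²` is linear in `τ` and hence summable against
  -- the total arc length.
  have hsq : ∀ x τ : ℝ, 0 < τ → x < tol → x ≤ C * τ ^ 2 → x ≤ Real.sqrt (tol * C) * τ := by
    intro x τ hτ h1 h2
    rcases le_or_gt x 0 with hx | hx
    · exact hx.trans (by positivity)
    · refine le_of_sq_le_sq ?_ (by positivity)
      rw [mul_pow, Real.sq_sqrt (by positivity), mul_assoc, sq x]
      exact mul_le_mul h1.le h2 hx.le htol.le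
  have hmono := hD.execution_s_mono hτ₁ ha
  -- The last step is charged `tol`, because `S` bounds the curve parameters only before the final
  -- time and this step may overshoot.
  refine ⟨fun j => if j + 1 = D.stopIndex a then tol else
    Real.sqrt (tol * C) * (sNode a (j + 1) - sNode a j), fun j => ?_, ?_, ?_⟩
  · dsimp only
    split_ifs
    · exact htol.le
    · exact mul_nonneg (Real.sqrt_nonneg _) (sub_nonneg.2 (hmono j.le_succ))
  · obtain ⟨m, hm⟩ := hD.exists_stopIndex_eq htol hτ₁ ha
    have hsm := (h tol τ₁ a hτ₁ ha m (lt_of_lt_stopIndex (by omega))).2.1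
    rw [hm, Finset.sum_range_succ, if_pos rfl]
    refine add_le_add_left ?_ _
    have h1 : ∀ j ∈ Finset.range m, (if j + 1 = m + 1 then tol else
        Real.sqrt (tol * C) * (sNode a (j + 1) - sNode a j)) =
        Real.sqrt (tol * C) * (sNode a (j + 1) - sNode a j) := fun j hj =>
      if_neg (by have := Finset.mem_range.1 hj; omega)
    rw [Finset.sum_congr rfl h1, ← Finset.mul_sum, Finset.sum_range_sub, sNode_zero ha, sub_zero]
    exact mul_le_mul_of_nonneg_left hsm (Real.sqrt_nonneg _)
  · intro j hj z hz hs h1 h2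
    obtain ⟨-, h3, h4⟩ := (h tol τ₁ a hτ₁ ha j (lt_of_lt_stopIndex hj)).2.2 z hz
    have hτ0 := (hD.execution_nonneg hτ₁ ha j).2
    dsimp only
    rw [hs, add_sub_cancel_left]
    split_ifs
    · exact ⟨h1.le, h2.le⟩
    · exact ⟨hsq _ _ hτ0 h1 h3, hsq _ _ hτ0 h2 h4⟩

/-- Local form of the energy-dissipation balance and of the stability condition, up to an error
that is controlled by the tolerance and by the oscillation of the forces. -/
theorem exists_local_balance (hD : D.StandingAssumptions) :
    ∃ C S K : ℝ, 0 ≤ K ∧ ∀ (tol τ₁ : ℝ) (a : ℕ → AlgState V), 0 < tol → 0 < τ₁ →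
      D.IsExecution tol τ₁ a → ∀ r s : ℝ, 0 ≤ r → r ≤ s → ∀ (ξ : V →L[ℝ] ℝ) (d ε : ℝ), 0 ≤ d →
        0 ≤ ε → (∀ q ∈ Icc r s, ‖D.dzEnergy (D.tHat a q) (D.zHat a q) - ξ‖ ≤ ε ∧
          d ≤ D.stabDist (D.tHat a q) (D.zHat a q) + ε) →
        D.Rv (D.zHat a s - D.zHat a r) + D.normV (D.zHat a s - D.zHat a r) * d +
            ξ (D.zHat a s - D.zHat a r) ≤
          Real.sqrt (tol * C) * S + tol + (K + 1) * ε * (s - r) ∧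
        (D.tHat a s - D.tHat a r) * d ≤ Real.sqrt (tol * C) * S + tol + ε * (s - r) := by
  obtain ⟨C, S, hρ⟩ := hD.exists_resid_sum_bound
  obtain ⟨K, hK⟩ := hD.exists_lipschitzOnWith_zHat
  refine ⟨C, S, K, K.2, fun tol τ₁ a htol hτ₁ ha r s hr hrs ξ d ε hd hε hosc => ?_⟩
  obtain ⟨ρ, hρ0, hρsum, hres⟩ := hρ tol τ₁ a htol hτ₁ ha
  obtain ⟨-, hvel⟩ := hK tol τ₁ a htol hτ₁ ha
  have hmono := hD.execution_s_mono hτ₁ ha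
  have hsum := sum_interpWeight_le (σ := sNode a) (by rw [sNode_zero ha]; exact hr) hrs
    (D.stopIndex a)
  have hnt := hD.interpNodes_t htol hτ₁ ha
  have hnz := hD.interpNodes_z htol hτ₁ ha
  have hw0 := interpWeight_nonneg (σ := sNode a) hmono hrs
  -- Freezing the force costs `ε K` and freezing the distance costs `ε`, as the velocity has norm at
  -- most `K` and `𝕍`-norm at most `1`; the residual of the pass controls the remainder.
  have hterm : ∀ j < D.stopIndex a,
      interpWeight (sNode a) r s j * (D.Rv (interpVelocity (sNode a) (zNode a) j) +
        D.normV (interpVelocity (sNode a) (zNode a) j) * d +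
        ξ (interpVelocity (sNode a) (zNode a) j) - (K + 1) * ε) ≤ ρ j ∧
      interpWeight (sNode a) r s j * (interpVelocity (sNode a) (tNode a) j * d - ε) ≤ ρ j := by
    intro j hj
    have hjT := lt_of_lt_stopIndex hj
    rcases (hw0 j).eq_or_lt with hw | hw
    · rw [← hw, zero_mul, zero_mul]
      exact ⟨hρ0 j, hρ0 j⟩
    obtain ⟨z, hz, hs, -, ht', hz', h1, h2⟩ := (pass_cases ha hjT).resolve_left fun h1 =>
      hw.ne' (interpWeight_eq_zero h1.1 r s)
    obtain ⟨ht0, hτ0⟩ := hD.execution_nonneg hτ₁ ha j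
    obtain ⟨hρ1, hρ2⟩ := hres j hj z hz hs h1 h2
    obtain ⟨hcc, hweq⟩ := interpWeight_eq_of_pos hmono hrs hw
    obtain ⟨hv0, hv1⟩ := hD.velocity_bounds hτ₁ ha hjT
    have hvK := hvel j hj
    have hN0 := normV_nonneg (D := D) (interpVelocity (sNode a) (zNode a) j)
    have hpt : ∀ q ∈ Icc (max r (sNode a j)) (min s (sNode a (j + 1))), q ∈ Icc r s ∧
        D.tHat a q = (a j).t + (q - (a j).s) * interpVelocity (sNode a) (tNode a) j ∧
        D.zHat a q = (a j).z + (q - (a j).s) • interpVelocity (sNode a) (zNode a) j := by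
      intro q hq
      have hq1 := max_le_iff.1 hq.1
      have hq2 := le_min_iff.1 hq.2
      exact ⟨⟨hq1.1, hq2.1⟩, hnt.affineInterp_of_mem hj ⟨hq1.2, hq2.2⟩,
        hnz.affineInterp_of_mem hj ⟨hq1.2, hq2.2⟩⟩
    have hc' : min s (sNode a (j + 1)) ≤ (a j).s + (a j).τ := (min_le_right _ _).trans hs.le
    generalize interpVelocity (sNode a) (tNode a) j = t' at *
    generalize interpVelocity (sNode a) (zNode a) j = z' at *
    rw [hweq]
    constructor
    · refine (hD.mul_le_resid₂ ht0 hτ0 hz ht' hz' (le_max_right _ _) hcc hc'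
        fun q hq => ?_).trans hρ2
      obtain ⟨hq1, hq2, hq3⟩ := hpt q hq
      obtain ⟨hξ, hdq⟩ := hosc q hq1
      rw [← hq2, ← hq3]
      have h3 : (ξ - D.dzEnergy (D.tHat a q) (D.zHat a q)) z' ≤ ε * K := by
        refine (Real.le_norm_self _).trans ((ContinuousLinearMap.le_opNorm _ z').trans ?_)
        rw [norm_sub_rev]
        gcongr
      rw [sub_apply] at h3
      have h4 : D.normV z' * d ≤
          D.normV z' * D.stabDist (D.tHat a q) (D.zHat a q) + ε := by
        nlinarith
      linarith
    · refine (hD.mul_le_resid₁ ht0 hτ0 hz ht' hz' (le_max_right _ _) hcc hc'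
        fun q hq => ?_).trans hρ1
      obtain ⟨hq1, hq2, hq3⟩ := hpt q hq
      obtain ⟨-, hdq⟩ := hosc q hq1
      rw [← hq2, ← hq3]
      nlinarith
  have hsumle : ∀ (g : ℕ → ℝ) (c : ℝ), 0 ≤ c → (∀ j < D.stopIndex a,
      interpWeight (sNode a) r s j * (g j - c) ≤ ρ j) →
      ∑ j ∈ Finset.range (D.stopIndex a), interpWeight (sNode a) r s j * g j ≤
        Real.sqrt (tol * C) * S + tol + c * (s - r) := by
    intro g c hc hg
    calc _ ≤ ∑ j ∈ Finset.range (D.stopIndex a), (ρ j + c * interpWeight (sNode a) r s j) :=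
          Finset.sum_le_sum fun j hj => by linarith [hg j (Finset.mem_range.1 hj)]
      _ ≤ _ := by
          rw [Finset.sum_add_distrib, ← Finset.mul_sum]
          exact add_le_add hρsum (mul_le_mul_of_nonneg_left hsum hc)
  constructor
  -- With `ξ` and `d` frozen, the whole left-hand side is one sublinear functional of the increment.
  · refine (hD.sublinear_zHat_sub_le htol hτ₁ ha (p := fun v => D.Rv v + D.normV v * d + ξ v)
      (by simp [hD.Rv_zero, normV_zero]) (fun v w => ?_) (fun c hc v => ?_) hr hrs).trans
      (hsumle _ _ (mul_nonneg (add_nonneg K.2 zero_le_one) hε) fun j hj => (hterm j hj).1)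
    · have h1 := hD.Rv_add_le v w
      have h2 := mul_le_mul_of_nonneg_right (hD.normV_add_le v w) hd
      rw [map_add]
      linarith
    · rw [hD.Rv_smul hc, normV_smul, abs_of_nonneg hc, map_smul, smul_eq_mul]
      ring
  · rw [hD.tHat_increment htol hτ₁ ha hr hrs, Finset.sum_mul]
    simp only [mul_assoc]
    exact hsumle _ _ hε fun j hj => (hterm j hj).2

end StandingAssumptions

end RISData

/-- A positively homogeneous bound on increments passes to the derivative. -/
theorem HasDerivAt.homogeneous_le {E : Type*} [NormedAddCommGroup E] [NormedSpace ℝ E]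
    {u : ℝ → E} {u' : E} {s S c B : ℝ} {p : E → ℝ} (hu : HasDerivAt u u' s) (hp : Continuous p)
    (hsmul : ∀ c : ℝ, 0 ≤ c → ∀ v, p (c • v) = c * p v) (hs : s < S)
    (h : ∀ r, s ≤ r → r ≤ S → p (u r - u s) ≤ (c + B * (r - s)) * (r - s)) : p u' ≤ c := by
  have h1 : Tendsto (fun t => p (t⁻¹ • (u (s + t) - u s))) (𝓝[>] 0) (𝓝 (p u')) :=
    (hp.tendsto _).comp ((hasDerivAt_iff_tendsto_slope_zero.1 hu).mono_left
      (nhdsWithin_mono _ fun x hx => (ne_of_gt hx)))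
  have h2 : Tendsto (fun t : ℝ => c + B * t) (𝓝[>] 0) (𝓝 c) := by
    have : Continuous fun t : ℝ => c + B * t := by fun_prop
    simpa using (this.tendsto 0).mono_left nhdsWithin_le_nhds
  refine le_of_tendsto_of_tendsto h1 h2 ?_
  filter_upwards [Ioo_mem_nhdsGT (sub_pos.2 hs)] with t ht
  have h3 := h (s + t) (by linarith [ht.1]) (by linarith [ht.2])
  rw [add_sub_cancel_left] at h3
  rw [hsmul _ (inv_pos.2 ht.1).le, inv_mul_le_iff₀ ht.1, mul_comm t]
  exact h3

/-! ### Passage to the limit. -/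

namespace RISData

variable {V W X : Type*} [NormedAddCommGroup V] [InnerProductSpace ℝ V]
  [NormedAddCommGroup W] [NormedSpace ℝ W] [NormedAddCommGroup X] [NormedSpace ℝ X]
  {D : RISData V W X}

namespace StandingAssumptions

/-! ### Limits of interpolants -/

/-- The local balance passes to the limit. -/
theorem exists_limit_local_balance (hD : D.StandingAssumptions) :
    ∃ B : ℝ, ∀ (tol τ₁ : ℕ → ℝ) (a : ℕ → ℕ → AlgState V) (that : ℝ → ℝ) (zhat : ℝ → V) (S : ℝ),
      (∀ n, 0 < tol n) → Tendsto tol atTop (𝓝 0) → (∀ n, 0 < τ₁ n) →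
      (∀ n, D.IsExecution (tol n) (τ₁ n) (a n)) →
      (∀ s ∈ Icc 0 S, Tendsto (fun n => D.tHat (a n) s) atTop (𝓝 (that s))) →
      (∀ s ∈ Icc 0 S, Tendsto (fun n => D.zHat (a n) s) atTop (𝓝 (zhat s))) →
      ∀ r s, 0 ≤ r → r ≤ s → s ≤ S →
        D.Rv (zhat s - zhat r) +
            D.normV (zhat s - zhat r) * D.stabDist (that r) (zhat r) +
            D.dzEnergy (that r) (zhat r) (zhat s - zhat r) ≤ (0 + B * (s - r)) * (s - r) ∧
          (that s - that r) * D.stabDist (that r) (zhat r) ≤ (0 + B * (s - r)) * (s - r) := by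
  obtain ⟨M, _, hM, hbound⟩ := hD.exists_endParam_bound
  obtain ⟨K, hK⟩ := hD.exists_lipschitzOnWith_zHat
  obtain ⟨L₁, hL₁, hl₁⟩ := hD.exists_dzEnergy_lipschitz hM
  obtain ⟨L₂, hL₂, hl₂⟩ := hD.exists_stabDist_lipschitz hM
  obtain ⟨C, S', N, hN, hloc⟩ := hD.exists_local_balance
  set L := L₁ + L₂ with hL
  have hL0 : 0 < L := add_pos hL₁ hL₂
  refine ⟨(N + 1) * (L * (1 + K)), ?_⟩
  intro tol τ₁ a that zhat S htol htol0 hτ₁ ha ht hz r s hr hrs hsS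
  have hrmem : r ∈ Icc 0 S := ⟨hr, hrs.trans hsS⟩
  have hsmem : s ∈ Icc 0 S := ⟨hr.trans hrs, hsS⟩
  have htr : 0 ≤ that r :=
    ge_of_tendsto' (ht r hrmem) fun n => hD.tHat_nonneg (htol n) (hτ₁ n) (ha n) hr
  have hzr : ‖zhat r‖ ≤ M :=
    le_of_tendsto' (hz r hrmem).norm fun n =>
      (hbound _ _ _ (htol n) (hτ₁ n) (ha n)).2.2.2 r hr
  set η : ℕ → ℝ := fun n => |D.tHat (a n) r - that r| + ‖D.zHat (a n) r - zhat r‖ with hη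
  have hη0 : Tendsto η atTop (𝓝 0) := by
    have h1 := ((ht r hrmem).sub_const (that r)).norm
    have h2 := ((hz r hrmem).sub_const (zhat r)).norm
    simpa using h1.add h2
  -- The distance from the interpolants on `[r,s]` to the limit point at `r` is at most the error `η
  -- n` at `r` plus the oscillation `(1 + K) (s - r)`. Only the latter survives and produces the
  -- quadratic error.
  set ε : ℕ → ℝ := fun n => L * (η n + (1 + K) * (s - r)) with hε
  have hεlim : Tendsto ε atTop (𝓝 (L * ((1 + K) * (s - r)))) := by
    simpa using (hη0.add_const ((1 + (K : ℝ)) * (s - r))).const_mul L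
  have hδlim : Tendsto (fun n => Real.sqrt (tol n * C) * S' + tol n) atTop (𝓝 0) := by
    have h1 : Continuous fun x : ℝ => Real.sqrt (x * C) * S' + x := by fun_prop
    simpa [Function.comp_def] using (h1.tendsto 0).comp htol0
  have hmain : ∀ n, _ := fun n => hloc (tol n) (τ₁ n) (a n) (htol n) (hτ₁ n) (ha n) r s hr hrs
    (D.dzEnergy (that r) (zhat r)) (D.stabDist (that r) (zhat r)) (ε n)
    (hD.stabDist_nonneg _ _)
    (mul_nonneg hL0.le (add_nonneg (by positivity)
      (mul_nonneg (by positivity) (sub_nonneg.2 hrs)))) (by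
      intro q hq
      have hq0 : 0 ≤ q := hr.trans hq.1
      have htq := hD.tHat_nonneg (htol n) (hτ₁ n) (ha n) hq0
      have hzq := (hbound _ _ _ (htol n) (hτ₁ n) (ha n)).2.2.2 q hq0
      have h1 := (hD.lipschitzOnWith_tHat (htol n) (hτ₁ n) (ha n)).dist_le_mul q hq0 r hr
      have h2 := (hK _ _ _ (htol n) (hτ₁ n) (ha n)).1.dist_le_mul q hq0 r hr
      rw [Real.dist_eq, Real.dist_eq, abs_of_nonneg (sub_nonneg.2 hq.1), NNReal.coe_one,
        one_mul] at h1
      rw [dist_eq_norm, Real.dist_eq, abs_of_nonneg (sub_nonneg.2 hq.1)] at h2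
      have h3 := abs_sub_le (D.tHat (a n) q) (D.tHat (a n) r) (that r)
      have h4 := norm_sub_le_norm_sub_add_norm_sub (D.zHat (a n) q) (D.zHat (a n) r) (zhat r)
      have h5 : (K : ℝ) * (q - r) ≤ K * (s - r) := by
        gcongr
        exact hq.2
      have h6 : |D.tHat (a n) q - that r| + ‖D.zHat (a n) q - zhat r‖ ≤
          η n + (1 + K) * (s - r) := by
        simp only [hη]
        linarith [hq.2]
      have h7 : 0 ≤ |D.tHat (a n) q - that r| + ‖D.zHat (a n) q - zhat r‖ := by positivity
      constructor
      · refine (hl₁ _ _ htq htr _ _ hzq hzr).trans ?_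
        exact mul_le_mul (by linarith) h6 h7 hL0.le
      · refine (hl₂ _ _ htr htq _ _ hzr hzq).trans (add_le_add_right ?_ _)
        rw [abs_sub_comm, norm_sub_rev]
        exact mul_le_mul (by linarith) h6 h7 hL0.le)
  have hΔz := (hz s hsmem).sub (hz r hrmem)
  constructor
  · have hcont : Continuous fun v => D.Rv v + D.normV v * D.stabDist (that r) (zhat r) +
        D.dzEnergy (that r) (zhat r) v := by
      have h1 := hD.continuous_Rv
      have h2 : Continuous D.normV := continuous_normV
      fun_prop
    have h1 := le_of_tendsto_of_tendsto' ((hcont.tendsto _).comp hΔz)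
      (hδlim.add ((hεlim.const_mul (N + 1)).mul_const (s - r))) fun n => (hmain n).1
    refine h1.trans_eq ?_
    ring
  · have h1 := le_of_tendsto_of_tendsto'
      (((ht s hsmem).sub (ht r hrmem)).mul_const (D.stabDist (that r) (zhat r)))
      (hδlim.add (hεlim.mul_const (s - r))) fun n => (hmain n).2
    refine h1.trans ?_
    have h2 : 0 ≤ N * (L * (1 + K)) * (s - r) * (s - r) := by
      have := sub_nonneg.2 hrs
      positivity
    nlinarith

/-- A Lipschitz curve along which the dissipation rate balances the force satisfies the
energy-dissipation identity. -/
theorem energy_balance (hD : D.StandingAssumptions) {S : ℝ} {that : ℝ → ℝ} {zhat : ℝ → V}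
    {K : NNReal} (ht : LipschitzOnWith 1 that (Icc 0 S)) (hz : LipschitzOnWith K zhat (Icc 0 S))
    (htT : ∀ s ∈ Icc 0 S, that s ∈ Icc 0 D.T)
    (hbal : ∀ᵐ s ∂(volume.restrict (Ioo 0 S)), D.Rv (deriv zhat s) +
      D.normV (deriv zhat s) * D.stabDist (that s) (zhat s) =
        -D.dzEnergy (that s) (zhat s) (deriv zhat s)) {s : ℝ} (hs : s ∈ Icc 0 S) :
    D.energy (that s) (zhat s) + ∫ σ in (0 : ℝ)..s, (D.Rv (deriv zhat σ) +
        D.normV (deriv zhat σ) * D.stabDist (that σ) (zhat σ)) =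
      D.energy (that 0) (zhat 0) +
        ∫ σ in (0 : ℝ)..s, D.dtEnergy (that σ) (zhat σ) * deriv that σ := by
  have := hD.finiteDimensional
  obtain ⟨M, hM⟩ := isCompact_Icc.exists_bound_of_continuousOn hz.continuousOn
  have h0mem : (0 : ℝ) ∈ Icc 0 S := ⟨le_rfl, hs.1.trans hs.2⟩
  have hM0 : 0 ≤ M := (norm_nonneg _).trans (hM 0 h0mem)
  obtain ⟨L, hL, hen⟩ := hD.exists_energy_lipschitz hM0
  set e : ℝ → ℝ := fun r => D.energy (that r) (zhat r) with he
  have helip : LipschitzOnWith (L * (1 + K)).toNNReal e (Icc 0 S) := by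
    refine LipschitzOnWith.of_dist_le_mul fun p hp q hq => ?_
    rw [Real.coe_toNNReal _ (by positivity)]
    refine (hen _ (htT p hp) _ (htT q hq) _ _ (hM p hp) (hM q hq)).trans ?_
    have h1 := ht.dist_le_mul p hp q hq
    have h2 := hz.dist_le_mul p hp q hq
    rw [Real.dist_eq, NNReal.coe_one] at h1
    rw [dist_eq_norm] at h2
    rw [mul_assoc]
    exact mul_le_mul_of_nonneg_left (by linarith) hL.le
  have hac : AbsolutelyContinuousOnInterval e 0 s :=
    (helip.mono (by rw [uIcc_of_le hs.1]; exact Icc_subset_Icc_right hs.2))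
      |>.absolutelyContinuousOnInterval
  have hftc := hac.integral_deriv_eq_sub
  have hsub : Ioo 0 s ⊆ Ioo 0 S := Ioo_subset_Ioo_right hs.2
  have hii : ∀ g : ℝ → ℝ, IntegrableOn g (Ioo 0 S) → IntervalIntegrable g volume 0 s :=
    fun g hg => (intervalIntegrable_iff_integrableOn_Ioo_of_le hs.1).2 (hg.mono_set hsub)
  have hcontz : ContinuousOn (fun r => D.dzEnergy (that r) (zhat r)) (Icc 0 S) :=
    hD.continuousOn_dzEnergy_comp ht.continuousOn hz.continuousOn fun r hr => (htT r hr).1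
  have hforce : IntegrableOn (fun r => D.dzEnergy (that r) (zhat r) (deriv zhat r)) (Ioo 0 S) :=
    integrableOn_Ioo_clm_apply (hcontz.integrableOn_Icc.mono_set Ioo_subset_Icc_self)
      (stronglyMeasurable_deriv zhat).aestronglyMeasurable fun r hr => hz.norm_deriv_le_Ioo hr
  -- Integrability is inherited from the power of the force, with which the dissipation rate agrees
  -- almost everywhere.
  have hdiss : IntegrableOn (fun r => D.Rv (deriv zhat r) +
      D.normV (deriv zhat r) * D.stabDist (that r) (zhat r)) (Ioo 0 S) :=
    hforce.neg.congr (hbal.mono fun r hr => hr.symm)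
  have hchain : ∀ᵐ r ∂(volume.restrict (Ioo 0 S)), D.dtEnergy (that r) (zhat r) * deriv that r =
      deriv e r + (D.Rv (deriv zhat r) +
        D.normV (deriv zhat r) * D.stabDist (that r) (zhat r)) := by
    filter_upwards [ht.ae_differentiableAt_Ioo, hz.ae_differentiableAt_Ioo, hbal,
      ae_restrict_mem measurableSet_Ioo] with r h1 h2 h3 hr
    have h4 := (hD.hasDerivAt_energy_comp h1.hasDerivAt h2.hasDerivAt (by
      filter_upwards [Icc_mem_nhds hr.1 hr.2] with q hq using htT q hq)).deriv
    rw [h3, he, h4]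
    ring
  have hcongr : ∫ σ in (0 : ℝ)..s, D.dtEnergy (that σ) (zhat σ) * deriv that σ =
      ∫ σ in (0 : ℝ)..s, (deriv e σ + (D.Rv (deriv zhat σ) +
        D.normV (deriv zhat σ) * D.stabDist (that σ) (zhat σ))) := by
    rw [intervalIntegral.integral_of_le hs.1, intervalIntegral.integral_of_le hs.1,
      integral_Ioc_eq_integral_Ioo, integral_Ioc_eq_integral_Ioo]
    exact integral_congr_ae (ae_restrict_of_ae_restrict_of_subset hsub hchain)
  rw [hcongr, intervalIntegral.integral_add hac.intervalIntegrable_deriv (hii _ hdiss), hftc]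
  simp only [he]
  ring

/-- Weak* limits of the interpolants of a sequence of executions are solutions. -/
theorem isParamBVSolution_of_tendsto (hD : D.StandingAssumptions) {tol τ₁ : ℕ → ℝ}
    {a : ℕ → ℕ → AlgState V} (htol : ∀ n, 0 < tol n) (htol0 : Tendsto tol atTop (𝓝 0))
    (hτ₁ : ∀ n, 0 < τ₁ n) (ha : ∀ n, D.IsExecution (tol n) (τ₁ n) (a n)) {S : ℝ} {that : ℝ → ℝ}
    {zhat : ℝ → V} (hS : Tendsto (fun n => D.endParam (a n)) atTop (𝓝 S))
    (ht : TendstoWeakStarW1Inf S (fun n => D.tHat (a n)) that)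
    (hz : TendstoWeakStarW1Inf S (fun n => D.zHat (a n)) zhat) :
    D.IsParamBVSolution S that zhat := by
  have := hD.finiteDimensional
  obtain ⟨M, _, hM, hbound⟩ := hD.exists_endParam_bound
  obtain ⟨K, hK⟩ := hD.exists_lipschitzOnWith_zHat
  obtain ⟨B, hB⟩ := hD.exists_limit_local_balance
  have hTS : D.T ≤ S := ge_of_tendsto' hS fun n => (hbound _ _ _ (htol n) (hτ₁ n) (ha n)).2.1
  have hS0 : 0 < S := hD.T_pos.trans_le hTS
  have hlt : ∀ n, LipschitzOnWith 1 (D.tHat (a n)) (Icc 0 S) := fun n =>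
    (hD.lipschitzOnWith_tHat (htol n) (hτ₁ n) (ha n)).mono Icc_subset_Ici_self
  have hlz : ∀ n, LipschitzOnWith K (D.zHat (a n)) (Icc 0 S) := fun n =>
    (hK _ _ _ (htol n) (hτ₁ n) (ha n)).1.mono Icc_subset_Ici_self
  obtain ⟨_, _, -, htW, htL, -⟩ := ht
  obtain ⟨_, _, -, hzW, hzL, -⟩ := hz
  -- The common Lipschitz constants turn weak* convergence into pointwise convergence.
  have htc : ∀ s ∈ Icc 0 S, Tendsto (fun n => D.tHat (a n) s) atTop (𝓝 (that s)) :=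
    fun s hs => htL.tendsto_apply hS0 hlt htW.continuousOn hs
  have hzc : ∀ s ∈ Icc 0 S, Tendsto (fun n => D.zHat (a n) s) atTop (𝓝 (zhat s)) :=
    fun s hs => hzL.tendsto_apply hS0 hlz hzW.continuousOn hs
  have htlip : LipschitzOnWith 1 that (Icc 0 S) := LipschitzOnWith.of_tendsto (.of_forall hlt) htc
  have hzlip : LipschitzOnWith K zhat (Icc 0 S) := LipschitzOnWith.of_tendsto (.of_forall hlz) hzc
  have h0mem : (0 : ℝ) ∈ Icc 0 S := ⟨le_rfl, hS0.le⟩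
  have hSmem : S ∈ Icc 0 S := ⟨hS0.le, le_rfl⟩
  have ht0 : that 0 = 0 := tendsto_nhds_unique (htc 0 h0mem) (by
    simp only [fun n => hD.tHat_zero (htol n) (hτ₁ n) (ha n)]
    exact tendsto_const_nhds)
  have hz0 : zhat 0 = D.z₀ := tendsto_nhds_unique (hzc 0 h0mem) (by
    simp only [fun n => hD.zHat_zero (htol n) (hτ₁ n) (ha n)]
    exact tendsto_const_nhds)
  have htS : that S = D.T := by
    refine tendsto_nhds_unique (htc S hSmem) ?_
    -- Each time interpolant equals `T` at its own end parameter and is 1-Lipschitz, so its value at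
    -- `S` differs from `T` by at most the distance of the end parameters.
    rw [tendsto_iff_dist_tendsto_zero]
    refine squeeze_zero (fun _ => dist_nonneg) (fun n => ?_) (by
      simpa using (tendsto_const_nhds (x := S)).dist hS : Tendsto (fun n => dist S (D.endParam (a n)))
        atTop (𝓝 0))
    have hleast := (hbound _ _ _ (htol n) (hτ₁ n) (ha n)).1.1
    have h1 := (hD.lipschitzOnWith_tHat (htol n) (hτ₁ n) (ha n)).dist_le_mul S hS0.le
      (D.endParam (a n)) hleast.1
    rwa [hleast.2, NNReal.coe_one, one_mul] at h1
  have hmono : ∀ r s, 0 ≤ r → r ≤ s → s ≤ S → that r ≤ that s := fun r s hr hrs hs =>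
    le_of_tendsto_of_tendsto' (htc r ⟨hr, hrs.trans hs⟩) (htc s ⟨hr.trans hrs, hs⟩) fun n =>
      hD.tHat_mono (htol n) (hτ₁ n) (ha n) hr hrs
  have htT : ∀ s ∈ Icc 0 S, that s ∈ Icc 0 D.T := fun s hs =>
    ⟨ht0 ▸ hmono 0 s le_rfl hs.1 hs.2, htS ▸ hmono s S hs.1 hs.2 le_rfl⟩
  have hnorm : Continuous D.normV := continuous_normV
  have hinc : ∀ r s, 0 ≤ r → r ≤ s → s ≤ S →
      that s - that r + D.normV (zhat s - zhat r) ≤ s - r := fun r s hr hrs hs =>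
    le_of_tendsto' (((htc s ⟨hr.trans hrs, hs⟩).sub (htc r ⟨hr, hrs.trans hs⟩)).add
      ((hnorm.tendsto _).comp ((hzc s ⟨hr.trans hrs, hs⟩).sub (hzc r ⟨hr, hrs.trans hs⟩))))
      fun n => hD.increment_add_le (htol n) (hτ₁ n) (ha n) hr hrs
  have hloc := hB tol τ₁ a that zhat S htol htol0 hτ₁ ha htc hzc
  have hrates : ∀ᵐ s ∂(volume.restrict (Ioo 0 S)), (0 ≤ deriv that s ∧
      deriv that s + D.normV (deriv zhat s) ≤ 1) ∧
      deriv that s * D.stabDist (that s) (zhat s) = 0 ∧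
      D.Rv (deriv zhat s) + D.normV (deriv zhat s) * D.stabDist (that s) (zhat s) =
        -D.dzEnergy (that s) (zhat s) (deriv zhat s) := by
    filter_upwards [htlip.ae_differentiableAt_Ioo, hzlip.ae_differentiableAt_Ioo,
      ae_restrict_mem measurableSet_Ioo] with s hdt hdz hs
    have h1 : 0 ≤ deriv that s := by
      have := hdt.hasDerivAt.homogeneous_le (p := fun x => -x) (c := 0) (B := 0) continuous_neg
        (fun c _ v => by simp) hs.2 fun r hsr hr => by
          simpa using hmono s r hs.1.le hsr hr
      linarith
    have h2 : deriv that s + D.normV (deriv zhat s) ≤ 1 :=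
      (hdt.hasDerivAt.prodMk hdz.hasDerivAt).homogeneous_le (p := fun x => x.1 + D.normV x.2)
        (c := 1) (B := 0) (by fun_prop)
        (fun c hc v => by
          simp only [Prod.smul_fst, Prod.smul_snd, normV_smul, abs_of_nonneg hc, smul_eq_mul]
          ring) hs.2 fun r hsr hr => by
          simpa using hinc s r hs.1.le hsr hr
    have h3 : deriv that s * D.stabDist (that s) (zhat s) ≤ 0 :=
      hdt.hasDerivAt.homogeneous_le (p := fun x => x * D.stabDist (that s) (zhat s))
        (by fun_prop) (fun c _ v => by simp [mul_assoc]) hs.2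
        fun r hsr hr => (hloc s r hs.1.le hsr hr).2
    have h4 : D.Rv (deriv zhat s) + D.normV (deriv zhat s) * D.stabDist (that s) (zhat s) +
        D.dzEnergy (that s) (zhat s) (deriv zhat s) ≤ 0 := by
      have hR := hD.continuous_Rv
      refine hdz.hasDerivAt.homogeneous_le (p := fun v => D.Rv v +
        D.normV v * D.stabDist (that s) (zhat s) + D.dzEnergy (that s) (zhat s) v)
        (by fun_prop) (fun c hc v => ?_) hs.2 fun r hsr hr => (hloc s r hs.1.le hsr hr).1
      rw [hD.Rv_smul hc, normV_smul, abs_of_nonneg hc, map_smul, smul_eq_mul]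
      ring
    -- Duality is the reverse of `h4`; together they give the balance of forces.
    have h5 := hD.balance_defect_nonneg (that s) (zhat s) (deriv zhat s)
    exact ⟨⟨h1, h2⟩, le_antisymm h3 (mul_nonneg h1 (hD.stabDist_nonneg _ _)), by linarith⟩
  refine ⟨hTS, deriv that, deriv zhat, htlip.memW1Inf hS0.le, hzlip.memW1Inf hS0.le, hz0, ht0,
    htS, hrates.mono fun s hs => hs.1, hrates.mono fun s hs => hs.2.1, fun s hs => ?_⟩
  have h := hD.energy_balance htlip hzlip htT (hrates.mono fun s hs => hs.2.2) hs
  rwa [ht0, hz0] at h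

/-- Continuation by the initial value to negative parameters, which makes the compactness statement
for curves on the whole line applicable. -/
theorem _root_.LipschitzOnWith.comp_max_zero {E : Type*} [PseudoMetricSpace E] {u : ℝ → E}
    {K : NNReal} (hu : LipschitzOnWith K u (Ici 0)) : LipschitzWith K fun s => u (max s 0) := by
  refine LipschitzWith.of_dist_le_mul fun s r => ?_
  refine (hu.dist_le_mul (max s 0) (mem_Ici.2 (le_max_right s 0)) (max r 0)
    (mem_Ici.2 (le_max_right r 0))).trans ?_
  exact mul_le_mul_of_nonneg_left (abs_max_sub_max_le_abs s r 0) K.2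

/-- Compactness of the interpolants of a sequence of executions. -/
theorem exists_subseq_tendsto (hD : D.StandingAssumptions) {tol τ₁ : ℕ → ℝ}
    {a : ℕ → ℕ → AlgState V} (htol : ∀ n, 0 < tol n) (hτ₁ : ∀ n, 0 < τ₁ n)
    (ha : ∀ n, D.IsExecution (tol n) (τ₁ n) (a n)) :
    ∃ (φ : ℕ → ℕ) (S : ℝ) (that : ℝ → ℝ) (zhat : ℝ → V), StrictMono φ ∧
      Tendsto (fun n => D.endParam (a (φ n))) atTop (𝓝 S) ∧
      TendstoWeakStarW1Inf S (fun n => D.tHat (a (φ n))) that ∧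
      TendstoWeakStarW1Inf S (fun n => D.zHat (a (φ n))) zhat := by
  have := hD.finiteDimensional
  obtain ⟨M, S', hM, hbound⟩ := hD.exists_endParam_bound
  obtain ⟨K, hK⟩ := hD.exists_lipschitzOnWith_zHat
  have hlt := fun n => hD.lipschitzOnWith_tHat (htol n) (hτ₁ n) (ha n)
  have hlz := fun n => (hK _ _ _ (htol n) (hτ₁ n) (ha n)).1
  -- Three successive extractions: end parameters, times, states.
  obtain ⟨S, hSmem, φ, hφ, hS⟩ := (isCompact_Icc (a := D.T) (b := S')).tendsto_subseq
    (x := fun n => D.endParam (a n)) fun n =>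
      ⟨(hbound _ _ _ (htol n) (hτ₁ n) (ha n)).2.1, (hbound _ _ _ (htol n) (hτ₁ n) (ha n)).2.2.1⟩
  obtain ⟨ψ, that, hψ, ht⟩ := exists_subseq_tendsto_of_lipschitzWith (B := 0)
    (u := fun n s => D.tHat (a (φ n)) (max s 0)) (fun n => (hlt (φ n)).comp_max_zero)
    fun n => by rw [max_self, hD.tHat_zero (htol _) (hτ₁ _) (ha _), norm_zero]
  obtain ⟨χ, zhat, hχ, hz⟩ := exists_subseq_tendsto_of_lipschitzWith (B := M)
    (u := fun n s => D.zHat (a (φ (ψ n))) (max s 0)) (fun n => (hlz (φ (ψ n))).comp_max_zero)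
    fun n => (hbound _ _ _ (htol _) (hτ₁ _) (ha _)).2.2.2 _ (le_max_right _ _)
  have hS0 : 0 ≤ S := hD.T_pos.le.trans hSmem.1
  refine ⟨fun n => φ (ψ (χ n)), S, that, zhat, hφ.comp (hψ.comp hχ),
    hS.comp (hψ.comp hχ).tendsto_atTop, ?_, ?_⟩
  · refine tendstoWeakStarW1Inf_of_pointwise hS0
      (fun n => (hlt (φ (ψ (χ n)))).mono Icc_subset_Ici_self) fun s hs => ?_
    have h := (ht s).comp hχ.tendsto_atTop
    simpa only [Function.comp_def, max_eq_left hs.1] using h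
  · refine tendstoWeakStarW1Inf_of_pointwise hS0
      (fun n => (hlz (φ (ψ (χ n)))).mono Icc_subset_Ici_self) fun s hs => ?_
    have h := hz s
    simpa only [max_eq_left hs.1] using h

end StandingAssumptions

end RISData

theorem theorem5p4 {V W X : Type*}
    [NormedAddCommGroup V] [InnerProductSpace ℝ V] [CompleteSpace V]
    [NormedAddCommGroup W] [NormedSpace ℝ W] [CompleteSpace W]
    [NormedAddCommGroup X] [NormedSpace ℝ X] [CompleteSpace X]
    (D : RISData V W X) (hD : D.StandingAssumptions) :
    -- the scheme can be run
    (∀ tol τ₁ : ℝ, 0 < tol → 0 < τ₁ → ∃ a : ℕ → AlgState V, D.IsExecution tol τ₁ a) ∧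
    ∀ (tol τ₁ : ℕ → ℝ), (∀ n, 0 < tol n) → Tendsto tol atTop (𝓝 0) → (∀ n, 0 < τ₁ n) →
      ∀ a : ℕ → ℕ → AlgState V, (∀ n, D.IsExecution (tol n) (τ₁ n) (a n)) →
        -- every execution reaches the final time, and the end parameter is attained
        (∀ n, (∃ j, D.T ≤ (a n j).t) ∧
          IsLeast {s | 0 ≤ s ∧ D.tHat (a n) s = D.T} (D.endParam (a n))) ∧
        -- a subsequence converges
        (∃ (φ : ℕ → ℕ) (S : ℝ) (that : ℝ → ℝ) (zhat : ℝ → V), StrictMono φ ∧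
          Tendsto (fun n => D.endParam (a (φ n))) atTop (𝓝 S) ∧
          TendstoWeakStarW1Inf S (fun n => D.tHat (a (φ n))) that ∧
          TendstoWeakStarW1Inf S (fun n => D.zHat (a (φ n))) zhat) ∧
        -- every weak* limit is a solution
        (∀ (φ : ℕ → ℕ) (S : ℝ) (that : ℝ → ℝ) (zhat : ℝ → V), StrictMono φ →
          Tendsto (fun n => D.endParam (a (φ n))) atTop (𝓝 S) →
          TendstoWeakStarW1Inf S (fun n => D.tHat (a (φ n))) that →
          TendstoWeakStarW1Inf S (fun n => D.zHat (a (φ n))) zhat →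
          D.IsParamBVSolution S that zhat) := by
  refine ⟨fun tol τ₁ _ hτ₁ => hD.exists_execution tol hτ₁, ?_⟩
  intro tol τ₁ htol htol0 hτ₁ a ha
  obtain ⟨_, _, _, hbound⟩ := hD.exists_endParam_bound
  exact ⟨fun n => ⟨hD.exists_final (htol n) (hτ₁ n) (ha n),
      (hbound _ _ _ (htol n) (hτ₁ n) (ha n)).1⟩,
    hD.exists_subseq_tendsto htol hτ₁ ha,
    fun φ S that zhat hφ hS ht hz => hD.isParamBVSolution_of_tendsto (fun n => htol (φ n))
      (htol0.comp hφ.tendsto_atTop) (fun n => hτ₁ (φ n)) (fun n => ha (φ n)) hS ht hz⟩
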